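/- Let $\Bbbk$ be an algebraically closed field of characteristic $0$ and $\mathcal C$ a premodular category over $\Bbbk$, i.e. a ribbon fusion category, with braiding $c_{A,B}:A\otimes B\to B\otimes A$, duals $\mathrm{ev}_X:X^*\otimes X\to\mathbf 1$, $\mathrm{coev}_X:\mathbf 1\to X\otimes X^*$, and $\widetilde{\mathrm{ev}}_X:X\otimes X^*\to\mathbf 1$, $\widetilde{\mathrm{coev}}_X:\mathbf 1\to X^*\otimes X$ obtained from the pivotal structure. Associativity and unit isomorphisms of $\mathcal C$ are suppressed. Let $X_i$ $(i\in I)$ be representatives of the simple objects, $d_i=\dim X_i$, fix square roots $\sqrt{d_i}$, and assume $\mathcal D=\sum_i d_i^2\neq0$. For an object $M$ and $j\in I$ let $\{\varphi_\alpha\}\subset\mathrm{Hom}(M,X_j)$, $\{\varphi^\alpha\}\subset\mathrm{Hom}(X_j,M)$ be bases with $\mathrm{tr}(\varphi_\beta\circ\varphi^\alpha)=\delta_{\alpha\beta}$. **Centers.** A half-braiding on $X$ is a natural isomorphism $\lambda_A:A\otimes X\to X\otimes A$ with $\lambda_{A\otimes B}=(\lambda_A\otimes B)(A\otimes\lambda_B)$.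 $\mathcal Z(\mathcal C)$ is the Drinfeld center (objects $(X,\lambda)$), with its usual tensor product $(X\otimes Y,\lambda\otimes\mu)$, $(\lambda\otimes\mu)_A=(X\otimes\mu_A)(\lambda_A\otimes Y)$. Objects of $\mathcal Z^{\mathrm{el}}(\mathcal C)$ are triples $(X,\lambda^1,\lambda^2)$ with half-braidings $\lambda^1,\lambda^2$ on $X$ such that for all $A,B$ $$(X\otimes c_{A,B})(\lambda^1_A\otimes B)(A\otimes\lambda^2_B)=(\lambda^2_B\otimes A)(B\otimes\lambda^1_A)(c_{B,A}^{-1}\otimes X);$$ its morphisms are the morphisms of $\mathcal C$ that intertwine both half-braidings. **Induction.** $\mathcal I_1:\mathcal Z(\mathcal C)\to\mathcal Z^{\mathrm{el}}(\mathcal C)$ sends $(X,\lambda)$ to $\big(\bigoplus_iX_i\otimes X\otimes X_i^*,\Gamma,\widetilde\lambda\big)$ and $f$ to $\bigoplus_i\mathrm{id}_{X_i}\otimes f\otimes\mathrm{id}_{X_i^*}$. Here $\Gamma_A$ has components $$\sum_\alpha\sqrt{d_i}\sqrt{d_j}\;\varphi_\alpha\otimes\mathrm{id}_X\otimes\widehat{\varphi^\alpha}:A\otimes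 X_i\otimes X\otimes X_i^*\to X_j\otimes X\otimes X_j^*\otimes A,$$ the sum being over dual bases of $\mathrm{Hom}(A\otimes X_i,X_j)$ and $\mathrm{Hom}(X_j,A\otimes X_i)$, and $\widehat{\varphi^\alpha}:X_i^*\to X_j^*\otimes A$ being $\varphi^\alpha$ bent by $\widetilde{\mathrm{coev}}_{X_j}$ and $\widetilde{\mathrm{ev}}_{X_i}$; and $\widetilde\lambda_A$ passes $A$ successively across $X_i$, $X$, $X_i^*$ by $c_{A,X_i}$, $\lambda_A$, $c_{X_i^*,A}^{-1}$. **Reduced tensor product.** For half-braidings $\lambda,\mu$ on $X,Y$ let $Q_{\lambda,\mu}:X\otimes Y\to X\otimes Y$ be $\frac1{\mathcal D}\sum_id_i$ times the composite $$X Y\xrightarrow{\mathrm{coev}}X_iX_i^*XY\xrightarrow{\lambda_{X_i^*}}X_iXX_i^*Y\xrightarrow{c_{X,X_i}^{-1}\otimes c_{X_i^*,Y}}XX_iYX_i^*\xrightarrow{\mu_{X_i}}XYX_iX_i^*\xrightarrow{\widetilde{\mathrm{ev}}}XY.$$ It is idempotent. The tensor product of $(X,\lambda^1,\lambda^2)$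 and $(Y,\mu^1,\mu^2)$ in $\mathcal Z^{\mathrm{el}}(\mathcal C)$ is $(\mathrm{im}\,Q_{\lambda^1,\mu^1},\lambda^1\overline\otimes\mu^1,\lambda^2\otimes\mu^2)$, where $\lambda^1\overline\otimes\mu^1$ and $\lambda^2\otimes\mu^2$ are the compressions to the image of $(X\otimes c_{A,Y})(\lambda^1_A\otimes Y)$ and of $(X\otimes\mu^2_A)(\lambda^2_A\otimes Y)$. The tensor product of morphisms and the associativity constraint are induced by those of $\mathcal C$; the unit is $\mathbf 1^{\mathrm{el}}=\mathcal I_1(\mathbf 1,\mathrm{id}_-)$; for a fixed normalization $0\ne\kappa\in\Bbbk$ the unit constraints $l$, $r$ are induced by $\kappa\sum_i\sqrt{d_i}$ times $$X_iX_i^*X\xrightarrow{c_{X_i^*,X}}X_iXX_i^*\xrightarrow{\lambda^1_{X_i}}XX_iX_i^*\xrightarrow{\widetilde{\mathrm{ev}}}X,\qquad XX_iX_i^*\xrightarrow{c_{X,X_i}}X_iXX_i^*\xrightarrow{\lambda^1_{X_i}}XX_iX_i^*\xrightarrow{\widetilde{\mathrm{ev}}}X.$$ **Statement.** All of the above is well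 defined: $\mathcal I_1$ is a functor to $\mathcal Z^{\mathrm{el}}(\mathcal C)$ and $\mathcal Z^{\mathrm{el}}(\mathcal C)$ is a monoidal category. Let $J_{X,Y}:\mathcal I_1(X,\lambda)\otimes\mathcal I_1(Y,\mu)\to\mathcal I_1((X,\lambda)\otimes(Y,\mu))$ be induced by the morphism with components $\kappa\sqrt{d_i}\sqrt{d_j}\sqrt{d_l}$ times $$X_iXX_i^*X_jYX_j^*\xrightarrow{c_{X_i^*,\,X_jYX_j^*}}X_iXX_jYX_j^*X_i^*\xrightarrow{c_{X,X_j}}X_iX_jXYX_j^*X_i^*\xrightarrow{\sum_\alpha\varphi_\alpha\otimes\mathrm{id}_{XY}\otimes(\varphi^\alpha)^*}X_lXYX_l^*,$$ the sum being over dual bases of $\mathrm{Hom}(X_iX_j,X_l)$ and $\mathrm{Hom}(X_l,X_iX_j)$. Then $(\mathcal I_1,J):\mathcal Z(\mathcal C)\to\mathcal Z^{\mathrm{el}}(\mathcal C)$ is a (strong) monoidal functor, whose unit isomorphism $\mathbf 1^{\mathrm{el}}\to\mathcal I_1(\mathbf 1)$ is the identity. -/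

import Mathlib

open CategoryTheory MonoidalCategory Limits

universe w v u

namespace EllipticCenter

noncomputable section

attribute [local instance] Abelian.hasFiniteBiproducts

/-! ### Premodular (ribbon fusion) categories -/

/-- A ribbon structure on a braided rigid monoidal category: a twist `θ`, i.e. a natural
automorphism of the identity functor with `θ_{X ⊗ Y} = c_{Y,X} ∘ c_{X,Y} ∘ (θ_X ⊗ θ_Y)` and
`θ_{X*} = (θ_X)*`. The dual `X*` is `Xᘁ`, with `ev_X : X* ⊗ X ⟶ 𝟙` and
`coev_X : 𝟙 ⟶ X ⊗ X*`; the braiding `c_{A,B} : A ⊗ B ⟶ B ⊗ A` is `(β_ A B).hom`. -/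
class RibbonCategory (C : Type u) [Category.{v} C] [MonoidalCategory C] [RigidCategory C]
    [BraidedCategory C] where
  twist : ∀ X : C, X ≅ X
  twist_naturality : ∀ {X Y : C} (f : X ⟶ Y), f ≫ (twist Y).hom = (twist X).hom ≫ f
  twist_tensor : ∀ X Y : C, (twist (X ⊗ Y)).hom =
    ((twist X).hom ⊗ₘ (twist Y).hom) ≫ (β_ X Y).hom ≫ (β_ Y X).hom
  twist_dual : ∀ X : C, (twist Xᘁ).hom = (twist X).homᘁ

/-- A `k`-linear abelian rigid monoidal category is fusion if its Hom spaces are finite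
dimensional, its unit is simple, every object is a finite direct sum of simple objects, and there
are finitely many simple objects up to isomorphism. -/
class FusionCategory (k : Type w) (C : Type u) [Field k] [Category.{v} C] [Abelian C] [Linear k C]
    [MonoidalCategory C] [MonoidalPreadditive C] [MonoidalLinear k C] [RigidCategory C] :
    Prop where
  finiteDimensional_hom : ∀ X Y : C, FiniteDimensional k (X ⟶ Y)
  simple_unit : Simple (𝟙_ C)
  semisimple : ∀ X : C, ∃ (n : ℕ) (T : Fin n → C), (∀ i, Simple (T i)) ∧ Nonempty (X ≅ ⨁ T)
  finite_simples : ∃ (n : ℕ) (T : Fin n → C), ∀ X : C, Simple X → ∃ i, Nonempty (X ≅ T i)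

attribute [instance] FusionCategory.finiteDimensional_hom FusionCategory.simple_unit

/-! ### Half-braidings and the elliptic Drinfeld center -/

section Elliptic

variable {C : Type u} [Category.{v} C] [MonoidalCategory C]

/-- A family of morphisms `σ_A : A ⊗ X ⟶ X ⊗ A`, the underlying datum of a half-braiding on `X`. -/
abbrev HalfFamily (X : C) := ∀ A : C, A ⊗ X ⟶ X ⊗ A

/-- The half-braiding `λ_A : A ⊗ X ⟶ X ⊗ A` of an object `(X, λ)` of the Drinfeld center. Mathlib's
`HalfBraiding X` consists of isomorphisms `X ⊗ A ≅ A ⊗ X`; `λ_A` is the inverse. -/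
def centerFamily (X : Center C) : HalfFamily X.1 := fun A => (X.2.β A).inv

/-- `σ` is a half-braiding: an invertible natural family compatible with tensor products,
`σ_{A ⊗ B} = (σ_A ⊗ B) ∘ (A ⊗ σ_B)`. -/
def IsHalfBraiding {X : C} (σ : HalfFamily X) : Prop :=
  ∃ b : HalfBraiding X, ∀ A, σ A = (b.β A).inv

/-- The half-braiding `σ ⊗ τ` on `X ⊗ Y`: pass `X` with `σ`, then `Y` with `τ`. -/
def tensorFamily {X Y : C} (σ : HalfFamily X) (τ : HalfFamily Y) : HalfFamily (X ⊗ Y) := fun A =>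
  (α_ A X Y).inv ≫ σ A ▷ Y ≫ (α_ X A Y).hom ≫ X ◁ τ A ≫ (α_ X Y A).inv

/-- `f : X ⟶ Y` intertwines the families `σ` on `X` and `τ` on `Y`. -/
def Intertwines {X Y : C} (σ : HalfFamily X) (τ : HalfFamily Y) (f : X ⟶ Y) : Prop :=
  ∀ A : C, A ◁ f ≫ τ A = σ A ≫ f ▷ A

theorem Intertwines.id {X : C} (σ : HalfFamily X) : Intertwines σ σ (𝟙 X) := by
  intro A; simp

theorem Intertwines.comp {X Y Z : C} {σ : HalfFamily X} {τ : HalfFamily Y} {ρ : HalfFamily Z}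
    {f : X ⟶ Y} {g : Y ⟶ Z} (hf : Intertwines σ τ f) (hg : Intertwines τ ρ g) :
    Intertwines σ ρ (f ≫ g) := by
  intro A
  rw [MonoidalCategory.whiskerLeft_comp, Category.assoc, hg A, ← Category.assoc, hf A]
  simp

theorem Intertwines.inv {X Y : C} {σ : HalfFamily X} {τ : HalfFamily Y} {f : X ⟶ Y} [IsIso f]
    (hf : Intertwines σ τ f) : Intertwines τ σ (CategoryTheory.inv f) := by
  intro A
  rw [← cancel_epi (A ◁ f), ← Category.assoc, ← MonoidalCategory.whiskerLeft_comp,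
    ← Category.assoc, hf A, Category.assoc, ← comp_whiskerRight]
  simp

variable (C) in
/-- An object with two families; no axioms yet. -/
structure EllipticDatum where
  pt : C
  fst : HalfFamily pt
  snd : HalfFamily pt

variable [BraidedCategory C]

/-- The universal half-braiding `c_{-,X}`. -/
def braidFamily (X : C) : HalfFamily X := fun A => (β_ A X).hom

/-- The condition COMM on an ordered pair of families, an equality of morphisms
`A ⊗ (B ⊗ X) ⟶ (X ⊗ B) ⊗ A`:
`(X ⊗ c_{A,B}) (σ_A ⊗ B) (A ⊗ τ_B) = (τ_B ⊗ A) (B ⊗ σ_A) (c_{B,A}⁻¹ ⊗ X)`. -/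
def Comm {X : C} (σ τ : HalfFamily X) : Prop :=
  ∀ A B : C,
    A ◁ τ B ≫ (α_ A X B).inv ≫ σ A ▷ B ≫ (α_ X A B).hom ≫ X ◁ (β_ A B).hom ≫ (α_ X B A).inv =
      (α_ A B X).inv ≫ (β_ B A).inv ▷ X ≫ (α_ B A X).hom ≫ B ◁ σ A ≫ (α_ B X A).inv ≫ τ B ▷ A

/-- The conditions for a datum to be an object of the elliptic Drinfeld center. -/
structure EllipticDatum.IsElliptic (P : EllipticDatum C) : Prop where
  fst_isHalfBraiding : IsHalfBraiding P.fst
  snd_isHalfBraiding : IsHalfBraiding P.snd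
  comm : Comm P.fst P.snd

variable (C) in
/-- Objects `(X, λ¹, λ²)` of the elliptic Drinfeld center. -/
structure ZEl extends EllipticDatum C where
  isElliptic : toEllipticDatum.IsElliptic

/-- Morphisms of the elliptic Drinfeld center: those of `C` that intertwine both
half-braidings. -/
@[ext]
structure ZEl.Hom (P R : ZEl C) where
  f : P.pt ⟶ R.pt
  fst_comm : Intertwines P.fst R.fst f
  snd_comm : Intertwines P.snd R.snd f

instance : Category (ZEl C) where
  Hom := ZEl.Hom
  id P := ⟨𝟙 P.pt, .id _, .id _⟩
  comp g h := ⟨g.f ≫ h.f, g.fst_comm.comp h.fst_comm, g.snd_comm.comp h.snd_comm⟩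
  id_comp _ := ZEl.Hom.ext (Category.id_comp _)
  comp_id _ := ZEl.Hom.ext (Category.comp_id _)
  assoc _ _ _ := ZEl.Hom.ext (Category.assoc _ _ _)

/-- `f` underlies an isomorphism of data. -/
structure IsDatumIso (P R : EllipticDatum C) (f : P.pt ⟶ R.pt) : Prop where
  isIso : IsIso f
  fst_comm : Intertwines P.fst R.fst f
  snd_comm : Intertwines P.snd R.snd f

/-- The isomorphism of the elliptic Drinfeld center with a given underlying morphism. -/
def ZEl.isoMk {P R : ZEl C} (f : P.pt ⟶ R.pt)
    (h : IsDatumIso P.toEllipticDatum R.toEllipticDatum f) : P ≅ R :=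
  haveI := h.isIso
  { hom := ⟨f, h.fst_comm, h.snd_comm⟩
    inv := ⟨CategoryTheory.inv f, h.fst_comm.inv, h.snd_comm.inv⟩
    hom_inv_id := ZEl.Hom.ext (IsIso.hom_inv_id f)
    inv_hom_id := ZEl.Hom.ext (IsIso.inv_hom_id f) }

end Elliptic

/-! ### Traces and dimensions -/

section Trace

variable {C : Type u} [Category.{v} C] [MonoidalCategory C] [RigidCategory C] [BraidedCategory C]
  [RibbonCategory C]

/-- `X ⊗ X* ⟶ 𝟙`, i.e. `ev_{X*}` through the pivotal structure `X ≅ X**` given by the twist. -/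
def evTilde (X : C) : X ⊗ Xᘁ ⟶ 𝟙_ C :=
  (RibbonCategory.twist X).hom ▷ Xᘁ ≫ (β_ X Xᘁ).hom ≫ ε_ X Xᘁ

/-- `𝟙 ⟶ X* ⊗ X`, i.e. `coev_{X*}` through the pivotal structure `X ≅ X**`. -/
def coevTilde (X : C) : 𝟙_ C ⟶ Xᘁ ⊗ X :=
  η_ X Xᘁ ≫ (β_ X Xᘁ).hom ≫ Xᘁ ◁ (RibbonCategory.twist X).hom

/-- The categorical trace, as an endomorphism of the unit. -/
def traceEnd {X : C} (f : X ⟶ X) : 𝟙_ C ⟶ 𝟙_ C :=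
  η_ X Xᘁ ≫ f ▷ Xᘁ ≫ evTilde X

end Trace

section Dimension

variable (k : Type w) [Field k] [IsAlgClosed k]
  {C : Type u} [Category.{v} C] [Abelian C] [Linear k C] [MonoidalCategory C]
  [MonoidalPreadditive C] [MonoidalLinear k C] [RigidCategory C] [BraidedCategory C]
  [RibbonCategory C] [FusionCategory k C]

/-- The identification `End(𝟙) = k`: the scalar `t` with `t • id = a`. -/
def unitScalar (a : 𝟙_ C ⟶ 𝟙_ C) : k := (endomorphism_simple_eq_smul_id k a).choose

/-- The categorical trace as a scalar. -/
def trace {X : C} (f : X ⟶ X) : k := unitScalar k (traceEnd f)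

/-- The categorical dimension. -/
def catDim (X : C) : k := trace k (𝟙 X)

/-- A pair of bases `φ_α` of `Hom(M, T)` and `φ^α` of `Hom(T, M)`, dual for the trace pairing. -/
structure DualBases (M T : C) where
  n : ℕ
  φ : Module.Basis (Fin n) k (M ⟶ T)
  ψ : Module.Basis (Fin n) k (T ⟶ M)
  dual : ∀ a b, trace k (ψ a ≫ φ b) = if a = b then 1 else 0

/-- `S` is a complete irredundant list of representatives of the simple objects. -/
structure IsSimpleReps {I : Type*} (S : I → C) : Prop where
  simple : ∀ i, Simple (S i)
  eq_of_iso : ∀ i j, Nonempty (S i ≅ S j) → i = j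
  exists_iso : ∀ X : C, Simple X → ∃ i, Nonempty (X ≅ S i)

end Dimension

/-- The auxiliary choices that enter the formulas: representatives `S i` of the simple objects,
square roots of their dimensions, and pairs of dual bases of the spaces `Hom(A ⊗ S i, S j)`. -/
structure Choices (k : Type w) [Field k] [IsAlgClosed k]
    (C : Type u) [Category.{v} C] [Abelian C] [Linear k C] [MonoidalCategory C]
    [MonoidalPreadditive C] [MonoidalLinear k C] [RigidCategory C] [BraidedCategory C]
    [RibbonCategory C] [FusionCategory k C] where
  I : Type
  [fintype : Fintype I]
  S : I → C
  isSimpleReps : IsSimpleReps S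
  sqrtDim : I → k
  sqrtDim_sq : ∀ i, sqrtDim i ^ 2 = catDim k (S i)
  bases : ∀ (A : C) (i j : I), DualBases k (A ⊗ S i) (S j)

attribute [instance] Choices.fintype

section Existence

theorem unitScalar_spec (k : Type w) [Field k] [IsAlgClosed k] {C : Type u} [Category.{v} C]
    [Abelian C] [Linear k C] [MonoidalCategory C] [MonoidalPreadditive C] [MonoidalLinear k C]
    [RigidCategory C] [FusionCategory k C]
    (a : 𝟙_ C ⟶ 𝟙_ C) : unitScalar k a • 𝟙 (𝟙_ C) = a :=
  (endomorphism_simple_eq_smul_id k a).choose_spec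

/-- A nonzero morphism to a simple object has a section. -/
theorem exists_section (k : Type w) [Field k] {C : Type u} [Category.{v} C] [Abelian C]
    [Linear k C] [MonoidalCategory C] [MonoidalPreadditive C] [MonoidalLinear k C]
    [RigidCategory C] [FusionCategory k C]
    {M T : C} [Simple T] (f : M ⟶ T) (hf : f ≠ 0) :
    ∃ g : T ⟶ M, g ≫ f = 𝟙 T := by
  obtain ⟨n, U, hU, ⟨e⟩⟩ := FusionCategory.semisimple (k := k) M
  obtain ⟨i, hi⟩ : ∃ i, biproduct.ι U i ≫ e.inv ≫ f ≠ 0 := by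
    by_contra! h
    apply hf
    rw [← cancel_epi e.inv]
    exact biproduct.hom_ext' _ _ (by simpa using h)
  have := hU i
  have := isIso_of_hom_simple hi
  exact ⟨inv (biproduct.ι U i ≫ e.inv ≫ f) ≫ biproduct.ι U i ≫ e.inv, by
    rw [Category.assoc, Category.assoc, IsIso.inv_hom_id]⟩

/-- A nonzero morphism from a simple object has a retraction. -/
theorem exists_retraction (k : Type w) [Field k] {C : Type u} [Category.{v} C] [Abelian C]
    [Linear k C] [MonoidalCategory C] [MonoidalPreadditive C] [MonoidalLinear k C]
    [RigidCategory C] [FusionCategory k C]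
    {M T : C} [Simple T] (f : T ⟶ M) (hf : f ≠ 0) :
    ∃ g : M ⟶ T, f ≫ g = 𝟙 T := by
  obtain ⟨n, U, hU, ⟨e⟩⟩ := FusionCategory.semisimple (k := k) M
  obtain ⟨i, hi⟩ : ∃ i, f ≫ e.hom ≫ biproduct.π U i ≠ 0 := by
    by_contra! h
    apply hf
    rw [← cancel_mono e.hom]
    exact biproduct.hom_ext _ _ (by simpa using h)
  have := hU i
  have := isIso_of_hom_simple hi
  exact ⟨e.hom ≫ biproduct.π U i ≫ inv (f ≫ e.hom ≫ biproduct.π U i), by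
    rw [← Category.assoc, ← Category.assoc]
    simp only [Category.assoc]
    rw [← Category.assoc (e.hom), ← Category.assoc f, IsIso.hom_inv_id]⟩

variable (k : Type w) [Field k] [IsAlgClosed k]
  {C : Type u} [Category.{v} C] [Abelian C] [Linear k C] [MonoidalCategory C]
  [MonoidalPreadditive C] [MonoidalLinear k C] [RigidCategory C] [BraidedCategory C]
  [RibbonCategory C] [FusionCategory k C]

set_option linter.unusedSectionVars false in
theorem unitScalar_eq {a : 𝟙_ C ⟶ 𝟙_ C} {t : k} (h : t • 𝟙 (𝟙_ C) = a) : unitScalar k a = t :=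
  smul_left_injective k (id_nonzero (𝟙_ C)) ((unitScalar_spec k a).trans h.symm)

/-- The trace as a linear map. -/
def traceLinear (X : C) : (X ⟶ X) →ₗ[k] k where
  toFun := trace k
  map_add' f g := unitScalar_eq k (by
    simp only [trace, add_smul, unitScalar_spec, traceEnd, MonoidalPreadditive.add_whiskerRight,
      Preadditive.add_comp, Preadditive.comp_add])
  map_smul' t f := unitScalar_eq k (by
    simp only [trace, RingHom.id_apply, smul_eq_mul, mul_smul, unitScalar_spec, traceEnd,
      MonoidalLinear.smul_whiskerRight, Linear.smul_comp, Linear.comp_smul])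

/-- Simple objects have nonzero dimension. -/
theorem catDim_ne_zero (T : C) [Simple T] : catDim k T ≠ 0 := by
  have hη : η_ T Tᘁ ≠ 0 := by
    intro h
    apply id_nonzero T
    have := ExactPairing.evaluation_coevaluation T Tᘁ
    rw [h] at this
    simp only [MonoidalPreadditive.zero_whiskerRight, zero_comp] at this
    rw [← cancel_epi (λ_ T).hom, ← cancel_mono (ρ_ T).inv]
    simp [← this]
  obtain ⟨p, hp⟩ := exists_retraction k (η_ T Tᘁ) hη
  let u : T ⊗ Tᘁ ≅ Tᘁ ⊗ T := whiskerRightIso (RibbonCategory.twist T) Tᘁ ≪≫ β_ T Tᘁ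
  have hu : evTilde T = u.hom ≫ ε_ T Tᘁ := by simp [evTilde, u]
  obtain ⟨t, ht⟩ := endomorphism_simple_eq_smul_id k
    (tensorLeftHomEquiv T T Tᘁ (𝟙_ C) (u.inv ≫ p) ≫ (ρ_ T).hom)
  have h1 : u.inv ≫ p = t • ε_ T Tᘁ := by
    apply (tensorLeftHomEquiv T T Tᘁ (𝟙_ C)).injective
    rw [← cancel_mono (ρ_ T).hom, ← ht]
    have := ExactPairing.evaluation_coevaluation T Tᘁ
    simp [tensorLeftHomEquiv, this]
  have h2 : p = t • evTilde T := by
    rw [hu, ← Linear.comp_smul, ← h1]; simp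
  intro h0
  apply id_nonzero (𝟙_ C)
  have h3 : η_ T Tᘁ ≫ evTilde T = 0 := by
    have := unitScalar_spec k (traceEnd (𝟙 T))
    rw [show unitScalar k (traceEnd (𝟙 T)) = 0 from h0] at this
    simpa [traceEnd] using this.symm
  rw [← hp, h2, Linear.comp_smul, h3, smul_zero]

/-- The trace pairing `Hom(T, M) × Hom(M, T) ⟶ k`. -/
def tracePairing (M T : C) : (T ⟶ M) →ₗ[k] (M ⟶ T) →ₗ[k] k :=
  LinearMap.compr₂ (Linear.comp (S := k) T M T) (traceLinear k T)

theorem tracePairing_apply {M T : C} (f : T ⟶ M) (g : M ⟶ T) :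
    tracePairing k M T f g = trace k (f ≫ g) := rfl

/-- The trace pairing with a simple object is perfect, so that dual bases exist. -/
theorem nonempty_dualBases (M T : C) [Simple T] : Nonempty (DualBases k M T) := by
  have h1 : Function.Injective (tracePairing k M T) := by
    rw [injective_iff_map_eq_zero]
    intro f hf
    by_contra h
    obtain ⟨g, hg⟩ := exists_retraction k f h
    have := LinearMap.congr_fun hf g
    rw [tracePairing_apply, hg] at this
    exact catDim_ne_zero k T this
  have h2 : Function.Injective (tracePairing k M T).flip := by
    rw [injective_iff_map_eq_zero]
    intro f hf
    by_contra h
    obtain ⟨g, hg⟩ := exists_section k f h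
    have := LinearMap.congr_fun hf g
    rw [LinearMap.flip_apply, tracePairing_apply, hg] at this
    exact catDim_ne_zero k T this
  have h3 := LinearMap.finrank_le_finrank_of_injective h1
  have h4 := LinearMap.finrank_le_finrank_of_injective h2
  rw [Subspace.dual_finrank_eq] at h3 h4
  let b := Module.finBasis k (M ⟶ T)
  let e := LinearEquiv.ofInjectiveOfFinrankEq (tracePairing k M T) h1
    (by rw [Subspace.dual_finrank_eq]; exact le_antisymm h3 h4)
  refine ⟨⟨_, b, b.dualBasis.map e.symm, fun i j => ?_⟩⟩
  rw [← tracePairing_apply]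
  have : tracePairing k M T (e.symm (b.dualBasis i)) = b.dualBasis i := e.apply_symm_apply _
  rw [Module.Basis.map_apply, this, Module.Basis.dualBasis_apply_self]
  simp [eq_comm]

variable (C) in
/-- The auxiliary choices can be made. -/
theorem nonempty_choices : Nonempty (Choices k C) := by
  classical
  obtain ⟨n, T, hT⟩ := FusionCategory.finite_simples (k := k) (C := C)
  let s : Setoid {i : Fin n // Simple (T i)} :=
    { r := fun i j => Nonempty (T i ≅ T j)
      iseqv := ⟨fun _ => ⟨Iso.refl _⟩, fun ⟨e⟩ => ⟨e.symm⟩, fun ⟨e⟩ ⟨f⟩ => ⟨e.trans f⟩⟩ }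
  have hS : ∀ q : _root_.Quotient s, Simple (T q.out) := fun q => q.out.2
  refine ⟨{ I := _root_.Quotient s
            fintype := Fintype.ofFinite _
            S := fun q => T q.out
            isSimpleReps := ⟨hS, fun i j h => ?_, fun X hX => ?_⟩
            sqrtDim := fun q => (IsAlgClosed.exists_pow_nat_eq (catDim k (T q.out)) two_pos).choose
            sqrtDim_sq := fun q =>
              (IsAlgClosed.exists_pow_nat_eq (catDim k (T q.out)) two_pos).choose_spec
            bases := fun A i j => haveI := hS j; (nonempty_dualBases k _ _).some }⟩
  · rw [← _root_.Quotient.out_eq i, ← _root_.Quotient.out_eq j]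
    exact _root_.Quotient.sound h
  · obtain ⟨i, ⟨e⟩⟩ := hT X hX
    have hi : Simple (T i) := Simple.of_iso e.symm
    obtain ⟨f⟩ : Nonempty (T (_root_.Quotient.out (_root_.Quotient.mk s ⟨i, hi⟩)).1 ≅ T i) :=
      _root_.Quotient.mk_out (s := s) ⟨i, hi⟩
    exact ⟨_root_.Quotient.mk s ⟨i, hi⟩, ⟨e.trans f.symm⟩⟩

end Existence

section Constructions

variable {k : Type w} [Field k] [IsAlgClosed k]
  {C : Type u} [Category.{v} C] [Abelian C] [Linear k C] [MonoidalCategory C]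
  [MonoidalPreadditive C] [MonoidalLinear k C] [RigidCategory C] [BraidedCategory C]
  [RibbonCategory C] [FusionCategory k C] (D : Choices k C)

/-- The dimension `𝒟 = ∑ d_i²` of the category. -/
def Choices.globalDim : k := ∑ i, catDim k (D.S i) ^ 2

/-! ### The induction functor `I₁` -/

/-- The object `⨁ᵢ Sᵢ ⊗ X ⊗ Sᵢ*`. -/
abbrev Choices.indObj (X : C) : C := ⨁ fun i => D.S i ⊗ X ⊗ (D.S i)ᘁ

/-- The morphism `⨁ᵢ id ⊗ f ⊗ id`. -/
def Choices.indMap {X Y : C} (f : X ⟶ Y) : D.indObj X ⟶ D.indObj Y :=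
  biproduct.map fun i => D.S i ◁ f ▷ (D.S i)ᘁ

/-- Bend `ψ : T ⟶ A ⊗ U` to `U* ⟶ T* ⊗ A`. -/
def bend {A U T : C} (ψ : T ⟶ A ⊗ U) : Uᘁ ⟶ Tᘁ ⊗ A :=
  𝟙 _ ⊗≫ coevTilde T ▷ Uᘁ ⊗≫ Tᘁ ◁ ψ ▷ Uᘁ ⊗≫ (Tᘁ ⊗ A) ◁ evTilde U ⊗≫ 𝟙 _

/-- The `(i, j)` component of `Γ_A`: the sum over dual bases of
`√dᵢ √dⱼ (φ_α ⊗ X ⊗ bend φ^α) : A ⊗ (Sᵢ ⊗ X ⊗ Sᵢ*) ⟶ (Sⱼ ⊗ X ⊗ Sⱼ*) ⊗ A`. -/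
def Choices.gammaComponent (X A : C) (i j : D.I) :
    A ⊗ (D.S i ⊗ X ⊗ (D.S i)ᘁ) ⟶ (D.S j ⊗ X ⊗ (D.S j)ᘁ) ⊗ A :=
  (D.sqrtDim i * D.sqrtDim j) • ∑ a,
    (𝟙 _ ⊗≫ ((D.bases A i j).φ a ⊗ₘ (X ◁ bend ((D.bases A i j).ψ a))) ⊗≫ 𝟙 _)

/-- The half-braiding `Γ` on `⨁ᵢ Sᵢ ⊗ X ⊗ Sᵢ*`. -/
def Choices.gamma (X : C) : HalfFamily (D.indObj X) := fun A =>
  ∑ i, ∑ j, A ◁ biproduct.π (fun i => D.S i ⊗ X ⊗ (D.S i)ᘁ) i ≫ D.gammaComponent X A i j ≫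
    biproduct.ι (fun i => D.S i ⊗ X ⊗ (D.S i)ᘁ) j ▷ A

/-- The half-braiding `λ~` on `⨁ᵢ Sᵢ ⊗ X ⊗ Sᵢ*`: pass `Sᵢ` with `c_{A,Sᵢ}`, then `X` with `λ_A`,
then `Sᵢ*` with `(c_{Sᵢ*,A})⁻¹`. -/
def Choices.tilde {X : C} (σ : HalfFamily X) : HalfFamily (D.indObj X) := fun A =>
  ∑ i, A ◁ biproduct.π (fun i => D.S i ⊗ X ⊗ (D.S i)ᘁ) i ≫
    tensorFamily (braidFamily (D.S i))
      (tensorFamily σ (fun B => (β_ (D.S i)ᘁ B).inv)) A ≫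
    biproduct.ι (fun i => D.S i ⊗ X ⊗ (D.S i)ᘁ) i ▷ A

/-- The datum `I₁(X, λ) = (⨁ᵢ Sᵢ ⊗ X ⊗ Sᵢ*, Γ, λ~)`. -/
def Choices.ind (X : Center C) : EllipticDatum C where
  pt := D.indObj X.1
  fst := D.gamma X.1
  snd := D.tilde (centerFamily X)

/-- The formulas for `I₁` define objects and morphisms of the elliptic Drinfeld center. -/
structure Choices.InductionWellDefined : Prop where
  obj : ∀ X : Center C, (D.ind X).IsElliptic
  map_fst : ∀ {X Y : Center C} (f : X ⟶ Y),
    Intertwines (D.ind X).fst (D.ind Y).fst (D.indMap f.f)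
  map_snd : ∀ {X Y : Center C} (f : X ⟶ Y),
    Intertwines (D.ind X).snd (D.ind Y).snd (D.indMap f.f)

variable {D} in
/-- The intermediate induction functor `I₁ : Z(C) ⥤ Z^el(C)`. -/
def Choices.inductionFunctor (hI : D.InductionWellDefined) : Center C ⥤ ZEl C where
  obj X := ⟨D.ind X, hI.obj X⟩
  map f := ⟨D.indMap f.f, hI.map_fst f, hI.map_snd f⟩
  map_id X := ZEl.Hom.ext (by
    change D.indMap (𝟙 X.1) = 𝟙 (D.indObj X.1)
    apply biproduct.hom_ext
    intro i
    simp [Choices.indMap])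
  map_comp {X Y Z} f g := ZEl.Hom.ext (by
    change D.indMap (f.f ≫ g.f) = D.indMap f.f ≫ D.indMap g.f
    apply biproduct.hom_ext
    intro i
    simp [Choices.indMap])

/-! ### The reduced tensor product -/

/-- The loop labelled `T` that links `X` and `Y`: create `T ⊗ T*` to the left of `X ⊗ Y`, pass
`T*` across `X` with `σ`, pass `T` across `X` with `c_{X,T}⁻¹` and `T*` across `Y` with `c_{T*,Y}`,
pass `T` across `Y` with `τ`, and annihilate `T ⊗ T*` to the right of `X ⊗ Y`. -/
def loop {X Y : C} (σ : HalfFamily X) (τ : HalfFamily Y) (T : C) : X ⊗ Y ⟶ X ⊗ Y :=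
  𝟙 _ ⊗≫ (η_ T Tᘁ) ▷ (X ⊗ Y) ⊗≫ T ◁ σ Tᘁ ▷ Y ⊗≫ ((β_ X T).inv ⊗ₘ (β_ Tᘁ Y).hom) ⊗≫
    X ◁ τ T ▷ Tᘁ ⊗≫ (X ⊗ Y) ◁ evTilde T ⊗≫ 𝟙 _

/-- The projection `Q_{σ,τ} = 𝒟⁻¹ ∑ᵢ dᵢ loopᵢ` of `X ⊗ Y`. -/
def Choices.Q {X Y : C} (σ : HalfFamily X) (τ : HalfFamily Y) : X ⊗ Y ⟶ X ⊗ Y :=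
  D.globalDim⁻¹ • ∑ i, catDim k (D.S i) • loop σ τ (D.S i)

/-- The reduced tensor product of `X` and `Y`: the image of `Q_{σ,τ}`. -/
abbrev Choices.red {X Y : C} (σ : HalfFamily X) (τ : HalfFamily Y) : C := image (D.Q σ τ)

/-- The inclusion of the reduced tensor product in `X ⊗ Y`. -/
abbrev Choices.incl {X Y : C} (σ : HalfFamily X) (τ : HalfFamily Y) : D.red σ τ ⟶ X ⊗ Y :=
  image.ι (D.Q σ τ)

/-- The projection of `X ⊗ Y` on the reduced tensor product. -/
abbrev Choices.proj {X Y : C} (σ : HalfFamily X) (τ : HalfFamily Y) : X ⊗ Y ⟶ D.red σ τ :=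
  factorThruImage (D.Q σ τ)

/-- The morphism between the reduced tensor products induced by a family on `X ⊗ Y`. -/
def Choices.restrict {X Y : C} (σ : HalfFamily X) (τ : HalfFamily Y) (ρ : HalfFamily (X ⊗ Y)) :
    HalfFamily (D.red σ τ) := fun A =>
  A ◁ D.incl σ τ ≫ ρ A ≫ D.proj σ τ ▷ A

/-- The tensor product on the elliptic Drinfeld center:
the object is the reduced tensor product with respect to the first half-braidings; the first
half-braiding passes `X` with `λ¹` and `Y` with `c_{-,Y}`; the second one is `λ² ⊗ μ²`. -/
def Choices.tensorDatum (P R : EllipticDatum C) : EllipticDatum C where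
  pt := D.red P.fst R.fst
  fst := D.restrict P.fst R.fst (tensorFamily P.fst (braidFamily R.pt))
  snd := D.restrict P.fst R.fst (tensorFamily P.snd R.snd)

/-- The tensor product of morphisms. -/
def Choices.tensorMap {P P' R R' : EllipticDatum C} (f : P.pt ⟶ P'.pt) (g : R.pt ⟶ R'.pt) :
    (D.tensorDatum P R).pt ⟶ (D.tensorDatum P' R').pt :=
  D.incl P.fst R.fst ≫ (f ⊗ₘ g) ≫ D.proj P'.fst R'.fst

/-- The associativity constraint, induced by that of `C`. -/
def Choices.assocMap (P R T : EllipticDatum C) :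
    (D.tensorDatum (D.tensorDatum P R) T).pt ⟶ (D.tensorDatum P (D.tensorDatum R T)).pt :=
  D.incl (D.tensorDatum P R).fst T.fst ≫ D.incl P.fst R.fst ▷ T.pt ≫
    (α_ P.pt R.pt T.pt).hom ≫
    P.pt ◁ D.proj R.fst T.fst ≫ D.proj P.fst (D.tensorDatum R T).fst

/-- The unit `I₁(𝟙)`. -/
abbrev Choices.unitDatum : EllipticDatum C := D.ind (𝟙_ (Center C))

/-- The left unit constraint. With normalization `c`, its component at `Sᵢ` is `c √dᵢ` times:
pass `Sᵢ*` across `X` with `c_{Sᵢ*,X}`, then `Sᵢ` across `X` with `λ¹`, and annihilate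
`Sᵢ ⊗ Sᵢ*`. -/
def Choices.leftUnitMap (c : k) (P : EllipticDatum C) :
    (D.tensorDatum D.unitDatum P).pt ⟶ P.pt :=
  D.incl D.unitDatum.fst P.fst ≫ ∑ i, (c * D.sqrtDim i) •
    (biproduct.π (fun i => D.S i ⊗ 𝟙_ C ⊗ (D.S i)ᘁ) i ▷ P.pt ⊗≫
      D.S i ◁ (β_ (D.S i)ᘁ P.pt).hom ⊗≫ P.fst (D.S i) ▷ (D.S i)ᘁ ⊗≫
      P.pt ◁ evTilde (D.S i) ⊗≫ 𝟙 P.pt)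

/-- The right unit constraint. With normalization `c`, its component at `Sᵢ` is `c √dᵢ` times:
pass `Sᵢ` to the left of `X` with `c_{X,Sᵢ}`, then back across `X` with `λ¹`, and annihilate
`Sᵢ ⊗ Sᵢ*`. -/
def Choices.rightUnitMap (c : k) (P : EllipticDatum C) :
    (D.tensorDatum P D.unitDatum).pt ⟶ P.pt :=
  D.incl P.fst D.unitDatum.fst ≫ ∑ i, (c * D.sqrtDim i) •
    (P.pt ◁ biproduct.π (fun i => D.S i ⊗ 𝟙_ C ⊗ (D.S i)ᘁ) i ⊗≫
      (β_ P.pt (D.S i)).hom ▷ (D.S i)ᘁ ⊗≫ P.fst (D.S i) ▷ (D.S i)ᘁ ⊗≫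
      P.pt ◁ evTilde (D.S i) ⊗≫ 𝟙 P.pt)

/-- The formulas for the tensor product define objects, morphisms and isomorphisms of the elliptic
Drinfeld center. -/
structure Choices.TensorWellDefined (c : k) : Prop where
  tensorObj : ∀ P R : ZEl C, (D.tensorDatum P.toEllipticDatum R.toEllipticDatum).IsElliptic
  tensorHom_fst : ∀ {P P' R R' : ZEl C} (f : P ⟶ P') (g : R ⟶ R'),
    Intertwines (D.tensorDatum P.toEllipticDatum R.toEllipticDatum).fst
      (D.tensorDatum P'.toEllipticDatum R'.toEllipticDatum).fst (D.tensorMap f.f g.f)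
  tensorHom_snd : ∀ {P P' R R' : ZEl C} (f : P ⟶ P') (g : R ⟶ R'),
    Intertwines (D.tensorDatum P.toEllipticDatum R.toEllipticDatum).snd
      (D.tensorDatum P'.toEllipticDatum R'.toEllipticDatum).snd (D.tensorMap f.f g.f)
  associator : ∀ P R T : ZEl C, IsDatumIso _ _
    (D.assocMap P.toEllipticDatum R.toEllipticDatum T.toEllipticDatum)
  leftUnitor : ∀ P : ZEl C, IsDatumIso _ _ (D.leftUnitMap c P.toEllipticDatum)
  rightUnitor : ∀ P : ZEl C, IsDatumIso _ _ (D.rightUnitMap c P.toEllipticDatum)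

variable {D}

/-- The data of the monoidal structure on the elliptic Drinfeld center given by the reduced tensor
product. -/
abbrev Choices.zelStruct {c : k} (hI : D.InductionWellDefined) (hT : D.TensorWellDefined c) :
    MonoidalCategoryStruct (ZEl C) where
  tensorObj P R := ⟨D.tensorDatum P.toEllipticDatum R.toEllipticDatum, hT.tensorObj P R⟩
  tensorHom f g := ⟨D.tensorMap f.f g.f, hT.tensorHom_fst f g, hT.tensorHom_snd f g⟩
  whiskerLeft P _ _ g :=
    ⟨D.tensorMap (𝟙 P.pt) g.f, hT.tensorHom_fst (𝟙 P) g, hT.tensorHom_snd (𝟙 P) g⟩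
  whiskerRight f R :=
    ⟨D.tensorMap f.f (𝟙 R.pt), hT.tensorHom_fst f (𝟙 R), hT.tensorHom_snd f (𝟙 R)⟩
  tensorUnit := ⟨D.unitDatum, hI.obj _⟩
  associator P R T := ZEl.isoMk (D.assocMap _ _ _) (hT.associator P R T)
  leftUnitor P := ZEl.isoMk (D.leftUnitMap c _) (hT.leftUnitor P)
  rightUnitor P := ZEl.isoMk (D.rightUnitMap c _) (hT.rightUnitor P)

/-! ### The structure morphism `J` -/

/-- The dual `T* ⊗ U* ⟶ V*` of `ψ : V ⟶ U ⊗ T`. -/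
def dualVertex {U T V : C} (ψ : V ⟶ U ⊗ T) : Tᘁ ⊗ Uᘁ ⟶ Vᘁ :=
  𝟙 _ ⊗≫ (Tᘁ ⊗ Uᘁ) ◁ (η_ V Vᘁ) ⊗≫ (Tᘁ ⊗ Uᘁ) ◁ ψ ▷ Vᘁ ⊗≫
    Tᘁ ◁ (ε_ U Uᘁ) ▷ (T ⊗ Vᘁ) ⊗≫ (ε_ T Tᘁ) ▷ Vᘁ ⊗≫ 𝟙 _

variable (D)

/-- The component `(Sᵢ ⊗ X ⊗ Sᵢ*) ⊗ (Sⱼ ⊗ Y ⊗ Sⱼ*) ⟶ Sₗ ⊗ (X ⊗ Y) ⊗ Sₗ*` of `J`, without its scalar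
factor: pass `Sᵢ*` across `Sⱼ ⊗ Y ⊗ Sⱼ*` with the braiding, pass `X` across `Sⱼ` with the braiding,
and sum `φ_α ⊗ (X ⊗ Y) ⊗ (φ^α)*` over dual bases of `Hom(Sᵢ ⊗ Sⱼ, Sₗ)` and `Hom(Sₗ, Sᵢ ⊗ Sⱼ)`. -/
def Choices.muComponent (X Y : C) (i j l : D.I) :
    (D.S i ⊗ X ⊗ (D.S i)ᘁ) ⊗ (D.S j ⊗ Y ⊗ (D.S j)ᘁ) ⟶ D.S l ⊗ (X ⊗ Y) ⊗ (D.S l)ᘁ :=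
  𝟙 _ ⊗≫ (D.S i ⊗ X) ◁ (β_ (D.S i)ᘁ (D.S j ⊗ Y ⊗ (D.S j)ᘁ)).hom ⊗≫
    D.S i ◁ (β_ X (D.S j)).hom ▷ (Y ⊗ (D.S j)ᘁ ⊗ (D.S i)ᘁ) ⊗≫
    ∑ a, ((D.bases (D.S i) j l).φ a ⊗ₘ
      ((X ⊗ Y) ◁ dualVertex ((D.bases (D.S i) j l).ψ a)))

/-- The morphism `J : I₁(X, λ) ⊗ I₁(Y, μ) ⟶ I₁((X, λ) ⊗ (Y, μ))` with normalization `c`. -/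
def Choices.J (c : k) (X Y : Center C) :
    (D.tensorDatum (D.ind X) (D.ind Y)).pt ⟶ D.indObj (X.1 ⊗ Y.1) :=
  D.incl (D.ind X).fst (D.ind Y).fst ≫ ∑ i, ∑ j, ∑ l,
    (c * D.sqrtDim i * D.sqrtDim j * D.sqrtDim l) •
      ((biproduct.π (fun i => D.S i ⊗ X.1 ⊗ (D.S i)ᘁ) i ⊗ₘ
          biproduct.π (fun i => D.S i ⊗ Y.1 ⊗ (D.S i)ᘁ) j) ≫
        D.muComponent X.1 Y.1 i j l ≫
        biproduct.ι (fun i => D.S i ⊗ (X.1 ⊗ Y.1) ⊗ (D.S i)ᘁ) l)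

end Constructions

/-- The monoidal category with the data `s`, when these data satisfy the axioms. -/
abbrev monoidalOfStruct {E : Type u} [Category.{v} E] (s : MonoidalCategoryStruct E)
    (h : ∃ M : MonoidalCategory E, M.toMonoidalCategoryStruct = s) : MonoidalCategory E :=
  { s with
    tensorHom_def := by obtain ⟨M, rfl⟩ := h; exact M.tensorHom_def
    id_tensorHom_id := by obtain ⟨M, rfl⟩ := h; exact M.id_tensorHom_id
    tensorHom_comp_tensorHom := by obtain ⟨M, rfl⟩ := h; exact M.tensorHom_comp_tensorHom
    whiskerLeft_id := by obtain ⟨M, rfl⟩ := h; exact M.whiskerLeft_id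
    id_whiskerRight := by obtain ⟨M, rfl⟩ := h; exact M.id_whiskerRight
    associator_naturality := by obtain ⟨M, rfl⟩ := h; exact M.associator_naturality
    leftUnitor_naturality := by obtain ⟨M, rfl⟩ := h; exact M.leftUnitor_naturality
    rightUnitor_naturality := by obtain ⟨M, rfl⟩ := h; exact M.rightUnitor_naturality
    pentagon := by obtain ⟨M, rfl⟩ := h; exact M.pentagon
    triangle := by obtain ⟨M, rfl⟩ := h; exact M.triangle }

end

end EllipticCenter

namespace EllipticCenter

noncomputable section

/-! ### Calculus of half-braidings -/

section Families

variable {C : Type u} [Category.{v} C] [MonoidalCategory C]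

/-! Everything rests on one universal property. With the half-braiding Γ, the object I(X) = ⨁ Sᵢ ⊗ X
⊗ Sᵢ* is the free half-braided object on X: a morphism X ⟶ W into an object with half-braiding w
extends uniquely along ι : X ⟶ I(X) to an intertwiner (`Choices.ext_intertwines`,
`Choices.iota_ext`, `Choices.gamma_generates`). The working tool is `Choices.kappa`, which is Γ_T ∘
(T ⊗ ι). It is built from canonical elements of dual bases, hence natural in T; Γ acts on it by
enlarging T (`Choices.kappa_gamma`); and the summand inclusions of I(X) are partial traces of it, so
identities about Γ may be tested on it.

I(Z) also receives an intertwiner from Z for every half-braiding u on Z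
(`Choices.coext_intertwines`). Followed by the extension of id_Z for another half-braiding v, it
yields 𝒟 times the average `Choices.avg u v` of loops crossing Z by u on one side and by v on the
other. So averages intertwine u with v; they are natural in (Z, u, v) and equal to the identity when
u = v. Now Q is the average of σ ⊠ c and c⁻¹ ⊠ τ. Formally, Q is idempotent, both half-braidings
restrict to the same one on its image, and any intertwiner from both to a common half-braiding
factors through Q. Either bracketing of a triple product is the part of X ⊗ Y ⊗ Z on which three
half-braidings agree, so the associator and its coherence are inherited from C.

COMM says that the crossings of the second half-braiding intertwine families built from the first
one (`comm_iff_exchange`). Hence Q commutes with the second half-braidings, and an intertwiner for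
the first half-braidings respects the second ones as soon as it does so on generators
(`Generates.intertwines`).

By rigidity extension also works for I(X) ⊗ N and M ⊗ I(X). The unit constraints come from extending
c times the unitors, J from extending c · ι_{X⊗Y} to I(X) ⊗ I(Y). Each monoidal-functor axiom is
then checked on ι, where both sides are the same structure map of C with the same power of c. A
final computation on summands identifies these extensions with the explicit formulas. -/

/-- The axioms of a half-braiding, without invertibility. -/
structure IsHalf {X : C} (σ : HalfFamily X) : Prop where
  nat : ∀ {A B : C} (f : A ⟶ B), f ▷ X ≫ σ B = σ A ≫ X ◁ f
  mul : ∀ A B : C, σ (A ⊗ B) =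
    (α_ A B X).hom ≫ A ◁ σ B ≫ (α_ A X B).inv ≫ σ A ▷ B ≫ (α_ X A B).hom
  unit : σ (𝟙_ C) = (λ_ X).hom ≫ (ρ_ X).inv

/-- The half-braiding on the unit object. -/
def unitFamily : HalfFamily (𝟙_ C) := fun A => (ρ_ A).hom ≫ (λ_ A).inv

infixr:70 " ⊠ " => tensorFamily

theorem Intertwines.tensorHom {X X' Y Y' : C} {σ : HalfFamily X} {σ' : HalfFamily X'}
    {τ : HalfFamily Y} {τ' : HalfFamily Y'} {f : X ⟶ X'} {g : Y ⟶ Y'}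
    (hf : Intertwines σ σ' f) (hg : Intertwines τ τ' g) :
    Intertwines (σ ⊠ τ) (σ' ⊠ τ') (f ⊗ₘ g) := by
  intro A
  simp only [tensorFamily, MonoidalCategory.tensorHom_def]
  calc
    _ = 𝟙 _ ⊗≫ A ◁ f ▷ Y ⊗≫ ((A ⊗ X') ◁ g ≫ σ' A ▷ Y') ⊗≫ X' ◁ τ' A ⊗≫ 𝟙 _ := by monoidal
    _ = 𝟙 _ ⊗≫ (A ◁ f ≫ σ' A) ▷ Y ⊗≫ X' ◁ (A ◁ g ≫ τ' A) ⊗≫ 𝟙 _ := by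
      rw [whisker_exchange]; monoidal
    _ = 𝟙 _ ⊗≫ σ A ▷ Y ⊗≫ (f ▷ (A ⊗ Y) ≫ X' ◁ τ A) ⊗≫ X' ◁ g ▷ A ⊗≫ 𝟙 _ := by
      rw [hf A, hg A]; monoidal
    _ = _ := by rw [← whisker_exchange]; monoidal

theorem Intertwines.whiskerRight {X X' Y : C} {σ : HalfFamily X} {σ' : HalfFamily X'}
    {f : X ⟶ X'} (hf : Intertwines σ σ' f) (τ : HalfFamily Y) :
    Intertwines (σ ⊠ τ) (σ' ⊠ τ) (f ▷ Y) := by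
  rw [← MonoidalCategory.tensorHom_id]; exact hf.tensorHom (.id τ)

theorem Intertwines.whiskerLeft {X Y Y' : C} (σ : HalfFamily X)
    {τ : HalfFamily Y} {τ' : HalfFamily Y'} {g : Y ⟶ Y'}
    (hg : Intertwines τ τ' g) :
    Intertwines (σ ⊠ τ) (σ ⊠ τ') (X ◁ g) := by
  rw [← MonoidalCategory.id_tensorHom]; exact (Intertwines.id σ).tensorHom hg

theorem Intertwines.isoInv {X Y : C} {σ : HalfFamily X} {τ : HalfFamily Y} {e : X ≅ Y}
    (h : Intertwines σ τ e.hom) : Intertwines τ σ e.inv := by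
  have := h.inv
  rwa [IsIso.Iso.inv_hom] at this

theorem intertwines_associator {X Y Z : C} (σ : HalfFamily X) (τ : HalfFamily Y)
    (ρ : HalfFamily Z) : Intertwines ((σ ⊠ τ) ⊠ ρ) (σ ⊠ τ ⊠ ρ) (α_ X Y Z).hom := by
  intro A
  simp only [tensorFamily]
  monoidal

theorem intertwines_leftUnitor {X : C} (σ : HalfFamily X) :
    Intertwines (unitFamily ⊠ σ) σ (λ_ X).hom := by
  intro A
  simp only [tensorFamily, unitFamily]
  monoidal

theorem intertwines_rightUnitor {X : C} (σ : HalfFamily X) :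
    Intertwines (σ ⊠ unitFamily) σ (ρ_ X).hom := by
  intro A
  simp only [tensorFamily, unitFamily]
  monoidal

/-- Compressing a family to a retract loses nothing once the idempotent p ≫ i commutes with it. This
is how families descend to the image of Q. -/
theorem Intertwines.of_retract {X Y : C} {σ : HalfFamily X} {τ : HalfFamily Y}
    {i : X ⟶ Y} {p : Y ⟶ X} (hp : i ≫ p = 𝟙 X) (hq : Intertwines τ τ (p ≫ i))
    (hσ : ∀ A, σ A = A ◁ i ≫ τ A ≫ p ▷ A) : Intertwines σ τ i ∧ Intertwines τ σ p := by
  constructor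
  · intro A
    rw [hσ, Category.assoc, Category.assoc, ← comp_whiskerRight]
    have := hq A
    rw [← this, ← Category.assoc (A ◁ i), ← MonoidalCategory.whiskerLeft_comp, ← Category.assoc i,
      hp, Category.id_comp]
  · intro A
    rw [hσ, ← Category.assoc, ← MonoidalCategory.whiskerLeft_comp, ← Category.assoc, hq A,
      Category.assoc, ← comp_whiskerRight, Category.assoc, hp, Category.comp_id]

theorem IsHalf.of_mono {X Y : C} {σ : HalfFamily X} {τ : HalfFamily Y} {i : X ⟶ Y} {p : Y ⟶ X}
    (hp : i ≫ p = 𝟙 X) (hi : Intertwines σ τ i) (hτ : IsHalf τ) : IsHalf σ := by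
  have key : ∀ A, σ A = A ◁ i ≫ τ A ≫ p ▷ A := fun A => by
    rw [← Category.assoc, hi A, Category.assoc, ← comp_whiskerRight, hp, id_whiskerRight,
      Category.comp_id]
  refine ⟨fun {A B} f => ?_, fun A B => ?_, ?_⟩
  · rw [key, key, ← whisker_exchange_assoc, ← Category.assoc (f ▷ Y), hτ.nat, Category.assoc,
      Category.assoc, Category.assoc, whisker_exchange]
  · rw [key, hτ.mul]
    calc
      _ = 𝟙 _ ⊗≫ A ◁ (B ◁ i ≫ τ B) ⊗≫ τ A ▷ B ⊗≫ p ▷ (A ⊗ B) := by monoidal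
      _ = 𝟙 _ ⊗≫ A ◁ σ B ⊗≫ (A ◁ i ≫ τ A ≫ p ▷ A) ▷ B ⊗≫ 𝟙 _ := by
        rw [hi B]; monoidal
      _ = _ := by rw [← key]; monoidal
  · rw [key, hτ.unit]
    calc
      _ = 𝟙 _ ⊗≫ (i ≫ p) ⊗≫ 𝟙 _ := by monoidal
      _ = _ := by rw [hp]; monoidal

theorem IsHalf.tensor {X Y : C} {σ : HalfFamily X} {τ : HalfFamily Y} (hσ : IsHalf σ)
    (hτ : IsHalf τ) : IsHalf (σ ⊠ τ) := by
  refine ⟨fun {A B} f => ?_, fun A B => ?_, ?_⟩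
  · simp only [tensorFamily]
    calc
      _ = 𝟙 _ ⊗≫ (f ▷ X ≫ σ B) ▷ Y ⊗≫ X ◁ τ B ⊗≫ 𝟙 _ := by monoidal
      _ = 𝟙 _ ⊗≫ σ A ▷ Y ⊗≫ X ◁ (f ▷ Y ≫ τ B) ⊗≫ 𝟙 _ := by rw [hσ.nat]; monoidal
      _ = _ := by rw [hτ.nat]; monoidal
  · simp only [tensorFamily]
    rw [hσ.mul, hτ.mul]
    calc
      _ = 𝟙 _ ⊗≫ A ◁ σ B ▷ Y ⊗≫ (σ A ▷ (B ⊗ Y) ≫ (X ⊗ A) ◁ τ B) ⊗≫ X ◁ τ A ▷ B ⊗≫ 𝟙 _ := by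
        monoidal
      _ = _ := by rw [← whisker_exchange]; monoidal
  · simp only [tensorFamily, hσ.unit, hτ.unit]
    monoidal

theorem HalfBraiding.isHalf {X : C} (b : HalfBraiding X) : IsHalf fun A => (b.β A).inv := by
  have hmul : ∀ A B, (b.β (A ⊗ B)).inv = (α_ A B X).hom ≫ A ◁ (b.β B).inv ≫ (α_ A X B).inv ≫
      (b.β A).inv ▷ B ≫ (α_ X A B).hom := fun A B => by
    rw [Iso.inv_eq_inv _ ((α_ A B X) ≪≫ whiskerLeftIso A (b.β B).symm ≪≫ (α_ A X B).symm ≪≫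
      whiskerRightIso (b.β A).symm B ≪≫ (α_ X A B)).symm |>.mpr]
    · simp
    · simp
  have hnat : ∀ {A B : C} (f : A ⟶ B), f ▷ X ≫ (b.β B).inv = (b.β A).inv ≫ X ◁ f := by
    intro A B f
    rw [Iso.comp_inv_eq, Category.assoc, b.naturality, Iso.inv_hom_id_assoc]
  refine ⟨hnat, hmul, ?_⟩
  -- Multiplicativity at (𝟙, 𝟙) and naturality along 𝟙 ⊗ 𝟙 ≅ 𝟙 make the component at 𝟙 idempotent up
  -- to unitors; being invertible, it is trivial.
  have h1 := hmul (𝟙_ C) (𝟙_ C)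
  have h2 := hnat (λ_ (𝟙_ C)).hom
  rw [h1] at h2
  have h4 : (ρ_ X).hom ≫ (λ_ X).inv ≫ (b.β (𝟙_ C)).inv = 𝟙 (X ⊗ 𝟙_ C) := by
    rw [← cancel_epi (b.β (𝟙_ C)).inv, Category.comp_id]
    calc
      _ = (λ_ (𝟙_ C ⊗ X)).inv ≫ (α_ (𝟙_ C) (𝟙_ C) X).inv ≫ ((α_ (𝟙_ C) (𝟙_ C) X).hom ≫
          𝟙_ C ◁ (b.β (𝟙_ C)).inv ≫ (α_ (𝟙_ C) X (𝟙_ C)).inv ≫ (b.β (𝟙_ C)).inv ▷ 𝟙_ C ≫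
          (α_ X (𝟙_ C) (𝟙_ C)).hom) ≫ X ◁ (λ_ (𝟙_ C)).hom := by monoidal
      _ = _ := by rw [← h2]; monoidal
  rw [← cancel_epi (λ_ X).inv, ← cancel_epi (ρ_ X).hom, h4]
  simp

/-! ### Braidings as half-braidings, and exchange relations between families -/

section Braided

set_option linter.unusedSectionVars false

variable [BraidedCategory C]

/-- The half-braiding `c_{X,-}⁻¹`. -/
def revBraidFamily (X : C) : HalfFamily X := fun A => (β_ X A).inv

theorem braidFamily_isHalf (X : C) : IsHalf (braidFamily X) := by
  refine ⟨fun {A B} f => ?_, fun A B => ?_, ?_⟩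
  · simp [braidFamily]
  · simp [braidFamily, BraidedCategory.braiding_tensor_left_hom]
  · simp [braidFamily]

theorem revBraidFamily_isHalf (X : C) : IsHalf (revBraidFamily X) := by
  refine ⟨fun {A B} f => ?_, fun A B => ?_, ?_⟩
  · simp [revBraidFamily]
  · simp [revBraidFamily, BraidedCategory.braiding_tensor_right_inv]
  · simp [revBraidFamily]

theorem intertwines_braidFamily {X Y : C} (f : X ⟶ Y) :
    Intertwines (braidFamily X) (braidFamily Y) f := by
  intro A; simp [braidFamily]

theorem intertwines_revBraidFamily {X Y : C} (f : X ⟶ Y) :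
    Intertwines (revBraidFamily X) (revBraidFamily Y) f := by
  intro A; simp [revBraidFamily]

theorem braidFamily_tensor (X Y : C) : braidFamily (X ⊗ Y) = braidFamily X ⊠ braidFamily Y := by
  funext A
  simp [braidFamily, tensorFamily, BraidedCategory.braiding_tensor_right_hom]

theorem revBraidFamily_tensor (X Y : C) :
    revBraidFamily (X ⊗ Y) = revBraidFamily X ⊠ revBraidFamily Y := by
  funext A
  simp [revBraidFamily, tensorFamily, BraidedCategory.braiding_tensor_left_inv]

theorem braidFamily_unit : braidFamily (𝟙_ C) = unitFamily := by
  funext A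
  simp [braidFamily, unitFamily]

theorem revBraidFamily_unit : revBraidFamily (𝟙_ C) = unitFamily := by
  funext A
  simp [revBraidFamily, unitFamily]

/-- `w_A` intertwines `e_A ⊠ u` and `u ⊠ e'_A` for all `A`. -/
def Exchange {X : C} (e e' : ∀ A : C, HalfFamily A) (u w : HalfFamily X) : Prop :=
  ∀ A, Intertwines (e A ⊠ u) (u ⊠ e' A) (w A)

/-- The strand A crosses X and then Y; the family it carries changes from e to e' and then to e'',
so exchange relations compose like crossings. -/
theorem Exchange.tensor {X Y : C} {e e' e'' : ∀ A : C, HalfFamily A} {u w : HalfFamily X}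
    {u' w' : HalfFamily Y} (h : Exchange e e' u w) (h' : Exchange e' e'' u' w') :
    Exchange e e'' (u ⊠ u') (w ⊠ w') := by
  intro A
  exact (intertwines_associator _ _ _).isoInv.comp <| ((h A).whiskerRight _).comp <|
    (intertwines_associator _ _ _).comp <| ((h' A).whiskerLeft _).comp <|
    (intertwines_associator _ _ _).isoInv

/-- COMM read conceptually: each crossing τ_B is a morphism of objects equipped with a family, for
families made of σ and the two braidings of B. This is the form in which COMM is used throughout. -/
theorem comm_iff_exchange {X : C} {σ τ : HalfFamily X} :
    Comm σ τ ↔ Exchange revBraidFamily braidFamily σ τ := by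
  constructor
  · intro h B A
    have := h A B
    simp only [tensorFamily, revBraidFamily, braidFamily, Category.assoc]
    exact this
  · intro h A B
    have := h B A
    simp only [tensorFamily, revBraidFamily, braidFamily, Category.assoc] at this
    exact this

/-- The Yang–Baxter relation: naturality of σ at the braiding of two objects, expanded by
multiplicativity. -/
theorem IsHalf.exchange_braid {X : C} {σ : HalfFamily X} (h : IsHalf σ) :
    Exchange braidFamily braidFamily σ σ := by
  intro A T
  have := h.nat (β_ T A).hom
  rw [h.mul, h.mul] at this
  simp only [tensorFamily, braidFamily, Category.assoc] at this ⊢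
  simp only [← Category.assoc] at this ⊢
  rw [← cancel_mono (α_ X A T).hom]
  rw [← cancel_epi (α_ T A X).hom]
  simp only [Category.assoc] at this ⊢
  simpa using this.symm

theorem IsHalf.exchange_revBraid {X : C} {σ : HalfFamily X} (h : IsHalf σ) :
    Exchange revBraidFamily revBraidFamily σ σ := by
  intro A T
  have := h.nat (β_ A T).inv
  rw [h.mul, h.mul] at this
  simp only [tensorFamily, revBraidFamily, Category.assoc] at this ⊢
  rw [← cancel_mono (α_ X A T).hom]
  rw [← cancel_epi (α_ T A X).hom]
  simp only [Category.assoc] at this ⊢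
  simpa using this.symm

/-- Only naturality of the braiding in the morphism σ_A enters; σ may be any family. -/
theorem exchange_braid_right (Y : C) (σ : HalfFamily Y) :
    Exchange braidFamily braidFamily (braidFamily Y) σ := by
  intro A
  rw [← braidFamily_tensor, ← braidFamily_tensor]
  exact intertwines_braidFamily _

theorem exchange_revBraid_right (Y : C) (σ : HalfFamily Y) :
    Exchange revBraidFamily revBraidFamily (revBraidFamily Y) σ := by
  intro A
  rw [← revBraidFamily_tensor, ← revBraidFamily_tensor]
  exact intertwines_revBraidFamily _

/-- Naturality of the braiding in σ_T, again for an arbitrary family, with the crossings of X by A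
moved to the other side. -/
theorem exchange_braid_revBraid {X : C} (σ : HalfFamily X) :
    Exchange braidFamily braidFamily σ (revBraidFamily X) := by
  intro A T
  simp only [tensorFamily, revBraidFamily, braidFamily]
  have h := BraidedCategory.braiding_naturality_left (σ T) A
  rw [BraidedCategory.braiding_tensor_left_hom, BraidedCategory.braiding_tensor_left_hom] at h
  rw [← cancel_epi (T ◁ (β_ X A).hom), ← cancel_epi (α_ T X A).hom,
    ← cancel_mono ((β_ X A).hom ▷ T), ← cancel_mono (α_ A X T).hom]
  simpa using h

theorem exchange_revBraid_braid {X : C} (σ : HalfFamily X) :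
    Exchange revBraidFamily revBraidFamily σ (braidFamily X) := by
  intro A T
  simp only [tensorFamily, revBraidFamily, braidFamily]
  have h := BraidedCategory.braiding_naturality_right A (σ T)
  rw [BraidedCategory.braiding_tensor_right_hom, BraidedCategory.braiding_tensor_right_hom] at h
  rw [← cancel_epi (α_ T A X).hom, ← cancel_epi ((β_ A T).hom ▷ X), ← cancel_epi (α_ A T X).inv,
    ← cancel_mono (α_ X A T).hom, ← cancel_mono (X ◁ (β_ A T).hom), ← cancel_mono (α_ X T A).inv]
  simpa using h.symm

/-- Half-braidings on all objects, natural and multiplicative in the object. -/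
structure IsUniversal (e : ∀ A : C, HalfFamily A) : Prop where
  half : ∀ X, IsHalf (e X)
  nat : ∀ {X Y : C} (f : X ⟶ Y), Intertwines (e X) (e Y) f
  tensor : ∀ X Y, e (X ⊗ Y) = e X ⊠ e Y
  unit : e (𝟙_ C) = unitFamily

theorem isUniversal_braidFamily : IsUniversal (braidFamily (C := C)) :=
  ⟨braidFamily_isHalf, intertwines_braidFamily, braidFamily_tensor, braidFamily_unit⟩

theorem isUniversal_revBraidFamily : IsUniversal (revBraidFamily (C := C)) :=
  ⟨revBraidFamily_isHalf, intertwines_revBraidFamily, revBraidFamily_tensor, revBraidFamily_unit⟩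

end Braided

/-- Intertwiners out of `(Z, z)` are determined by their restriction along `j`. -/
def Generates {Y Z : C} (z : HalfFamily Z) (j : Y ⟶ Z) : Prop :=
  ∀ ⦃W : C⦄ (w : HalfFamily W) (f g : Z ⟶ W), Intertwines z w f → Intertwines z w g →
    j ≫ f = j ≫ g → f = g

/-! ### Duality for intertwiners, and automatic invertibility -/

section Rigid

set_option linter.unusedSectionVars false

variable [RigidCategory C] {e : ∀ A : C, HalfFamily A}

/-- A universal family is natural and multiplicative, so coevaluations intertwine it with the
trivial family on 𝟙. The duality bijections of Hom spaces therefore restrict to intertwiners. -/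
theorem Intertwines.curryLeft (he : IsUniversal e) (M : C) {Z W : C} {z : HalfFamily Z}
    {w : HalfFamily W} {f : M ⊗ Z ⟶ W} (hf : Intertwines (e M ⊠ z) w f) :
    Intertwines z (e (ᘁM) ⊠ w) (tensorLeftHomEquiv Z (ᘁM) M W f) := by
  have h1 : Intertwines unitFamily (e (ᘁM) ⊠ e M) (η_ (ᘁM) M) := by
    rw [← he.unit, ← he.tensor]; exact he.nat _
  exact (intertwines_leftUnitor z).isoInv.comp <| (h1.whiskerRight z).comp <|
    (intertwines_associator _ _ _).comp <| hf.whiskerLeft _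

theorem Intertwines.curryRight (he : IsUniversal e) (N : C) {Z W : C} {z : HalfFamily Z}
    {w : HalfFamily W} {f : Z ⊗ N ⟶ W} (hf : Intertwines (z ⊠ e N) w f) :
    Intertwines z (w ⊠ e Nᘁ) (tensorRightHomEquiv Z N Nᘁ W f) := by
  have h1 : Intertwines unitFamily (e N ⊠ e Nᘁ) (η_ N Nᘁ) := by
    rw [← he.unit, ← he.tensor]; exact he.nat _
  exact (intertwines_rightUnitor z).isoInv.comp <| (h1.whiskerLeft z).comp <|
    (intertwines_associator _ _ _).isoInv.comp <| hf.whiskerRight _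

theorem Intertwines.uncurryLeft (he : IsUniversal e) (M : C) {Z W : C} {z : HalfFamily Z}
    {w : HalfFamily W} {f : Z ⟶ (ᘁM) ⊗ W} (hf : Intertwines z (e (ᘁM) ⊠ w) f) :
    Intertwines (e M ⊠ z) w ((tensorLeftHomEquiv Z (ᘁM) M W).symm f) := by
  have h1 : Intertwines (e M ⊠ e (ᘁM)) unitFamily (ε_ (ᘁM) M) := by
    rw [← he.unit, ← he.tensor]; exact he.nat _
  exact (hf.whiskerLeft _).comp <| (intertwines_associator _ _ _).isoInv.comp <|
    (h1.whiskerRight _).comp <| intertwines_leftUnitor _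

theorem Intertwines.uncurryRight (he : IsUniversal e) (N : C) {Z W : C} {z : HalfFamily Z}
    {w : HalfFamily W} {f : Z ⟶ W ⊗ Nᘁ} (hf : Intertwines z (w ⊠ e Nᘁ) f) :
    Intertwines (z ⊠ e N) w ((tensorRightHomEquiv Z N Nᘁ W).symm f) := by
  have h1 : Intertwines (e Nᘁ ⊠ e N) unitFamily (ε_ N Nᘁ) := by
    rw [← he.unit, ← he.tensor]; exact he.nat _
  exact (hf.whiskerRight _).comp <| (intertwines_associator _ _ _).comp <|
    (h1.whiskerLeft _).comp <| intertwines_rightUnitor _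

theorem tensorLeftHomEquiv_comp {M Y Z W : C} (j : Y ⟶ Z) (f : M ⊗ Z ⟶ W) :
    tensorLeftHomEquiv Y (HasLeftDual.leftDual M) M W (M ◁ j ≫ f) =
      j ≫ tensorLeftHomEquiv Z (HasLeftDual.leftDual M) M W f := by
  simp only [tensorLeftHomEquiv, Equiv.coe_fn_mk]
  calc
    _ = 𝟙 _ ⊗≫ ((η_ (ᘁM : C) M) ▷ Y ≫ ((ᘁM : C) ⊗ M) ◁ j) ⊗≫ (ᘁM : C) ◁ f := by monoidal
    _ = _ := by rw [← whisker_exchange]; monoidal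

theorem tensorRightHomEquiv_comp {N Y Z W : C} (j : Y ⟶ Z) (f : Z ⊗ N ⟶ W) :
    tensorRightHomEquiv Y N Nᘁ W (j ▷ N ≫ f) = j ≫ tensorRightHomEquiv Z N Nᘁ W f := by
  simp only [tensorRightHomEquiv, Equiv.coe_fn_mk]
  calc
    _ = 𝟙 _ ⊗≫ (Y ◁ (η_ N Nᘁ) ≫ j ▷ (N ⊗ Nᘁ)) ⊗≫ f ▷ Nᘁ := by monoidal
    _ = _ := by rw [whisker_exchange]; monoidal

/-- Move M to the target by duality, apply generation there, and move it back. -/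
theorem Generates.whiskerLeft (he : IsUniversal e) (M : C) {Y Z : C} {z : HalfFamily Z} {j : Y ⟶ Z}
    (h : Generates z j) : Generates (e M ⊠ z) (M ◁ j) := by
  intro W w f g hf hg hfg
  apply (tensorLeftHomEquiv Z (ᘁM) M W).injective
  refine h _ _ _ (hf.curryLeft he) (hg.curryLeft he) ?_
  rw [← tensorLeftHomEquiv_comp, hfg, tensorLeftHomEquiv_comp]

theorem Generates.whiskerRight (he : IsUniversal e) (N : C) {Y Z : C} {z : HalfFamily Z}
    {j : Y ⟶ Z} (h : Generates z j) : Generates (z ⊠ e N) (j ▷ N) := by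
  intro W w f g hf hg hfg
  apply (tensorRightHomEquiv Z N Nᘁ W).injective
  refine h _ _ _ (hf.curryRight he) (hg.curryRight he) ?_
  rw [← tensorRightHomEquiv_comp, hfg, tensorRightHomEquiv_comp]

/-- Half-braidings on objects of a rigid category are invertible. -/
theorem isHalfBraiding_iff {X : C} {σ : HalfFamily X} : IsHalfBraiding σ ↔ IsHalf σ := by
  constructor
  · rintro ⟨b, hb⟩
    have := HalfBraiding.isHalf b
    rwa [show (fun A => (b.β A).inv) = σ from funext fun A => (hb A).symm] at this
  · intro h
    -- The inverse crossing is the crossing with A*, rotated by coevaluation and evaluation;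
    -- naturality of σ along ε and along η gives the two inverse identities.
    let t : ∀ A : C, X ⊗ A ⟶ A ⊗ X := fun A =>
      𝟙 _ ⊗≫ η_ A Aᘁ ▷ X ▷ A ⊗≫ A ◁ σ Aᘁ ▷ A ⊗≫ A ◁ X ◁ ε_ A Aᘁ ⊗≫ 𝟙 _
    have h1 : ∀ A, σ A ≫ t A = 𝟙 _ := fun A => by
      have hn := h.nat (ε_ A Aᘁ)
      rw [h.mul, h.unit] at hn
      calc
        _ = 𝟙 _ ⊗≫ (𝟙_ C ◁ σ A ≫ η_ A Aᘁ ▷ (X ⊗ A)) ⊗≫ A ◁ σ Aᘁ ▷ A ⊗≫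
            A ◁ X ◁ ε_ A Aᘁ ⊗≫ 𝟙 _ := by simp only [t]; monoidal
        _ = 𝟙 _ ⊗≫ η_ A Aᘁ ▷ A ▷ X ⊗≫ A ◁ (((α_ Aᘁ A X).hom ≫ Aᘁ ◁ σ A ≫ (α_ Aᘁ X A).inv ≫
            σ Aᘁ ▷ A ≫ (α_ X Aᘁ A).hom) ≫ X ◁ ε_ A Aᘁ) ⊗≫ 𝟙 _ := by
          rw [whisker_exchange]; monoidal
        _ = 𝟙 _ ⊗≫ (η_ A Aᘁ ▷ A ⊗≫ A ◁ ε_ A Aᘁ) ▷ X ⊗≫ 𝟙 _ := by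
          rw [← hn]; monoidal
        _ = _ := by
          rw [ExactPairing.evaluation_coevaluation'']; monoidal
    have h2 : ∀ A, t A ≫ σ A = 𝟙 _ := fun A => by
      have hn := h.nat (η_ A Aᘁ)
      rw [h.mul, h.unit] at hn
      calc
        _ = 𝟙 _ ⊗≫ η_ A Aᘁ ▷ X ▷ A ⊗≫ A ◁ σ Aᘁ ▷ A ⊗≫ ((A ⊗ X) ◁ ε_ A Aᘁ ≫ σ A ▷ 𝟙_ C) ⊗≫
            𝟙 _ := by simp only [t]; monoidal
        _ = 𝟙 _ ⊗≫ ((η_ A Aᘁ ▷ X ≫ (α_ A Aᘁ X).hom ≫ A ◁ σ Aᘁ ≫ (α_ A X Aᘁ).inv ≫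
            σ A ▷ Aᘁ ≫ (α_ X A Aᘁ).hom)) ▷ A ⊗≫ X ◁ A ◁ ε_ A Aᘁ ⊗≫ 𝟙 _ := by
          rw [whisker_exchange]; monoidal
        _ = 𝟙 _ ⊗≫ X ◁ (η_ A Aᘁ ▷ A ⊗≫ A ◁ ε_ A Aᘁ) ⊗≫ 𝟙 _ := by
          rw [hn]; monoidal
        _ = _ := by
          rw [ExactPairing.evaluation_coevaluation'']; monoidal
    obtain ⟨i, hi⟩ : ∃ i : ∀ A, X ⊗ A ≅ A ⊗ X, ∀ A, (i A).inv = σ A :=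
      ⟨fun A => ⟨t A, σ A, h2 A, h1 A⟩, fun A => rfl⟩
    refine ⟨⟨i, fun A B => ?_, fun {A B} f => ?_⟩, fun A => (hi A).symm⟩
    · rw [← cancel_epi (i (A ⊗ B)).inv, Iso.inv_hom_id, hi, h.mul, ← hi A, ← hi B]
      simp [← comp_whiskerRight_assoc, ← MonoidalCategory.whiskerLeft_comp_assoc]
    · rw [← cancel_epi (i A).inv, Iso.inv_hom_id_assoc, ← cancel_mono (i B).inv, hi B, h.nat,
        ← hi A, ← hi B]
      simp

end Rigid

end Families
end
end EllipticCenter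



namespace EllipticCenter

noncomputable section

/-! ### The pivotal structure of a ribbon category -/

section Ribbon

set_option linter.unusedSectionVars false

variable {C : Type u} [Category.{v} C] [MonoidalCategory C] [RigidCategory C] [BraidedCategory C]
  [RibbonCategory C]

open RibbonCategory

theorem twist_unit : (twist (𝟙_ C)).hom = 𝟙 _ := by
  have h1 := twist_tensor (𝟙_ C) (𝟙_ C)
  have h2 := twist_naturality (λ_ (𝟙_ C)).hom
  rw [h1] at h2
  have h3 : (β_ (𝟙_ C) (𝟙_ C)).hom ≫ (β_ (𝟙_ C) (𝟙_ C)).hom = 𝟙 _ := by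
    rw [braiding_tensorUnit_left]; monoidal
  rw [h3, Category.comp_id, MonoidalCategory.tensorHom_def, Category.assoc,
    leftUnitor_naturality, unitors_equal, rightUnitor_naturality_assoc,
    Iso.cancel_iso_hom_left] at h2
  -- The double braiding on 𝟙 is trivial, so θ_𝟙 ∘ θ_𝟙 = θ_𝟙, and one factor cancels.
  have h4 := (cancel_epi (twist (𝟙_ C)).hom).1 (h2.symm.trans (Category.comp_id _).symm)
  exact h4

/-- Naturality of the twist at the coevaluation, with θ_{X*} = (θ_X)*, puts two twists and a double
braiding on the same strand. This trades (c, θ) for (c⁻¹, θ⁻¹), the form in which `coevTilde` and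
`evTilde` visibly belong to one exact pairing. -/
theorem coevTilde_eq (X : C) :
    coevTilde X = η_ X Xᘁ ≫ (β_ Xᘁ X).inv ≫ Xᘁ ◁ (twist X).inv := by
  have h := twist_naturality (η_ X Xᘁ)
  rw [twist_unit, Category.id_comp, twist_tensor, twist_dual, tensorHom_def'_assoc,
    ← Category.assoc (η_ X Xᘁ), coevaluation_comp_rightAdjointMate, Category.assoc,
    BraidedCategory.braiding_naturality_left_assoc,
    BraidedCategory.braiding_naturality_left_assoc] at h
  rw [coevTilde]
  conv_rhs => rw [← h]
  simp [← MonoidalCategory.whiskerLeft_comp]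

/-- `X` is a right dual of `X*` through the pivotal structure. -/
@[reducible]
def tildePairing (X : C) : ExactPairing Xᘁ X :=
  letI := BraidedCategory.exactPairing_swap X Xᘁ
  exactPairingCongrRight (twist X)

theorem coevTilde_eq_coevaluation (X : C) :
    coevTilde X = @ExactPairing.coevaluation _ _ _ Xᘁ X (tildePairing X) := by
  rw [coevTilde_eq]
  exact (Category.assoc _ _ _).symm

theorem evTilde_eq_evaluation (X : C) :
    evTilde X = @ExactPairing.evaluation _ _ _ Xᘁ X (tildePairing X) := rfl

theorem coevTilde_evTilde (X : C) :
    X ◁ coevTilde X ⊗≫ evTilde X ▷ X = ⊗𝟙.hom := by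
  rw [coevTilde_eq_coevaluation, evTilde_eq_evaluation]
  exact @ExactPairing.coevaluation_evaluation'' _ _ _ _ _ (tildePairing X)

theorem evTilde_coevTilde (X : C) :
    coevTilde X ▷ Xᘁ ⊗≫ Xᘁ ◁ evTilde X = ⊗𝟙.hom := by
  rw [coevTilde_eq_coevaluation, evTilde_eq_evaluation]
  exact @ExactPairing.evaluation_coevaluation'' _ _ _ _ _ (tildePairing X)

/-- Sphericality: the left trace equals the right trace, by naturality of the twist and of the
braiding. -/
theorem coevTilde_evaluation {X : C} (f : X ⟶ X) :
    coevTilde X ≫ Xᘁ ◁ f ≫ ε_ X Xᘁ = η_ X Xᘁ ≫ f ▷ Xᘁ ≫ evTilde X := by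
  rw [coevTilde, evTilde, ← comp_whiskerRight_assoc, twist_naturality]
  simp

theorem braid_evaluation (T U : C) :
    Uᘁ ◁ (β_ T U).hom ⊗≫ ε_ U Uᘁ ▷ T =
      𝟙 _ ⊗≫ (β_ T Uᘁ).inv ▷ U ⊗≫ T ◁ ε_ U Uᘁ ⊗≫ 𝟙 _ := by
  have h := BraidedCategory.braiding_naturality_right T (ε_ U Uᘁ)
  rw [BraidedCategory.braiding_tensor_right_hom, braiding_tensorUnit_right] at h
  calc
    _ = 𝟙 _ ⊗≫ ((β_ T Uᘁ).inv ≫ (β_ T Uᘁ).hom) ▷ U ⊗≫ Uᘁ ◁ (β_ T U).hom ⊗≫ ε_ U Uᘁ ▷ T ⊗≫ 𝟙 _ := by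
      rw [Iso.inv_hom_id]; monoidal
    _ = 𝟙 _ ⊗≫ (β_ T Uᘁ).inv ▷ U ⊗≫ (((α_ T Uᘁ U).inv ≫ (β_ T Uᘁ).hom ▷ U ≫ (α_ Uᘁ T U).hom ≫
        Uᘁ ◁ (β_ T U).hom ≫ (α_ Uᘁ U T).inv) ≫ ε_ U Uᘁ ▷ T) ⊗≫ 𝟙 _ := by monoidal
    _ = _ := by rw [← h]; monoidal

theorem braid_evTilde (U T : C) :
    (β_ U T).hom ▷ Tᘁ ⊗≫ T ◁ (β_ U Tᘁ).hom ⊗≫ evTilde T ▷ U =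
      𝟙 _ ⊗≫ U ◁ evTilde T ⊗≫ 𝟙 _ := by
  have h := BraidedCategory.braiding_naturality_right U (evTilde T)
  rw [BraidedCategory.braiding_tensor_right_hom, braiding_tensorUnit_right] at h
  calc
    _ = 𝟙 _ ⊗≫ (((α_ U T Tᘁ).inv ≫ (β_ U T).hom ▷ Tᘁ ≫ (α_ T U Tᘁ).hom ≫
        T ◁ (β_ U Tᘁ).hom ≫ (α_ T Tᘁ U).inv) ≫ evTilde T ▷ U) := by monoidal
    _ = _ := by rw [← h]; monoidal

/-- The evaluation of `T* ⊗ U*` on `U ⊗ T`. -/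
def evTensor (U T : C) : (Tᘁ ⊗ Uᘁ) ⊗ (U ⊗ T) ⟶ 𝟙_ C :=
  𝟙 _ ⊗≫ Tᘁ ◁ ε_ U Uᘁ ▷ T ⊗≫ ε_ T Tᘁ

/-- The pivotal evaluation of `U ⊗ T` on `T* ⊗ U*`. -/
def evTildeTensor (U T : C) : (U ⊗ T) ⊗ (Tᘁ ⊗ Uᘁ) ⟶ 𝟙_ C :=
  𝟙 _ ⊗≫ U ◁ evTilde T ▷ Uᘁ ⊗≫ evTilde U

/-- The pivotal structure is monoidal: the twist of U ⊗ T supplies the double braiding that turns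
the evaluation of the whole product into two nested pivotal evaluations. -/
theorem evTildeTensor_eq (U T : C) :
    (twist (U ⊗ T)).hom ▷ (Tᘁ ⊗ Uᘁ) ≫ (β_ (U ⊗ T) (Tᘁ ⊗ Uᘁ)).hom ≫ evTensor U T =
      evTildeTensor U T := by
  have h1 : (β_ T U).hom ▷ (Tᘁ ⊗ Uᘁ) ≫ (β_ (U ⊗ T) (Tᘁ ⊗ Uᘁ)).hom ≫ evTensor U T =
      𝟙 _ ⊗≫ T ◁ (β_ U Tᘁ).hom ▷ Uᘁ ⊗≫ (T ⊗ Tᘁ) ◁ ((β_ U Uᘁ).hom ≫ ε_ U Uᘁ) ⊗≫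
        (β_ T Tᘁ).hom ≫ ε_ T Tᘁ := by
    rw [BraidedCategory.braiding_naturality_left_assoc, evTensor]
    calc
      _ = (β_ (T ⊗ U) (Tᘁ ⊗ Uᘁ)).hom ⊗≫
          Tᘁ ◁ (Uᘁ ◁ (β_ T U).hom ⊗≫ ε_ U Uᘁ ▷ T) ⊗≫ ε_ T Tᘁ := by monoidal
      _ = 𝟙 _ ⊗≫ T ◁ (β_ U Tᘁ).hom ▷ Uᘁ ⊗≫ (T ⊗ Tᘁ) ◁ (β_ U Uᘁ).hom ⊗≫
          (β_ T Tᘁ).hom ▷ (Uᘁ ⊗ U) ⊗≫ Tᘁ ◁ ((β_ T Uᘁ).hom ≫ (β_ T Uᘁ).inv) ▷ U ⊗≫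
          (Tᘁ ⊗ T) ◁ ε_ U Uᘁ ⊗≫ ε_ T Tᘁ := by
        rw [braid_evaluation, BraidedCategory.braiding_tensor_left_hom,
          BraidedCategory.braiding_tensor_right_hom, BraidedCategory.braiding_tensor_right_hom]
        monoidal
      _ = 𝟙 _ ⊗≫ T ◁ (β_ U Tᘁ).hom ▷ Uᘁ ⊗≫ (T ⊗ Tᘁ) ◁ (β_ U Uᘁ).hom ⊗≫
          ((β_ T Tᘁ).hom ▷ (Uᘁ ⊗ U) ≫ (Tᘁ ⊗ T) ◁ ε_ U Uᘁ) ⊗≫ ε_ T Tᘁ := by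
        rw [Iso.hom_inv_id]; monoidal
      _ = _ := by rw [← whisker_exchange]; monoidal
  rw [twist_tensor, comp_whiskerRight, comp_whiskerRight, Category.assoc, Category.assoc, h1]
  calc
    _ = 𝟙 _ ⊗≫ (twist U).hom ▷ (T ⊗ Tᘁ ⊗ Uᘁ) ⊗≫ (U ◁ (twist T).hom ≫ (β_ U T).hom) ▷ (Tᘁ ⊗ Uᘁ) ⊗≫
        T ◁ (β_ U Tᘁ).hom ▷ Uᘁ ⊗≫ (T ⊗ Tᘁ) ◁ ((β_ U Uᘁ).hom ≫ ε_ U Uᘁ) ⊗≫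
        (β_ T Tᘁ).hom ≫ ε_ T Tᘁ := by
      rw [MonoidalCategory.tensorHom_def]; monoidal
    _ = 𝟙 _ ⊗≫ (twist U).hom ▷ (T ⊗ Tᘁ ⊗ Uᘁ) ⊗≫ (β_ U T).hom ▷ (Tᘁ ⊗ Uᘁ) ⊗≫
        ((twist T).hom ▷ (U ⊗ Tᘁ) ≫ T ◁ (β_ U Tᘁ).hom) ▷ Uᘁ ⊗≫
        (T ⊗ Tᘁ) ◁ ((β_ U Uᘁ).hom ≫ ε_ U Uᘁ) ⊗≫ (β_ T Tᘁ).hom ≫ ε_ T Tᘁ := by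
      rw [BraidedCategory.braiding_naturality_right]; monoidal
    _ = 𝟙 _ ⊗≫ (twist U).hom ▷ (T ⊗ Tᘁ ⊗ Uᘁ) ⊗≫ (β_ U T).hom ▷ (Tᘁ ⊗ Uᘁ) ⊗≫
        T ◁ (β_ U Tᘁ).hom ▷ Uᘁ ⊗≫ ((twist T).hom ▷ Tᘁ ▷ (U ⊗ Uᘁ) ≫
        (T ⊗ Tᘁ) ◁ ((β_ U Uᘁ).hom ≫ ε_ U Uᘁ)) ⊗≫ (β_ T Tᘁ).hom ≫ ε_ T Tᘁ := by
      rw [← whisker_exchange]; monoidal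
    _ = 𝟙 _ ⊗≫ (twist U).hom ▷ (T ⊗ Tᘁ ⊗ Uᘁ) ⊗≫ (β_ U T).hom ▷ (Tᘁ ⊗ Uᘁ) ⊗≫
        T ◁ (β_ U Tᘁ).hom ▷ Uᘁ ⊗≫ ((T ⊗ Tᘁ) ◁ ((β_ U Uᘁ).hom ≫ ε_ U Uᘁ) ≫
        evTilde T ▷ 𝟙_ C) ⊗≫ 𝟙 _ := by
      rw [← whisker_exchange, evTilde]; monoidal
    _ = 𝟙 _ ⊗≫ (twist U).hom ▷ (T ⊗ Tᘁ ⊗ Uᘁ) ⊗≫ ((β_ U T).hom ▷ Tᘁ ⊗≫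
        T ◁ (β_ U Tᘁ).hom ⊗≫ evTilde T ▷ U) ▷ Uᘁ ⊗≫ (β_ U Uᘁ).hom ≫ ε_ U Uᘁ := by
      rw [whisker_exchange]; monoidal
    _ = 𝟙 _ ⊗≫ ((twist U).hom ▷ (T ⊗ Tᘁ) ≫ U ◁ evTilde T) ▷ Uᘁ ⊗≫ (β_ U Uᘁ).hom ≫ ε_ U Uᘁ := by
      rw [braid_evTilde]; monoidal
    _ = _ := by
      rw [← whisker_exchange, evTildeTensor]
      conv_rhs => rw [evTilde.eq_def (X := U)]
      monoidal

theorem dualVertex_evaluation {U T V : C} (ψ : V ⟶ U ⊗ T) :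
    dualVertex ψ ▷ V ≫ ε_ V Vᘁ = (Tᘁ ⊗ Uᘁ) ◁ ψ ≫ evTensor U T := by
  have h : dualVertex ψ = 𝟙 _ ⊗≫ (Tᘁ ⊗ Uᘁ : C) ◁ η_ V Vᘁ ⊗≫ ((Tᘁ ⊗ Uᘁ : C) ◁ ψ ≫ evTensor U T) ▷ Vᘁ ⊗≫
      𝟙 _ := by
    rw [dualVertex, evTensor]; monoidal
  rw [h]
  generalize (Tᘁ ⊗ Uᘁ : C) ◁ ψ ≫ evTensor U T = g
  calc
    _ = 𝟙 _ ⊗≫ (Tᘁ ⊗ Uᘁ : C) ◁ η_ V Vᘁ ▷ V ⊗≫ (g ▷ (Vᘁ ⊗ V) ≫ 𝟙_ C ◁ ε_ V Vᘁ) ⊗≫ 𝟙 _ := by monoidal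
    _ = 𝟙 _ ⊗≫ (Tᘁ ⊗ Uᘁ : C) ◁ (η_ V Vᘁ ▷ V ⊗≫ V ◁ ε_ V Vᘁ) ⊗≫ g ⊗≫ 𝟙 _ := by
      rw [← whisker_exchange]; monoidal
    _ = _ := by rw [ExactPairing.evaluation_coevaluation'']; monoidal

/-- The dual vertex, computed with the pivotal structure. -/
theorem dualVertex_eq {U T V : C} (ψ : V ⟶ U ⊗ T) :
    dualVertex ψ = 𝟙 _ ⊗≫ coevTilde V ▷ (Tᘁ ⊗ Uᘁ) ⊗≫
      Vᘁ ◁ (ψ ▷ (Tᘁ ⊗ Uᘁ) ≫ evTildeTensor U T) ⊗≫ 𝟙 _ := by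
  -- The transpose for (ε, η) is also the transpose for the pivotal pairing, because pivotal
  -- evaluations are ordinary ones preceded by the twist and the braiding, both natural in ψ.
  have h : ψ ▷ (Tᘁ ⊗ Uᘁ) ≫ evTildeTensor U T = V ◁ dualVertex ψ ≫ evTilde V := by
    rw [← evTildeTensor_eq, ← comp_whiskerRight_assoc, twist_naturality, comp_whiskerRight_assoc,
      BraidedCategory.braiding_naturality_left_assoc, ← dualVertex_evaluation,
      ← BraidedCategory.braiding_naturality_right_assoc, ← whisker_exchange_assoc, evTilde]
  rw [h]
  symm
  calc
    _ = 𝟙 _ ⊗≫ (coevTilde V ▷ (Tᘁ ⊗ Uᘁ) ≫ (Vᘁ ⊗ V) ◁ dualVertex ψ) ⊗≫ Vᘁ ◁ evTilde V ⊗≫ 𝟙 _ := by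
      monoidal
    _ = 𝟙 _ ⊗≫ dualVertex ψ ⊗≫ (coevTilde V ▷ Vᘁ ⊗≫ Vᘁ ◁ evTilde V) ⊗≫ 𝟙 _ := by
      rw [← whisker_exchange]; monoidal
    _ = _ := by rw [evTilde_coevTilde]; monoidal

end Ribbon
end
end EllipticCenter



namespace EllipticCenter

noncomputable section

/-! ### Linking loops -/

section Loops

set_option linter.unusedSectionVars false

variable {C : Type u} [Category.{v} C] [MonoidalCategory C] [RigidCategory C] [BraidedCategory C]
  [RibbonCategory C]

/-- Close the strand `T` of `h : T ⊗ X ⟶ Z ⊗ T` to the right. -/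
def closeRight {T X Z : C} (h : T ⊗ X ⟶ Z ⊗ T) : T ⊗ X ⊗ Tᘁ ⟶ Z :=
  𝟙 _ ⊗≫ h ▷ Tᘁ ⊗≫ Z ◁ evTilde T ⊗≫ 𝟙 _

/-- Create `T ⊗ T*` to the left of `Z` and pass `T*` across `Z`. -/
def openLeft {Z : C} (u : HalfFamily Z) (T : C) : Z ⟶ T ⊗ Z ⊗ Tᘁ :=
  𝟙 _ ⊗≫ η_ T Tᘁ ▷ Z ⊗≫ T ◁ u Tᘁ

/-- The loop labelled `T` which passes `T*` across `Z` with `u` and `T` with `v`. -/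
def link {Z : C} (u v : HalfFamily Z) (T : C) : Z ⟶ Z := openLeft u T ≫ closeRight (v T)

theorem closeRight_comp {T X Z W : C} (h : T ⊗ X ⟶ Z ⊗ T) (f : Z ⟶ W) :
    closeRight h ≫ f = closeRight (h ≫ f ▷ T) := by
  simp only [closeRight]
  calc
    _ = 𝟙 _ ⊗≫ h ▷ Tᘁ ⊗≫ (Z ◁ evTilde T ≫ f ▷ 𝟙_ C) ⊗≫ 𝟙 _ := by monoidal
    _ = _ := by rw [whisker_exchange]; monoidal

theorem whisker_closeRight {T X Y Z : C} (g : X ⟶ Y) (h : T ⊗ Y ⟶ Z ⊗ T) :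
    T ◁ g ▷ Tᘁ ≫ closeRight h = closeRight (T ◁ g ≫ h) := by
  simp only [closeRight]
  monoidal

theorem Intertwines.comp_openLeft {Z W : C} {u : HalfFamily Z} {u' : HalfFamily W} {f : Z ⟶ W}
    (hf : Intertwines u u' f) (T : C) : f ≫ openLeft u' T = openLeft u T ≫ T ◁ f ▷ Tᘁ := by
  simp only [openLeft]
  calc
    _ = 𝟙 _ ⊗≫ (𝟙_ C ◁ f ≫ η_ T Tᘁ ▷ W) ⊗≫ T ◁ u' Tᘁ := by monoidal
    _ = 𝟙 _ ⊗≫ η_ T Tᘁ ▷ Z ⊗≫ T ◁ (Tᘁ ◁ f ≫ u' Tᘁ) := by rw [whisker_exchange]; monoidal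
    _ = _ := by rw [hf]; monoidal

/-- The loop crosses Z once by u and once by v, so a morphism respecting both slides through it. -/
theorem comp_link {Z W : C} {u v : HalfFamily Z} {u' v' : HalfFamily W} {f : Z ⟶ W}
    (hu : Intertwines u u' f) (hv : Intertwines v v' f) (T : C) :
    f ≫ link u' v' T = link u v T ≫ f := by
  rw [link, link, ← Category.assoc, hu.comp_openLeft, Category.assoc, whisker_closeRight, hv,
    Category.assoc, closeRight_comp]

/-- The loop that defines Q treats X ⊗ Y as one strand carrying two half-braidings, which reduces
the study of Q to that of `link`. -/
theorem loop_eq_link {X Y : C} (σ : HalfFamily X) (τ : HalfFamily Y) (T : C) :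
    loop σ τ T = link (σ ⊠ braidFamily Y) (revBraidFamily X ⊠ τ) T := by
  simp only [loop, link, openLeft, closeRight, tensorFamily, braidFamily, revBraidFamily,
    MonoidalCategory.tensorHom_def']
  monoidal

/-- Both crossings together are the crossing with T ⊗ T*, and naturality along the evaluation pulls
the loop off Z. -/
theorem IsHalf.link_self {Z : C} {w : HalfFamily Z} (hw : IsHalf w) (T : C) :
    link w w T = 𝟙 _ ⊗≫ (η_ T Tᘁ ≫ evTilde T) ▷ Z ⊗≫ 𝟙 _ := by
  have h := hw.nat (evTilde T)
  rw [hw.mul, hw.unit] at h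
  simp only [link, openLeft, closeRight]
  calc
    _ = 𝟙 _ ⊗≫ η_ T Tᘁ ▷ Z ⊗≫ (((α_ T Tᘁ Z).hom ≫ T ◁ w Tᘁ ≫ (α_ T Z Tᘁ).inv ≫ w T ▷ Tᘁ ≫
        (α_ Z T Tᘁ).hom) ≫ Z ◁ evTilde T) ⊗≫ 𝟙 _ := by monoidal
    _ = _ := by rw [← h]; monoidal

/-- A strand crossed twice by the same half-braiding is not linked with the loop: naturality along
the coevaluation removes it. -/
theorem IsHalf.link_tensor_left {A Z : C} {e : HalfFamily A} (he : IsHalf e) (u v : HalfFamily Z)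
    (T : C) : link (e ⊠ u) (e ⊠ v) T = A ◁ link u v T := by
  have h := he.nat (η_ T Tᘁ)
  rw [he.mul, he.unit] at h
  simp only [link, openLeft, closeRight, tensorFamily]
  calc
    _ = 𝟙 _ ⊗≫ η_ T Tᘁ ▷ (A ⊗ Z) ⊗≫ T ◁ e Tᘁ ▷ Z ⊗≫ ((T ⊗ A) ◁ u Tᘁ ≫ e T ▷ (Z ⊗ Tᘁ)) ⊗≫
        A ◁ v T ▷ Tᘁ ⊗≫ (A ⊗ Z) ◁ evTilde T ⊗≫ 𝟙 _ := by monoidal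
    _ = 𝟙 _ ⊗≫ (η_ T Tᘁ ▷ A ≫ (α_ T Tᘁ A).hom ≫ T ◁ e Tᘁ ≫ (α_ T A Tᘁ).inv ≫ e T ▷ Tᘁ ≫
        (α_ A T Tᘁ).hom) ▷ Z ⊗≫ A ◁ T ◁ u Tᘁ ⊗≫
        A ◁ v T ▷ Tᘁ ⊗≫ (A ⊗ Z) ◁ evTilde T ⊗≫ 𝟙 _ := by rw [whisker_exchange]; monoidal
    _ = _ := by rw [h]; monoidal

theorem IsHalf.link_tensor_right {A Z : C} {e : HalfFamily A} (he : IsHalf e) (u v : HalfFamily Z)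
    (T : C) : link (u ⊠ e) (v ⊠ e) T = link u v T ▷ A := by
  have h := he.nat (evTilde T)
  rw [he.mul, he.unit] at h
  simp only [link, openLeft, closeRight, tensorFamily]
  calc
    _ = 𝟙 _ ⊗≫ η_ T Tᘁ ▷ (Z ⊗ A) ⊗≫ T ◁ u Tᘁ ▷ A ⊗≫ ((T ⊗ Z) ◁ e Tᘁ ≫ v T ▷ (A ⊗ Tᘁ)) ⊗≫
        Z ◁ e T ▷ Tᘁ ⊗≫ (Z ⊗ A) ◁ evTilde T ⊗≫ 𝟙 _ := by monoidal
    _ = 𝟙 _ ⊗≫ η_ T Tᘁ ▷ (Z ⊗ A) ⊗≫ T ◁ u Tᘁ ▷ A ⊗≫ v T ▷ (Tᘁ ⊗ A) ⊗≫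
        Z ◁ (((α_ T Tᘁ A).hom ≫ T ◁ e Tᘁ ≫ (α_ T A Tᘁ).inv ≫ e T ▷ Tᘁ ≫
        (α_ A T Tᘁ).hom) ≫ A ◁ evTilde T) ⊗≫ 𝟙 _ := by rw [whisker_exchange]; monoidal
    _ = _ := by rw [← h]; monoidal

/-- Pass an object `N` on the right of a closed strand inside, with the braiding. -/
theorem closeRight_whiskerRight {T X Z : C} (h : T ⊗ X ⟶ Z ⊗ T) (N : C) :
    closeRight h ▷ N = 𝟙 _ ⊗≫ (T ⊗ X) ◁ (β_ Tᘁ N).hom ⊗≫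
      closeRight ((α_ T X N).inv ≫ h ▷ N ≫ (α_ Z T N).hom ≫ Z ◁ (β_ T N).hom ≫ (α_ Z N T).inv) ⊗≫
      𝟙 _ := by
  have hn := BraidedCategory.braiding_naturality_left (evTilde T) N
  rw [BraidedCategory.braiding_tensor_left_hom, braiding_tensorUnit_left] at hn
  simp only [closeRight]
  symm
  calc
    _ = 𝟙 _ ⊗≫ ((T ⊗ X) ◁ (β_ Tᘁ N).hom ≫ h ▷ (N ⊗ Tᘁ)) ⊗≫ Z ◁ (β_ T N).hom ▷ Tᘁ ⊗≫
        (Z ⊗ N) ◁ evTilde T ⊗≫ 𝟙 _ := by monoidal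
    _ = 𝟙 _ ⊗≫ h ▷ (Tᘁ ⊗ N) ⊗≫ Z ◁ (((α_ T Tᘁ N).hom ≫ T ◁ (β_ Tᘁ N).hom ≫ (α_ T N Tᘁ).inv ≫
        (β_ T N).hom ▷ Tᘁ ≫ (α_ N T Tᘁ).hom) ≫ N ◁ evTilde T) ⊗≫ 𝟙 _ := by
      rw [whisker_exchange]; monoidal
    _ = _ := by rw [← hn]; monoidal

theorem whiskerLeft_closeRight {T X Z : C} (h : T ⊗ X ⟶ Z ⊗ T) (M : C) :
    M ◁ closeRight h = 𝟙 _ ⊗≫ (β_ M T).hom ▷ (X ⊗ Tᘁ) ⊗≫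
      closeRight ((α_ T M X).inv ≫ (β_ M T).inv ▷ X ≫ (α_ M T X).hom ≫ M ◁ h ≫
        (α_ M Z T).inv) ⊗≫ 𝟙 _ := by
  simp only [closeRight]
  symm
  calc
    _ = 𝟙 _ ⊗≫ ((β_ M T).hom ≫ (β_ M T).inv) ▷ (X ⊗ Tᘁ) ⊗≫ M ◁ h ▷ Tᘁ ⊗≫
        (M ⊗ Z) ◁ evTilde T ⊗≫ 𝟙 _ := by monoidal
    _ = _ := by rw [Iso.hom_inv_id]; monoidal

end Loops
end
end EllipticCenter



namespace EllipticCenter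

noncomputable section

attribute [local instance] Abelian.hasFiniteBiproducts

/-! ### Dual bases -/

section Bases

set_option linter.unusedSectionVars false
set_option linter.unusedSimpArgs false

variable {k : Type w} [Field k] [IsAlgClosed k]
  {C : Type u} [Category.{v} C] [Abelian C] [Linear k C] [MonoidalCategory C]
  [MonoidalPreadditive C] [MonoidalLinear k C] [RigidCategory C] [BraidedCategory C]
  [RibbonCategory C] [FusionCategory k C]

theorem trace_smul {X : C} (t : k) (f : X ⟶ X) : trace k (t • f) = t * trace k f :=
  (traceLinear k X).map_smul t f

theorem trace_sum {X : C} {ι : Type*} (s : Finset ι) (f : ι → (X ⟶ X)) :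
    trace k (∑ i ∈ s, f i) = ∑ i ∈ s, trace k (f i) :=
  map_sum (traceLinear k X) f s

theorem DualBases.expand_left {M T : C} (b : DualBases k M T) (g : M ⟶ T) :
    g = ∑ a, trace k (b.ψ a ≫ g) • b.φ a := by
  have h : ∀ a, trace k (b.ψ a ≫ g) = b.φ.repr g a := fun a => by
    conv_lhs => rw [← b.φ.sum_repr g]
    rw [Preadditive.comp_sum, trace_sum]
    simp [Linear.comp_smul, trace_smul, b.dual]
  simp_rw [h, b.φ.sum_repr]

theorem DualBases.expand_right {M T : C} (b : DualBases k M T) (g : T ⟶ M) :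
    g = ∑ a, trace k (g ≫ b.φ a) • b.ψ a := by
  have h : ∀ a, trace k (g ≫ b.φ a) = b.ψ.repr g a := fun a => by
    conv_lhs => rw [← b.ψ.sum_repr g]
    rw [Preadditive.sum_comp, trace_sum]
    simp [Linear.smul_comp, trace_smul, b.dual]
  simp_rw [h, b.ψ.sum_repr]

/-- The canonical element given by dual bases is natural. -/
theorem DualBases.sum_comp {M N T : C} (b : DualBases k M T) (b' : DualBases k N T) (f : M ⟶ N)
    {W : Type*} [AddCommGroup W] [Module k W] (B : (M ⟶ T) →ₗ[k] (T ⟶ N) →ₗ[k] W) :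
    ∑ a, B (f ≫ b'.φ a) (b'.ψ a) = ∑ a, B (b.φ a) (b.ψ a ≫ f) := by
  have h1 : ∀ a, B (f ≫ b'.φ a) (b'.ψ a) =
      ∑ c, trace k (b.ψ c ≫ f ≫ b'.φ a) • B (b.φ c) (b'.ψ a) := fun a => by
    conv_lhs => rw [b.expand_left (f ≫ b'.φ a)]
    simp
  have h2 : ∀ c, B (b.φ c) (b.ψ c ≫ f) =
      ∑ a, trace k (b.ψ c ≫ f ≫ b'.φ a) • B (b.φ c) (b'.ψ a) := fun c => by
    conv_lhs => rw [b'.expand_right (b.ψ c ≫ f)]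
    simp
  simp_rw [h1, h2]
  exact Finset.sum_comm

variable (D : Choices k C)

instance Choices.simple (i : D.I) : Simple (D.S i) := D.isSimpleReps.simple i

theorem Choices.hom_eq_zero {i j : D.I} (h : i ≠ j) (f : D.S i ⟶ D.S j) : f = 0 := by
  by_contra hf
  have := isIso_of_hom_simple hf
  exact h (D.isSimpleReps.eq_of_iso i j ⟨asIso f⟩)

theorem Choices.hom_ext {M N : C} {x y : M ⟶ N} (h : ∀ i (ψ : D.S i ⟶ M), ψ ≫ x = ψ ≫ y) :
    x = y := by
  obtain ⟨n, U, hU, ⟨e⟩⟩ := FusionCategory.semisimple (k := k) M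
  rw [← cancel_epi e.inv]
  refine biproduct.hom_ext' _ _ fun m => ?_
  obtain ⟨i, ⟨t⟩⟩ := D.isSimpleReps.exists_iso (U m) (hU m)
  rw [← cancel_epi t.inv]
  simpa using h i (t.inv ≫ biproduct.ι U m ≫ e.inv)

/-- Bases of `Hom(M, Sⱼ)` and `Hom(Sⱼ, M)`. -/
def Choices.basis (M : C) (j : D.I) : DualBases k M (D.S j) := (nonempty_dualBases k M _).some

theorem Choices.dim_ne_zero (i : D.I) : catDim k (D.S i) ≠ 0 := catDim_ne_zero k _

/-- For bases dual under the trace, ψ ≫ φ is dⱼ⁻¹ times the identity or zero; the weights dⱼ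
compensate. Tested on morphisms from simple objects, where Schur's lemma leaves a single j. -/
theorem Choices.sum_dim_smul {M : C} (b : ∀ j, DualBases k M (D.S j)) :
    ∑ j, catDim k (D.S j) • ∑ a, (b j).φ a ≫ (b j).ψ a = 𝟙 M := by
  refine D.hom_ext fun i ψ => ?_
  rw [Category.comp_id, Preadditive.comp_sum, Finset.sum_eq_single i]
  · rw [Linear.comp_smul, Preadditive.comp_sum]
    have : ∀ a, ψ ≫ (b i).φ a ≫ (b i).ψ a =
        (catDim k (D.S i))⁻¹ • trace k (ψ ≫ (b i).φ a) • (b i).ψ a := fun a => by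
      obtain ⟨t, ht⟩ := endomorphism_simple_eq_smul_id k (ψ ≫ (b i).φ a)
      rw [← Category.assoc, ← ht, trace_smul, show trace k (𝟙 (D.S i)) = catDim k (D.S i) from rfl,
        Linear.smul_comp, Category.id_comp, smul_smul, mul_comm t, ← mul_assoc,
        inv_mul_cancel₀ (D.dim_ne_zero i), one_mul]
    simp_rw [this]
    rw [← Finset.smul_sum, ← (b i).expand_right ψ, smul_smul, mul_inv_cancel₀ (D.dim_ne_zero i),
      one_smul]
  · intro j _ hj
    rw [Linear.comp_smul, Preadditive.comp_sum]
    have : ∀ a, ψ ≫ (b j).φ a ≫ (b j).ψ a = 0 := fun a => by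
      rw [← Category.assoc, D.hom_eq_zero hj.symm (ψ ≫ (b j).φ a), zero_comp]
    simp [this]
  · simp

theorem Choices.sqrtDim_mul_self (i : D.I) : D.sqrtDim i * D.sqrtDim i = catDim k (D.S i) := by
  rw [← pow_two, D.sqrtDim_sq]

end Bases

/-! ### The free half-braided object -/

section Free

set_option linter.unusedSectionVars false
set_option linter.unusedSimpArgs false

variable {k : Type w} [Field k] [IsAlgClosed k]
  {C : Type u} [Category.{v} C] [Abelian C] [Linear k C] [MonoidalCategory C]
  [MonoidalPreadditive C] [MonoidalLinear k C] [RigidCategory C] [BraidedCategory C]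
  [RibbonCategory C] [FusionCategory k C] (D : Choices k C)

/-- The inclusion of a summand of `⨁ᵢ Sᵢ ⊗ X ⊗ Sᵢ*`. -/
abbrev Choices.inj (X : C) (i : D.I) : D.S i ⊗ X ⊗ (D.S i)ᘁ ⟶ D.indObj X :=
  biproduct.ι (fun i => D.S i ⊗ X ⊗ (D.S i)ᘁ) i

/-- The projection on a summand of `⨁ᵢ Sᵢ ⊗ X ⊗ Sᵢ*`. -/
abbrev Choices.prj (X : C) (i : D.I) : D.indObj X ⟶ D.S i ⊗ X ⊗ (D.S i)ᘁ :=
  biproduct.π (fun i => D.S i ⊗ X ⊗ (D.S i)ᘁ) i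

theorem Choices.inj_prj_sum {X W : C} (i : D.I) (f : ∀ j, D.S j ⊗ X ⊗ (D.S j)ᘁ ⟶ W) :
    D.inj X i ≫ ∑ j, D.prj X j ≫ f j = f i := by
  classical
  rw [Preadditive.comp_sum, Finset.sum_eq_single i]
  · simp
  · intro j _ hj
    rw [← Category.assoc, biproduct.ι_π_ne _ hj.symm, zero_comp]
  · simp

theorem Choices.whisker_inj_prj_sum {X W : C} (A : C) (i : D.I)
    (f : ∀ j, A ⊗ (D.S j ⊗ X ⊗ (D.S j)ᘁ) ⟶ W) :
    A ◁ D.inj X i ≫ ∑ j, A ◁ D.prj X j ≫ f j = f i := by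
  classical
  rw [Preadditive.comp_sum, Finset.sum_eq_single i]
  · rw [← Category.assoc, ← MonoidalCategory.whiskerLeft_comp, biproduct.ι_π_self]
    simp
  · intro j _ hj
    rw [← Category.assoc, ← MonoidalCategory.whiskerLeft_comp, biproduct.ι_π_ne _ hj.symm]
    simp
  · simp

theorem Choices.whisker_indObj_hom_ext {A X W : C} {f g : A ⊗ D.indObj X ⟶ W}
    (h : ∀ i, A ◁ D.inj X i ≫ f = A ◁ D.inj X i ≫ g) : f = g := by
  have key : 𝟙 (A ⊗ D.indObj X) = ∑ i, A ◁ D.prj X i ≫ A ◁ D.inj X i := by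
    rw [← MonoidalCategory.whiskerLeft_id, ← biproduct.total, whiskerLeft_sum]
    simp only [MonoidalCategory.whiskerLeft_comp]
  rw [← Category.id_comp f, ← Category.id_comp g, key, Preadditive.sum_comp, Preadditive.sum_comp]
  simp [h]

/-- Apply `φ : T ⟶ S` to the left of `X` and create the pair `S*`, `T'` with `ψ : S ⟶ T'` to its
right. -/
def flank {S T T' : C} (X : C) (φ : T ⟶ S) (ψ : S ⟶ T') : T ⊗ X ⟶ (S ⊗ X ⊗ Sᘁ) ⊗ T' :=
  𝟙 _ ⊗≫ φ ▷ X ⊗≫ (S ⊗ X) ◁ (coevTilde S ≫ Sᘁ ◁ ψ) ⊗≫ 𝟙 _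

variable (k) in
/-- `flank` as a bilinear map. -/
def flankLinear {S T T' : C} (X : C) :
    (T ⟶ S) →ₗ[k] (S ⟶ T') →ₗ[k] (T ⊗ X ⟶ (S ⊗ X ⊗ Sᘁ) ⊗ T') :=
  LinearMap.mk₂ k (flank X)
    (fun _ _ _ => by simp [flank, monoidalComp])
    (fun _ _ _ => by simp [flank, monoidalComp])
    (fun _ _ _ => by simp [flank, monoidalComp])
    (fun _ _ _ => by simp [flank, monoidalComp])

theorem flankLinear_apply {S T T' : C} (X : C) (φ : T ⟶ S) (ψ : S ⟶ T') :
    flankLinear k X φ ψ = flank X φ ψ := rfl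

theorem comp_flank {S T T' U : C} (X : C) (f : U ⟶ T) (φ : T ⟶ S) (ψ : S ⟶ T') :
    flank X (f ≫ φ) ψ = f ▷ X ≫ flank X φ ψ := by
  simp only [flank]; monoidal

theorem flank_comp {S T T' U : C} (X : C) (φ : T ⟶ S) (ψ : S ⟶ T') (f : T' ⟶ U) :
    flank X φ (ψ ≫ f) = flank X φ ψ ≫ (S ⊗ X ⊗ Sᘁ) ◁ f := by
  simp only [flank]; monoidal

/-- The Sᘁ created by `flank` is annihilated by the closing evaluation; the resulting zigzag
straightens. -/
theorem flank_closeRight {S T T' X W : C} (φ : T ⟶ S) (ψ : S ⟶ T') (h : S ⊗ X ⟶ W ⊗ S) :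
    flank X φ ψ ≫ closeRight h ▷ T' = φ ▷ X ≫ h ≫ W ◁ ψ := by
  simp only [flank, closeRight]
  calc
    _ = 𝟙 _ ⊗≫ φ ▷ X ⊗≫ ((S ⊗ X) ◁ (coevTilde S ≫ Sᘁ ◁ ψ) ≫ h ▷ (Sᘁ ⊗ T')) ⊗≫
        W ◁ evTilde S ▷ T' ⊗≫ 𝟙 _ := by monoidal
    _ = 𝟙 _ ⊗≫ φ ▷ X ⊗≫ h ⊗≫ W ◁ (S ◁ coevTilde S ⊗≫ ((S ⊗ Sᘁ) ◁ ψ ≫ evTilde S ▷ T')) ⊗≫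
        𝟙 _ := by rw [whisker_exchange]; monoidal
    _ = 𝟙 _ ⊗≫ φ ▷ X ⊗≫ h ⊗≫ W ◁ (S ◁ coevTilde S ⊗≫ evTilde S ▷ S) ⊗≫ W ◁ ψ ⊗≫ 𝟙 _ := by
      rw [whisker_exchange]; monoidal
    _ = _ := by rw [coevTilde_evTilde]; monoidal

theorem closeRight_flank_id (S X : C) : closeRight (flank X (𝟙 S) (𝟙 S)) = 𝟙 _ := by
  simp only [flank, closeRight]
  calc
    _ = 𝟙 _ ⊗≫ (S ⊗ X) ◁ (coevTilde S ▷ Sᘁ ⊗≫ Sᘁ ◁ evTilde S) ⊗≫ 𝟙 _ := by monoidal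
    _ = _ := by rw [evTilde_coevTilde]; monoidal

/-- The universal morphism `T ⊗ X ⟶ I(X) ⊗ T`. -/
def Choices.kappa (X T : C) : T ⊗ X ⟶ D.indObj X ⊗ T :=
  ∑ j, D.sqrtDim j • (∑ a, flank X ((D.basis T j).φ a) ((D.basis T j).ψ a)) ≫ D.inj X j ▷ T

/-- Independence of the bases allows the prescribed bases of Hom(A ⊗ Sᵢ, Sⱼ) in Γ to be compared
with the chosen ones. -/
theorem Choices.kappa_eq (X T : C) (b : ∀ j, DualBases k T (D.S j)) :
    D.kappa X T = ∑ j, D.sqrtDim j • (∑ a, flank X ((b j).φ a) ((b j).ψ a)) ≫ D.inj X j ▷ T := by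
  refine Finset.sum_congr rfl fun j _ => ?_
  have := (b j).sum_comp (D.basis T j) (𝟙 T) (flankLinear k X)
  simp only [Category.id_comp, Category.comp_id, flankLinear_apply] at this
  rw [this]

theorem Choices.kappa_naturality (X : C) {T T' : C} (f : T ⟶ T') :
    f ▷ X ≫ D.kappa X T' = D.kappa X T ≫ D.indObj X ◁ f := by
  rw [kappa, kappa, Preadditive.comp_sum, Preadditive.sum_comp]
  refine Finset.sum_congr rfl fun j _ => ?_
  have := (D.basis T j).sum_comp (D.basis T' j) f (flankLinear k X)
  simp only [flankLinear_apply, comp_flank, flank_comp] at this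
  rw [Linear.comp_smul, Linear.smul_comp, Category.assoc, ← whisker_exchange,
    ← Category.assoc, ← Category.assoc, Preadditive.sum_comp _ _ ((D.S j ⊗ X ⊗ (D.S j)ᘁ) ◁ f),
    ← this, Preadditive.comp_sum]

/-- By Schur's lemma only j = i survives in the closure of `kappa` at Sᵢ. The factor √dᵢ of `kappa`
and the one in front make dᵢ, as the resolution of the identity requires. -/
theorem Choices.inj_eq (X : C) (i : D.I) :
    D.inj X i = D.sqrtDim i • closeRight (D.kappa X (D.S i)) := by
  have key : closeRight (D.kappa X (D.S i)) = ∑ j, D.sqrtDim j • ∑ a,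
      closeRight (flank X ((D.basis (D.S i) j).φ a) ((D.basis (D.S i) j).ψ a)) ≫ D.inj X j := by
    simp only [closeRight_comp]
    simp [kappa, closeRight, monoidalComp, sum_whiskerRight, whiskerLeft_sum, Preadditive.sum_comp, Preadditive.comp_sum,
      Finset.smul_sum]
  have h1 := D.sum_dim_smul (fun j => D.basis (D.S i) j)
  rw [Finset.sum_eq_single i (fun j _ hj => by
    rw [Finset.sum_eq_zero fun a _ => ?_, smul_zero]
    rw [D.hom_eq_zero hj.symm ((D.basis (D.S i) j).φ a), zero_comp]) (by simp)] at h1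
  rw [key, Finset.sum_eq_single i (fun j _ hj => by
    rw [Finset.sum_eq_zero fun a _ => ?_, smul_zero]
    rw [D.hom_eq_zero hj.symm ((D.basis (D.S i) j).φ a)]
    simp [flank, closeRight, monoidalComp]) (by simp)]
  -- φ is a scalar endomorphism of Sᵢ and can be moved past X into the other argument, where φ ≫ ψ
  -- appears.
  have h2 : ∀ a, flank X ((D.basis (D.S i) i).φ a) ((D.basis (D.S i) i).ψ a) =
      flankLinear k X (𝟙 _) ((D.basis (D.S i) i).φ a ≫ (D.basis (D.S i) i).ψ a) := fun a => by
    obtain ⟨t, ht⟩ := endomorphism_simple_eq_smul_id k ((D.basis (D.S i) i).φ a)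
    rw [← ht, ← flankLinear_apply (k := k)]
    simp
  rw [← Preadditive.sum_comp, smul_smul, D.sqrtDim_mul_self]
  have h3 : catDim k (D.S i) • ∑ a,
      closeRight (flank X ((D.basis (D.S i) i).φ a) ((D.basis (D.S i) i).ψ a)) = 𝟙 _ := by
    -- Stated for any x equal to the identity, so that x may be the resolution Σ d φ ≫ ψ and
    -- linearity can distribute over its terms.
    have h4 : ∀ x, x = 𝟙 _ → closeRight (flankLinear k X (𝟙 (D.S i)) x) = 𝟙 _ := by
      rintro x rfl; exact closeRight_flank_id _ _
    rw [← h4 _ h1]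
    simp only [h2]
    simp [closeRight, monoidalComp, sum_whiskerRight, whiskerLeft_sum, Preadditive.sum_comp, Preadditive.comp_sum,
      Finset.smul_sum]
  rw [← Linear.smul_comp, h3, Category.id_comp]

/-- Morphisms out of `A ⊗ I(X)` are determined by their composition with the universal
morphisms. -/
theorem Choices.kappa_hom_ext {A X W : C} {f g : A ⊗ D.indObj X ⟶ W}
    (h : ∀ T, A ◁ D.kappa X T ≫ (α_ A _ T).inv ≫ f ▷ T =
      A ◁ D.kappa X T ≫ (α_ A _ T).inv ≫ g ▷ T) : f = g := by
  refine D.whisker_indObj_hom_ext fun i => ?_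
  rw [D.inj_eq, MonoidalLinear.whiskerLeft_smul, Linear.smul_comp, Linear.smul_comp]
  congr 1
  have key : ∀ f : A ⊗ D.indObj X ⟶ W, A ◁ closeRight (D.kappa X (D.S i)) ≫ f =
      𝟙 _ ⊗≫ (A ◁ D.kappa X (D.S i) ≫ (α_ A _ (D.S i)).inv ≫ f ▷ (D.S i)) ▷ (D.S i)ᘁ ⊗≫
        W ◁ evTilde (D.S i) ⊗≫ 𝟙 _ := fun f => by
    simp only [closeRight]
    calc
      _ = 𝟙 _ ⊗≫ A ◁ D.kappa X (D.S i) ▷ (D.S i)ᘁ ⊗≫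
          ((A ⊗ D.indObj X) ◁ evTilde (D.S i) ≫ f ▷ 𝟙_ C) ⊗≫ 𝟙 _ := by monoidal
      _ = _ := by rw [whisker_exchange]; monoidal
  rw [key, key, h]

theorem bend_eq {A U T : C} (ψ : T ⟶ A ⊗ U) :
    bend ψ = 𝟙 _ ⊗≫ (coevTilde T ≫ (Tᘁ : C) ◁ ψ) ▷ Uᘁ ⊗≫ (Tᘁ ⊗ A : C) ◁ evTilde U ⊗≫ 𝟙 _ := by
  simp only [bend]; monoidal

theorem Choices.whisker_inj_gamma (X A : C) (i : D.I) :
    A ◁ D.inj X i ≫ D.gamma X A = ∑ j, D.gammaComponent X A i j ≫ D.inj X j ▷ A := by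
  simp only [gamma]
  simp only [← Preadditive.comp_sum]
  exact D.whisker_inj_prj_sum A i (fun i => ∑ j, D.gammaComponent X A i j ≫ D.inj X j ▷ A)

/-- `Γ` in terms of the universal morphisms. -/
theorem Choices.whisker_inj_gamma_eq (X A : C) (i : D.I) :
    A ◁ D.inj X i ≫ D.gamma X A = D.sqrtDim i • (𝟙 _ ⊗≫ D.kappa X (A ⊗ D.S i) ▷ (D.S i)ᘁ ⊗≫
      (D.indObj X ⊗ A) ◁ evTilde (D.S i) ⊗≫ 𝟙 _) := by
  rw [whisker_inj_gamma, D.kappa_eq X (A ⊗ D.S i) (fun j => D.bases A i j)]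
  simp only [gammaComponent]
  have h : ∀ j a, (𝟙 (A ⊗ (D.S i ⊗ X ⊗ (D.S i)ᘁ)) ⊗≫ ((D.bases A i j).φ a ⊗ₘ (X ◁ bend ((D.bases A i j).ψ a))) ⊗≫ 𝟙 _) ≫
      D.inj X j ▷ A = 𝟙 _ ⊗≫ (flank X ((D.bases A i j).φ a) ((D.bases A i j).ψ a) ≫
        D.inj X j ▷ (A ⊗ D.S i)) ▷ (D.S i)ᘁ ⊗≫
      (D.indObj X ⊗ A) ◁ evTilde (D.S i) ⊗≫ 𝟙 _ := fun j a => by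
    rw [bend_eq, flank, MonoidalCategory.tensorHom_def]
    symm
    calc
      _ = 𝟙 _ ⊗≫ (D.bases A i j).φ a ▷ (X ⊗ (D.S i)ᘁ) ⊗≫ (D.S j ⊗ X) ◁
          (coevTilde (D.S j) ≫ (D.S j)ᘁ ◁ (D.bases A i j).ψ a) ▷ (D.S i)ᘁ ⊗≫
          (D.inj X j ▷ (A ⊗ D.S i ⊗ (D.S i)ᘁ) ≫
          D.indObj X ◁ A ◁ evTilde (D.S i)) ⊗≫ 𝟙 _ := by monoidal
      _ = _ := by rw [← whisker_exchange]; monoidal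
  simp only [Linear.smul_comp, Preadditive.sum_comp, h, mul_smul, ← Finset.smul_sum]
  congr 1
  simp [monoidalComp, sum_whiskerRight, whiskerLeft_sum, Preadditive.sum_comp,
    Preadditive.comp_sum, Finset.smul_sum]

/-- The half-braiding `Γ` composes with the universal morphisms. -/
theorem Choices.kappa_gamma (X A T : C) :
    A ◁ D.kappa X T ≫ (α_ A _ T).inv ≫ D.gamma X A ▷ T =
      (α_ A T X).inv ≫ D.kappa X (A ⊗ T) ≫ (α_ _ A T).inv := by
  -- On one term, Γ_A is the closure of `kappa` at A ⊗ Sⱼ. Its evaluation meets the coevaluation of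
  -- `flank`, and φ passes through by naturality, leaving φ ≫ ψ. The weight √dⱼ · √dⱼ then resolves
  -- the identity of T.
  have h : ∀ j a, A ◁ (flank X ((D.basis T j).φ a) ((D.basis T j).ψ a) ≫ D.inj X j ▷ T) ≫
      (α_ A _ T).inv ≫ D.gamma X A ▷ T = D.sqrtDim j • ((α_ A T X).inv ≫ D.kappa X (A ⊗ T) ≫
        (D.indObj X) ◁ A ◁ ((D.basis T j).φ a ≫ (D.basis T j).ψ a) ≫ (α_ _ A T).inv) := fun j a => by
    have h1 := D.whisker_inj_gamma_eq X A j
    have h2 := D.kappa_naturality X (A ◁ ((D.basis T j).φ a))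
    generalize (D.basis T j).φ a = φ at *
    generalize (D.basis T j).ψ a = ψ
    calc
      _ = 𝟙 _ ⊗≫ A ◁ flank X φ ψ ⊗≫ (A ◁ D.inj X j ≫ D.gamma X A) ▷ T ⊗≫ 𝟙 _ := by monoidal
      _ = D.sqrtDim j • (𝟙 _ ⊗≫ A ◁ flank X φ ψ ⊗≫ (𝟙 (A ⊗ D.S j ⊗ X ⊗ (D.S j)ᘁ) ⊗≫
          D.kappa X (A ⊗ D.S j) ▷ (D.S j)ᘁ ⊗≫
          (D.indObj X ⊗ A) ◁ evTilde (D.S j) ⊗≫ 𝟙 (D.indObj X ⊗ A)) ▷ T ⊗≫ 𝟙 _) := by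
        rw [h1]
        simp only [monoidalComp, MonoidalLinear.smul_whiskerRight, Linear.smul_comp,
          Linear.comp_smul]
      _ = _ := ?_
    congr 1
    simp only [flank]
    calc
      _ = 𝟙 _ ⊗≫ (A ◁ φ) ▷ X ⊗≫ (((A ⊗ D.S j) ⊗ X) ◁ (coevTilde (D.S j) ≫ (D.S j)ᘁ ◁ ψ) ≫
          D.kappa X (A ⊗ D.S j) ▷ ((D.S j)ᘁ ⊗ T)) ⊗≫
          (D.indObj X ⊗ A) ◁ evTilde (D.S j) ▷ T ⊗≫ 𝟙 _ := by monoidal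
      _ = 𝟙 _ ⊗≫ ((A ◁ φ) ▷ X ≫ D.kappa X (A ⊗ D.S j)) ⊗≫ (D.indObj X ⊗ A) ◁
          (D.S j ◁ coevTilde (D.S j) ⊗≫ ((D.S j ⊗ (D.S j)ᘁ) ◁ ψ ≫ evTilde (D.S j) ▷ T)) ⊗≫
          𝟙 _ := by rw [whisker_exchange]; monoidal
      _ = 𝟙 _ ⊗≫ D.kappa X (A ⊗ T) ⊗≫ (D.indObj X ⊗ A) ◁ (φ ⊗≫
          (D.S j ◁ coevTilde (D.S j) ⊗≫ evTilde (D.S j) ▷ D.S j) ⊗≫ ψ) ⊗≫ 𝟙 _ := by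
        rw [whisker_exchange, h2]; monoidal
      _ = _ := by rw [coevTilde_evTilde]; monoidal
  conv_lhs => rw [kappa]
  have h3 : A ◁ (∑ j, D.sqrtDim j • (∑ a, flank X ((D.basis T j).φ a) ((D.basis T j).ψ a)) ≫
      D.inj X j ▷ T) ≫ (α_ A _ T).inv ≫ D.gamma X A ▷ T =
      ∑ j, D.sqrtDim j • ∑ a, A ◁ (flank X ((D.basis T j).φ a) ((D.basis T j).ψ a) ≫
        D.inj X j ▷ T) ≫ (α_ A _ T).inv ≫ D.gamma X A ▷ T := by
    simp [sum_whiskerRight, whiskerLeft_sum, Preadditive.sum_comp, Preadditive.comp_sum,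
      Finset.smul_sum]
  rw [h3]
  simp only [h]
  have h4 := D.sum_dim_smul (fun j => D.basis T j)
  have h5 : ∀ x : T ⟶ T, x = 𝟙 T → (α_ A T X).inv ≫ D.kappa X (A ⊗ T) ≫
      (D.indObj X) ◁ A ◁ x ≫ (α_ _ A T).inv =
      (α_ A T X).inv ≫ D.kappa X (A ⊗ T) ≫ (α_ _ A T).inv := by
    rintro x rfl; simp
  rw [← h5 _ h4]
  simp only [← Finset.smul_sum, smul_smul, D.sqrtDim_mul_self]
  simp [sum_whiskerRight, whiskerLeft_sum, Preadditive.sum_comp,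
    Preadditive.comp_sum, Finset.smul_sum]

end Free
end
end EllipticCenter



namespace EllipticCenter

noncomputable section

attribute [local instance] Abelian.hasFiniteBiproducts

/-! ### Universal property of (I(X), Γ), and well-definedness of the induction functor -/

section FreeProperty

set_option linter.unusedSectionVars false
set_option linter.unusedSimpArgs false

variable {k : Type w} [Field k] [IsAlgClosed k]
  {C : Type u} [Category.{v} C] [Abelian C] [Linear k C] [MonoidalCategory C]
  [MonoidalPreadditive C] [MonoidalLinear k C] [RigidCategory C] [BraidedCategory C]
  [RibbonCategory C] [FusionCategory k C] (D : Choices k C)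

/-- The extension of `f : X ⟶ W` to `I(X) ⟶ W`, for a family on `W`. -/
def Choices.ext {X W : C} (w : HalfFamily W) (f : X ⟶ W) : D.indObj X ⟶ W :=
  ∑ i, D.prj X i ≫ (D.sqrtDim i • closeRight (D.S i ◁ f ≫ w (D.S i)))

theorem Choices.inj_ext {X W : C} (w : HalfFamily W) (f : X ⟶ W) (i : D.I) :
    D.inj X i ≫ D.ext w f = D.sqrtDim i • closeRight (D.S i ◁ f ≫ w (D.S i)) :=
  D.inj_prj_sum i fun i => D.sqrtDim i • closeRight (D.S i ◁ f ≫ w (D.S i))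

/-- On each term the closure straightens to φ, the crossing w_S and ψ; naturality of w collects φ ≫
ψ, and the terms sum to the crossing with T. -/
theorem Choices.kappa_ext {X W : C} {w : HalfFamily W} (hw : IsHalf w) (f : X ⟶ W) (T : C) :
    D.kappa X T ≫ D.ext w f ▷ T = T ◁ f ≫ w T := by
  have h1 : ∀ j a, (flank X ((D.basis T j).φ a) ((D.basis T j).ψ a) ≫ D.inj X j ▷ T) ≫
      D.ext w f ▷ T = D.sqrtDim j • (T ◁ f ≫ w T ≫
        W ◁ ((D.basis T j).φ a ≫ (D.basis T j).ψ a)) := fun j a => by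
    rw [Category.assoc, ← comp_whiskerRight, D.inj_ext, MonoidalLinear.smul_whiskerRight,
      Linear.comp_smul, flank_closeRight, MonoidalCategory.whiskerLeft_comp, ← reassoc_of% hw.nat,
      whisker_exchange_assoc, Category.assoc]
  have h2 : ∀ x : T ⟶ T, x = 𝟙 T → T ◁ f ≫ w T ≫ W ◁ x = T ◁ f ≫ w T := by
    rintro x rfl; simp
  rw [← h2 _ (D.sum_dim_smul (fun j => D.basis T j)), kappa, Preadditive.sum_comp]
  simp only [Linear.smul_comp, Preadditive.sum_comp, h1, ← Finset.smul_sum, smul_smul,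
    D.sqrtDim_mul_self]
  simp [whiskerLeft_sum, Preadditive.comp_sum, Finset.smul_sum]

/-- The universal morphism `X ⟶ I(X)`. -/
def Choices.iota (X : C) : X ⟶ D.indObj X := (λ_ X).inv ≫ D.kappa X (𝟙_ C) ≫ (ρ_ _).hom

theorem Choices.iota_ext {X W : C} {w : HalfFamily W} (hw : IsHalf w) (f : X ⟶ W) :
    D.iota X ≫ D.ext w f = f := by
  have h := D.kappa_ext hw f (𝟙_ C)
  rw [hw.unit] at h
  calc
    _ = (λ_ X).inv ≫ (D.kappa X (𝟙_ C) ≫ D.ext w f ▷ 𝟙_ C) ≫ (ρ_ _).hom := by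
      rw [iota]; monoidal
    _ = _ := by rw [h]; monoidal

/-- Thus `kappa` is recovered from ι and Γ, which is why ι generates I(X). -/
theorem Choices.whiskerLeft_iota_gamma (X T : C) : T ◁ D.iota X ≫ D.gamma X T = D.kappa X T := by
  have h := D.kappa_gamma X T (𝟙_ C)
  have h2 := D.kappa_naturality X (ρ_ T).hom
  calc
    _ = 𝟙 _ ⊗≫ (T ◁ D.kappa X (𝟙_ C) ≫ (α_ T _ (𝟙_ C)).inv ≫ D.gamma X T ▷ 𝟙_ C) ⊗≫ 𝟙 _ := by
      rw [iota]; monoidal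
    _ = (ρ_ T).inv ▷ X ≫ (D.kappa X (T ⊗ 𝟙_ C) ≫ D.indObj X ◁ (ρ_ T).hom) := by
      rw [h]; monoidal
    _ = _ := by rw [← h2]; simp

/-- Tested on `kappa`, Γ_A replaces T by A ⊗ T, so the axioms become naturality of `kappa` in its
index object. -/
theorem Choices.gamma_isHalf (X : C) : IsHalf (D.gamma X) := by
  refine ⟨fun {A B} f => D.kappa_hom_ext fun T => ?_, fun A B => D.kappa_hom_ext fun T => ?_,
    D.kappa_hom_ext fun T => ?_⟩
  · calc
      _ = 𝟙 _ ⊗≫ (A ◁ D.kappa X T ≫ f ▷ (D.indObj X ⊗ T)) ⊗≫ D.gamma X B ▷ T ⊗≫ 𝟙 _ := by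
        monoidal
      _ = f ▷ (T ⊗ X) ⊗≫ (B ◁ D.kappa X T ≫ (α_ B _ T).inv ≫ D.gamma X B ▷ T) := by
        rw [whisker_exchange]; monoidal
      _ = 𝟙 _ ⊗≫ ((f ▷ T) ▷ X ≫ D.kappa X (B ⊗ T)) ⊗≫ 𝟙 _ := by
        rw [D.kappa_gamma]; monoidal
      _ = 𝟙 _ ⊗≫ ((α_ A T X).inv ≫ D.kappa X (A ⊗ T) ≫ (α_ _ A T).inv) ⊗≫
          D.indObj X ◁ f ▷ T ⊗≫ 𝟙 _ := by
        rw [D.kappa_naturality]; monoidal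
      _ = _ := by rw [← D.kappa_gamma]; monoidal
  · rw [D.kappa_gamma]
    symm
    calc
      _ = 𝟙 _ ⊗≫ A ◁ (B ◁ D.kappa X T ≫ (α_ B _ T).inv ≫ D.gamma X B ▷ T) ⊗≫
          D.gamma X A ▷ (B ⊗ T) ⊗≫ 𝟙 _ := by monoidal
      _ = 𝟙 _ ⊗≫ (A ◁ D.kappa X (B ⊗ T) ≫ (α_ A _ (B ⊗ T)).inv ≫ D.gamma X A ▷ (B ⊗ T)) ⊗≫
          𝟙 _ := by rw [D.kappa_gamma]; monoidal
      _ = 𝟙 _ ⊗≫ ((α_ A B T).inv ▷ X ≫ D.kappa X ((A ⊗ B) ⊗ T)) ⊗≫ 𝟙 _ := by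
        rw [D.kappa_gamma, D.kappa_naturality]; monoidal
      _ = _ := by monoidal
  · rw [D.kappa_gamma]
    have h := D.kappa_naturality X (λ_ T).hom
    calc
      _ = (α_ (𝟙_ C) T X).inv ≫ (D.kappa X (𝟙_ C ⊗ T) ≫ D.indObj X ◁ (λ_ T).hom) ⊗≫ 𝟙 _ := by
        monoidal
      _ = _ := by rw [← h]; monoidal

/-- Tested on `kappa`, both sides are the crossing of f with A ⊗ T, split by multiplicativity of w.
-/
theorem Choices.ext_intertwines {X W : C} {w : HalfFamily W} (hw : IsHalf w) (f : X ⟶ W) :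
    Intertwines (D.gamma X) w (D.ext w f) := by
  intro A
  refine D.kappa_hom_ext fun T => ?_
  have h1 := D.kappa_ext hw f T
  have h2 := D.kappa_ext hw f (A ⊗ T)
  rw [hw.mul] at h2
  have h3 := D.kappa_gamma X A T
  calc
    _ = A ◁ (D.kappa X T ≫ D.ext w f ▷ T) ⊗≫ w A ▷ T := by monoidal
    _ = (α_ A T X).inv ≫ (D.kappa X (A ⊗ T) ≫ D.ext w f ▷ (A ⊗ T)) ≫ (α_ _ A T).inv := by
      rw [h1, h2]; monoidal
    _ = (A ◁ D.kappa X T ≫ (α_ A _ T).inv ≫ D.gamma X A ▷ T) ≫ D.ext w f ▷ A ▷ T := by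
      rw [h3]; monoidal
    _ = _ := by simp

/-- An intertwiner out of `I(X)` is given on the summands by its restriction to `X`. -/
theorem Choices.inj_comp {X W : C} {w : HalfFamily W} {F : D.indObj X ⟶ W}
    (hF : Intertwines (D.gamma X) w F) (i : D.I) :
    D.inj X i ≫ F = D.sqrtDim i • closeRight (D.S i ◁ (D.iota X ≫ F) ≫ w (D.S i)) := by
  rw [D.inj_eq, Linear.smul_comp, closeRight_comp, ← D.whiskerLeft_iota_gamma, Category.assoc,
    ← hF, MonoidalCategory.whiskerLeft_comp, Category.assoc]

theorem Choices.gamma_generates (X : C) : Generates (D.gamma X) (D.iota X) := by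
  intro W w f g hf hg hfg
  refine biproduct.hom_ext' _ _ fun i => ?_
  rw [D.inj_comp hf, D.inj_comp hg, hfg]

theorem Intertwines.sum {X Y : C} {σ : HalfFamily X} {τ : HalfFamily Y} {ι : Type*} {s : Finset ι}
    {f : ι → (X ⟶ Y)} (h : ∀ i, Intertwines σ τ (f i)) : Intertwines σ τ (∑ i ∈ s, f i) := by
  intro A
  rw [whiskerLeft_sum, sum_whiskerRight, Preadditive.sum_comp, Preadditive.comp_sum]
  exact Finset.sum_congr rfl fun i _ => h i A

theorem Intertwines.smul {X Y : C} {σ : HalfFamily X} {τ : HalfFamily Y}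
    {f : X ⟶ Y} (h : Intertwines σ τ f) (t : k) : Intertwines σ τ (t • f) := by
  intro A
  rw [MonoidalLinear.whiskerLeft_smul, MonoidalLinear.smul_whiskerRight, Linear.smul_comp,
    Linear.comp_smul, h A]

theorem Choices.inj_intertwines_tilde {X : C} (σ : HalfFamily X) (i : D.I) :
    Intertwines (braidFamily (D.S i) ⊠ σ ⊠ revBraidFamily (D.S i)ᘁ) (D.tilde σ) (D.inj X i) := by
  intro A
  exact D.whisker_inj_prj_sum A i fun i => tensorFamily (braidFamily (D.S i))
      (tensorFamily σ (fun B => (β_ (D.S i)ᘁ B).inv)) A ≫ D.inj X i ▷ A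

theorem Choices.tilde_isHalf {X : C} {σ : HalfFamily X} (hσ : IsHalf σ) : IsHalf (D.tilde σ) := by
  have h := fun i => (braidFamily_isHalf (D.S i)).tensor (hσ.tensor (revBraidFamily_isHalf (D.S i)ᘁ))
  have h' := D.inj_intertwines_tilde σ
  refine ⟨fun {A B} f => D.whisker_indObj_hom_ext fun i => ?_,
    fun A B => D.whisker_indObj_hom_ext fun i => ?_, D.whisker_indObj_hom_ext fun i => ?_⟩
  · rw [whisker_exchange_assoc, h', ← Category.assoc, ← Category.assoc, h', (h i).nat,
      Category.assoc, Category.assoc, whisker_exchange]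
  · rw [h', (h i).mul]
    symm
    calc
      _ = 𝟙 _ ⊗≫ A ◁ (B ◁ D.inj X i ≫ D.tilde σ B) ⊗≫ D.tilde σ A ▷ B ⊗≫ 𝟙 _ := by monoidal
      _ = 𝟙 _ ⊗≫ A ◁ (braidFamily (D.S i) ⊠ σ ⊠ revBraidFamily (D.S i)ᘁ) B ⊗≫
          (A ◁ D.inj X i ≫ D.tilde σ A) ▷ B ⊗≫ 𝟙 _ := by rw [h']; monoidal
      _ = _ := by rw [h']; monoidal
  · rw [h', (h i).unit]
    monoidal

/-- The vertex φ lies to the left of X, where the strand meets c; the created pair lies to the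
right, where it meets c⁻¹. Each piece is natural for its own braiding. -/
theorem flank_intertwines {S T T' X : C} (σ : HalfFamily X) (φ : T ⟶ S) (ψ : S ⟶ T') :
    Intertwines (braidFamily T ⊠ σ) ((braidFamily S ⊠ σ ⊠ revBraidFamily Sᘁ) ⊠ revBraidFamily T')
      (flank X φ ψ) := by
  have h : flank X φ ψ = φ ▷ X ≫ (S ◁ ((ρ_ X).inv ≫ X ◁ (coevTilde S ≫ Sᘁ ◁ ψ) ≫
      (α_ _ _ _).inv)) ≫ (α_ _ _ _).inv := by
    rw [flank]; monoidal
  have h1 : Intertwines unitFamily (revBraidFamily Sᘁ ⊠ revBraidFamily T')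
      (coevTilde S ≫ Sᘁ ◁ ψ) := by
    rw [← revBraidFamily_unit, ← revBraidFamily_tensor]
    exact intertwines_revBraidFamily _
  rw [h]
  exact ((intertwines_braidFamily φ).whiskerRight σ).comp <| (((intertwines_rightUnitor σ).isoInv.comp
    <| (h1.whiskerLeft σ).comp (intertwines_associator _ _ _).isoInv).whiskerLeft _).comp
    (intertwines_associator _ _ _).isoInv

theorem Choices.kappa_intertwines {X : C} (σ : HalfFamily X) (T : C) :
    Intertwines (braidFamily T ⊠ σ) (D.tilde σ ⊠ revBraidFamily T) (D.kappa X T) := by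
  refine .sum fun j => .smul (.comp (.sum fun a => flank_intertwines σ _ _) ?_) _
  exact (D.inj_intertwines_tilde σ j).whiskerRight _

theorem Choices.iota_intertwines_tilde {X : C} (σ : HalfFamily X) :
    Intertwines σ (D.tilde σ) (D.iota X) := by
  refine (intertwines_leftUnitor σ).isoInv.comp (.comp ?_ (intertwines_rightUnitor _))
  have := D.kappa_intertwines σ (𝟙_ C)
  rwa [braidFamily_unit, revBraidFamily_unit] at this

/-- COMM with the roles exchanged: now the crossings σ_A intertwine families made of τ. This version
suits testing Γ on `kappa`. -/
theorem comm_iff_exchange' {X : C} {σ τ : HalfFamily X} :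
    Comm σ τ ↔ Exchange braidFamily revBraidFamily τ σ := by
  have key : ∀ A B : C, (B ◁ σ A ≫ (τ ⊠ revBraidFamily A) B = (braidFamily A ⊠ τ) B ≫ σ A ▷ B) ↔
    (A ◁ τ B ≫ (α_ A X B).inv ≫ σ A ▷ B ≫ (α_ X A B).hom ≫ X ◁ (β_ A B).hom ≫ (α_ X B A).inv =
      (α_ A B X).inv ≫ (β_ B A).inv ▷ X ≫ (α_ B A X).hom ≫ B ◁ σ A ≫ (α_ B X A).inv ≫ τ B ▷ A) := by
    intro A B
    rw [← cancel_epi ((α_ B A X).inv ≫ (β_ B A).hom ▷ X ≫ (α_ A B X).hom),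
      ← cancel_mono ((α_ X B A).hom ≫ X ◁ (β_ A B).inv ≫ (α_ X A B).inv)]
    simp only [tensorFamily, revBraidFamily, braidFamily, Category.assoc]
    simp only [Iso.hom_inv_id_assoc, Iso.inv_hom_id_assoc, hom_inv_whiskerRight_assoc,
      whiskerLeft_hom_inv_assoc, Iso.hom_inv_id, Category.comp_id]
    exact eq_comm
  exact ⟨fun h A B => (key A B).2 (h A B), fun h A B => (key A B).1 (h A B)⟩

/-- On `kappa` at T, Γ_A becomes `kappa` at A ⊗ T, which intertwines the braidings of A ⊗ T by
`Choices.kappa_intertwines`; removing the part belonging to T leaves the claim. -/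
theorem Choices.exchange_gamma {X : C} (σ : HalfFamily X) :
    Exchange braidFamily revBraidFamily (D.tilde σ) (D.gamma X) := by
  intro A B
  rw [← cancel_epi (α_ B A (D.indObj X)).hom]
  refine D.kappa_hom_ext fun T => ?_
  have h1 := ((D.kappa_intertwines σ T).whiskerLeft (braidFamily A)).comp
    (intertwines_associator _ _ _).isoInv B
  have h2 := (intertwines_associator (braidFamily A) (braidFamily T) σ).isoInv.comp
    (((braidFamily_tensor A T) ▸ D.kappa_intertwines σ (A ⊗ T)).comp
      (by rw [revBraidFamily_tensor]; exact (intertwines_associator _ _ _).isoInv)) B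
  rw [← D.kappa_gamma] at h2
  have e : ∀ {Z : C} (u : HalfFamily Z), (u ⊠ revBraidFamily T) B =
    (α_ _ _ _).inv ≫ u B ▷ T ≫ (α_ _ _ _).hom ≫ Z ◁ (β_ T B).inv ≫ (α_ _ _ _).inv := fun _ => rfl
  rw [e] at h1 h2
  rw [← cancel_mono ((α_ _ B T).hom ≫ (D.indObj X ⊗ A) ◁ (β_ T B).inv ≫ (α_ _ T B).inv)]
  calc
    _ = (α_ B A (T ⊗ X)).hom ≫ (B ◁ (A ◁ D.kappa X T ≫ (α_ A _ T).inv ≫ D.gamma X A ▷ T) ≫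
        (α_ _ _ _).inv ≫ (D.tilde σ ⊠ revBraidFamily A) B ▷ T ≫ (α_ _ _ _).hom ≫
        (D.indObj X ⊗ A) ◁ (β_ T B).inv ≫ (α_ _ _ _).inv) := by monoidal
    _ = (α_ B A (T ⊗ X)).hom ≫ ((braidFamily A ⊠ braidFamily T ⊠ σ) B ≫
        (A ◁ D.kappa X T ≫ (α_ A (D.indObj X) T).inv) ▷ B) ≫ D.gamma X A ▷ T ▷ B := by
      rw [h2]; monoidal
    _ = 𝟙 _ ⊗≫ B ◁ A ◁ D.kappa X T ⊗≫ (braidFamily A ⊠ D.tilde σ) B ▷ T ⊗≫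
        ((A ⊗ D.indObj X) ◁ (β_ T B).inv ≫ D.gamma X A ▷ (T ⊗ B)) ⊗≫ 𝟙 _ := by
      rw [← h1]; monoidal
    _ = _ := by rw [whisker_exchange]; monoidal

theorem Choices.comm_gamma_tilde {X : C} (σ : HalfFamily X) : Comm (D.gamma X) (D.tilde σ) :=
  comm_iff_exchange'.2 (D.exchange_gamma σ)

theorem Choices.inj_indMap {X Y : C} (f : X ⟶ Y) (i : D.I) :
    D.inj X i ≫ D.indMap f = D.S i ◁ f ▷ (D.S i)ᘁ ≫ D.inj Y i := by
  simp [indMap]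

theorem Choices.kappa_indMap {X Y : C} (f : X ⟶ Y) (T : C) :
    D.kappa X T ≫ D.indMap f ▷ T = T ◁ f ≫ D.kappa Y T := by
  rw [kappa, kappa, Preadditive.comp_sum, Preadditive.sum_comp]
  refine Finset.sum_congr rfl fun j _ => ?_
  rw [Linear.comp_smul, Linear.smul_comp, Category.assoc, ← comp_whiskerRight, D.inj_indMap,
    Preadditive.sum_comp, Preadditive.sum_comp, Preadditive.comp_sum]
  congr 1
  refine Finset.sum_congr rfl fun a _ => ?_
  simp only [flank]
  generalize (D.basis T j).φ a = φ
  generalize (D.basis T j).ψ a = ψ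
  symm
  calc
    _ = 𝟙 _ ⊗≫ (T ◁ f ≫ φ ▷ Y) ⊗≫ (D.S j ⊗ Y) ◁ (coevTilde (D.S j) ≫ (D.S j)ᘁ ◁ ψ) ⊗≫
        D.inj Y j ▷ T := by monoidal
    _ = 𝟙 _ ⊗≫ φ ▷ X ⊗≫ D.S j ◁ (f ▷ 𝟙_ C ≫ Y ◁ (coevTilde (D.S j) ≫ (D.S j)ᘁ ◁ ψ)) ⊗≫
        D.inj Y j ▷ T := by rw [whisker_exchange]; monoidal
    _ = _ := by rw [← whisker_exchange]; monoidal

theorem Choices.iota_indMap {X Y : C} (f : X ⟶ Y) : D.iota X ≫ D.indMap f = f ≫ D.iota Y := by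
  have h := D.kappa_indMap f (𝟙_ C)
  calc
    _ = (λ_ X).inv ≫ (D.kappa X (𝟙_ C) ≫ D.indMap f ▷ 𝟙_ C) ≫ (ρ_ _).hom := by
      rw [iota]; monoidal
    _ = _ := by rw [h, iota]; monoidal

theorem Choices.indMap_gamma {X Y : C} (f : X ⟶ Y) :
    Intertwines (D.gamma X) (D.gamma Y) (D.indMap f) := by
  have h : D.indMap f = D.ext (D.gamma Y) (f ≫ D.iota Y) := by
    refine biproduct.hom_ext' _ _ fun i => ?_
    rw [D.inj_ext, D.inj_indMap, D.inj_eq, Linear.comp_smul, MonoidalCategory.whiskerLeft_comp,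
      Category.assoc, D.whiskerLeft_iota_gamma, whisker_closeRight]
  rw [h]
  exact D.ext_intertwines (D.gamma_isHalf Y) _

theorem Choices.indMap_tilde {X Y : C} {σ : HalfFamily X} {τ : HalfFamily Y} {f : X ⟶ Y}
    (hf : Intertwines σ τ f) : Intertwines (D.tilde σ) (D.tilde τ) (D.indMap f) := by
  intro A
  refine D.whisker_indObj_hom_ext fun i => ?_
  have h1 := (((hf.whiskerRight (revBraidFamily (D.S i)ᘁ)).whiskerLeft (braidFamily (D.S i))).comp
    (D.inj_intertwines_tilde τ i)) A
  rw [← D.inj_indMap] at h1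
  rw [← Category.assoc, ← MonoidalCategory.whiskerLeft_comp, h1, comp_whiskerRight,
    ← Category.assoc, ← Category.assoc, D.inj_intertwines_tilde σ i A]

theorem HalfBraiding.intertwines {X Y : C} {b : HalfBraiding X} {b' : HalfBraiding Y} {f : X ⟶ Y}
    (h : ∀ A, f ▷ A ≫ (b'.β A).hom = (b.β A).hom ≫ A ◁ f) :
    Intertwines (fun A => (b.β A).inv) (fun A => (b'.β A).inv) f := by
  intro A
  rw [Iso.comp_inv_eq, Category.assoc, h, Iso.inv_hom_id_assoc]

theorem Choices.inductionWellDefined : D.InductionWellDefined where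
  obj X := ⟨isHalfBraiding_iff.2 (D.gamma_isHalf _),
    isHalfBraiding_iff.2 (D.tilde_isHalf (HalfBraiding.isHalf X.2)), D.comm_gamma_tilde _⟩
  map_fst f := D.indMap_gamma f.f
  map_snd f := D.indMap_tilde (HalfBraiding.intertwines f.comm)

end FreeProperty
end
end EllipticCenter



namespace EllipticCenter

noncomputable section

attribute [local instance] Abelian.hasFiniteBiproducts

/-! ### Sliding a strand over a cup -/

section Mate

variable {C : Type u} [Category.{v} C] [MonoidalCategory C]

/-- The mate of a morphism between objects with chosen duals. -/
def mate {K N S T : C} [ExactPairing K N] [ExactPairing S T] (φ : K ⟶ S) : T ⟶ N :=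
  𝟙 _ ⊗≫ T ◁ (η_ K N) ⊗≫ T ◁ φ ▷ N ⊗≫ (ε_ S T) ▷ N ⊗≫ 𝟙 _

theorem mate_id (K N : C) [ExactPairing K N] : mate (𝟙 K) = 𝟙 N := by
  simp only [mate]
  calc
    _ = 𝟙 _ ⊗≫ (N ◁ (η_ K N) ⊗≫ (ε_ K N) ▷ N) ⊗≫ 𝟙 _ := by monoidal
    _ = _ := by rw [ExactPairing.coevaluation_evaluation'']; monoidal

theorem mate_comp {K N S T U V : C} [ExactPairing K N] [ExactPairing S T] [ExactPairing U V]
    (φ : K ⟶ S) (ψ : S ⟶ U) :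
    mate (N := N) (T := V) (φ ≫ ψ) = mate (N := T) (T := V) ψ ≫ mate (N := N) (T := T) φ := by
  simp only [mate]
  symm
  calc
    _ = 𝟙 _ ⊗≫ V ◁ (η_ S T) ⊗≫ V ◁ ψ ▷ T ⊗≫ ((ε_ U V) ▷ (T ⊗ 𝟙_ C) ≫
        𝟙_ C ◁ (T ◁ (η_ K N ≫ φ ▷ N))) ⊗≫ (ε_ S T) ▷ N ⊗≫ 𝟙 _ := by monoidal
    _ = 𝟙 _ ⊗≫ V ◁ (η_ S T) ⊗≫ V ◁ (ψ ▷ (T ⊗ 𝟙_ C) ≫ U ◁ (T ◁ (η_ K N ≫ φ ▷ N))) ⊗≫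
        ((ε_ U V) ▷ (T ⊗ S) ≫ 𝟙_ C ◁ (ε_ S T)) ▷ N ⊗≫ 𝟙 _ := by
      rw [← whisker_exchange]; monoidal
    _ = 𝟙 _ ⊗≫ V ◁ ((η_ S T) ▷ 𝟙_ C ≫ (S ⊗ T) ◁ (η_ K N ≫ φ ▷ N)) ⊗≫
        V ◁ (ψ ▷ (T ⊗ S) ≫ U ◁ (ε_ S T)) ▷ N ⊗≫ (ε_ U V) ▷ N ⊗≫ 𝟙 _ := by
      rw [← whisker_exchange, ← whisker_exchange (ε_ U V)]; monoidal
    _ = 𝟙 _ ⊗≫ V ◁ (η_ K N ≫ φ ▷ N) ⊗≫ V ◁ ((η_ S T) ▷ S ⊗≫ S ◁ (ε_ S T)) ▷ N ⊗≫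
        V ◁ ψ ▷ N ⊗≫ (ε_ U V) ▷ N ⊗≫ 𝟙 _ := by
      rw [← whisker_exchange, ← whisker_exchange ψ]; monoidal
    _ = _ := by rw [ExactPairing.evaluation_coevaluation'']; monoidal

variable [RigidCategory C]

/-- Bend `φ : A ⊗ U ⟶ T` to `T* ⊗ A ⟶ U*`. -/
def rot {A U T : C} (φ : A ⊗ U ⟶ T) : Tᘁ ⊗ A ⟶ Uᘁ :=
  𝟙 _ ⊗≫ (Tᘁ ⊗ A : C) ◁ (η_ U Uᘁ) ⊗≫ (Tᘁ : C) ◁ φ ▷ Uᘁ ⊗≫ (ε_ T Tᘁ) ▷ Uᘁ ⊗≫ 𝟙 _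

theorem coevaluation_rot {A U T N : C} (φ : A ⊗ U ⟶ T) (g : Uᘁ ⟶ N) :
    (λ_ A).inv ≫ (η_ T Tᘁ) ▷ A ⊗≫ T ◁ (rot φ ≫ g) =
      (ρ_ A).inv ≫ A ◁ (η_ U Uᘁ) ⊗≫ (φ ⊗ₘ g) := by
  simp only [rot, MonoidalCategory.tensorHom_def]
  calc
    _ = 𝟙 _ ⊗≫ ((η_ T Tᘁ) ▷ (A ⊗ 𝟙_ C) ≫ (T ⊗ Tᘁ) ◁ (A ◁ (η_ U Uᘁ))) ⊗≫
        (T ⊗ Tᘁ) ◁ φ ▷ Uᘁ ⊗≫ T ◁ (ε_ T Tᘁ) ▷ Uᘁ ⊗≫ T ◁ g := by monoidal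
    _ = 𝟙 _ ⊗≫ A ◁ (η_ U Uᘁ) ⊗≫ ((η_ T Tᘁ) ▷ (A ⊗ U) ≫ (T ⊗ Tᘁ) ◁ φ) ▷ Uᘁ ⊗≫
        T ◁ (ε_ T Tᘁ) ▷ Uᘁ ⊗≫ T ◁ g := by rw [← whisker_exchange]; monoidal
    _ = 𝟙 _ ⊗≫ A ◁ (η_ U Uᘁ) ⊗≫ φ ▷ Uᘁ ⊗≫ ((η_ T Tᘁ) ▷ T ⊗≫ T ◁ (ε_ T Tᘁ)) ▷ Uᘁ ⊗≫
        T ◁ g := by rw [← whisker_exchange]; monoidal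
    _ = _ := by rw [ExactPairing.evaluation_coevaluation'']; monoidal

variable [BraidedCategory C] [RibbonCategory C]

/-- The inverse of `bend`. -/
def unbend {A U T : C} (f : Uᘁ ⟶ Tᘁ ⊗ A) : T ⟶ A ⊗ U :=
  𝟙 _ ⊗≫ T ◁ coevTilde U ⊗≫ T ◁ f ▷ U ⊗≫ evTilde T ▷ (A ⊗ U) ⊗≫ 𝟙 _

theorem bend_unbend {A U T : C} (f : Uᘁ ⟶ Tᘁ ⊗ A) : bend (unbend f) = f := by
  simp only [bend, unbend]
  calc
    _ = 𝟙 _ ⊗≫ coevTilde T ▷ Uᘁ ⊗≫ (Tᘁ ⊗ T : C) ◁ (coevTilde U ▷ Uᘁ) ⊗≫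
        (Tᘁ ⊗ T : C) ◁ f ▷ (U ⊗ Uᘁ) ⊗≫ (Tᘁ : C) ◁ (evTilde T ▷ (A ⊗ U ⊗ Uᘁ) ≫
        𝟙_ C ◁ (A ◁ evTilde U)) ⊗≫ 𝟙 _ := by monoidal
    _ = 𝟙 _ ⊗≫ coevTilde T ▷ Uᘁ ⊗≫ (Tᘁ ⊗ T : C) ◁ (coevTilde U ▷ Uᘁ) ⊗≫
        (Tᘁ ⊗ T : C) ◁ (f ▷ (U ⊗ Uᘁ) ≫ (Tᘁ ⊗ A : C) ◁ evTilde U) ⊗≫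
        (Tᘁ : C) ◁ (evTilde T ▷ A) ⊗≫ 𝟙 _ := by
      rw [← whisker_exchange]; monoidal
    _ = 𝟙 _ ⊗≫ coevTilde T ▷ Uᘁ ⊗≫ (Tᘁ ⊗ T : C) ◁ (coevTilde U ▷ Uᘁ ⊗≫ Uᘁ ◁ evTilde U) ⊗≫
        (Tᘁ ⊗ T : C) ◁ f ⊗≫ (Tᘁ : C) ◁ (evTilde T ▷ A) ⊗≫ 𝟙 _ := by
      rw [← whisker_exchange]; monoidal
    _ = 𝟙 _ ⊗≫ (coevTilde T ▷ Uᘁ ≫ (Tᘁ ⊗ T : C) ◁ f) ⊗≫ (Tᘁ : C) ◁ (evTilde T ▷ A) ⊗≫ 𝟙 _ := by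
      rw [evTilde_coevTilde]; monoidal
    _ = 𝟙 _ ⊗≫ f ⊗≫ (coevTilde T ▷ Tᘁ ⊗≫ (Tᘁ : C) ◁ evTilde T) ▷ A ⊗≫ 𝟙 _ := by
      rw [← whisker_exchange]; monoidal
    _ = _ := by rw [evTilde_coevTilde]; monoidal

theorem bend_leftUnitor_inv (T : C) : bend (λ_ T).inv = (ρ_ (Tᘁ : C)).inv := by
  simp only [bend]
  calc
    _ = 𝟙 _ ⊗≫ (coevTilde T ▷ Tᘁ ⊗≫ (Tᘁ : C) ◁ evTilde T) ⊗≫ 𝟙 _ := by monoidal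
    _ = _ := by rw [evTilde_coevTilde]; monoidal

/-- Rotating both vertices only redraws the closed diagram. Bases dual for the trace pairing thus
remain dual after bending. -/
theorem leftTrace_bend_rot {A U T : C} (ψ : T ⟶ A ⊗ U) (φ : A ⊗ U ⟶ T) :
    coevTilde U ≫ (bend ψ ≫ rot φ) ▷ U ≫ (ε_ U Uᘁ) = coevTilde T ≫ (Tᘁ : C) ◁ (ψ ≫ φ) ≫ ε_ T Tᘁ := by
  simp only [bend, rot]
  calc
    _ = 𝟙 _ ⊗≫ (coevTilde T ▷ 𝟙_ C ≫ (Tᘁ ⊗ T : C) ◁ coevTilde U) ⊗≫ (Tᘁ : C) ◁ (ψ ▷ (Uᘁ ⊗ U)) ⊗≫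
        (Tᘁ ⊗ A : C) ◁ evTilde U ▷ U ⊗≫ (Tᘁ ⊗ A : C) ◁ (η_ U Uᘁ) ▷ U ⊗≫
        (Tᘁ : C) ◁ φ ▷ (Uᘁ ⊗ U) ⊗≫ ((ε_ T Tᘁ) ▷ (Uᘁ ⊗ U) ≫ 𝟙_ C ◁ (ε_ U Uᘁ)) ⊗≫ 𝟙 _ := by
      rw [← whisker_exchange]; monoidal
    _ = 𝟙 _ ⊗≫ coevTilde T ⊗≫ (Tᘁ : C) ◁ (T ◁ coevTilde U ≫ ψ ▷ (Uᘁ ⊗ U)) ⊗≫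
        (Tᘁ ⊗ A : C) ◁ evTilde U ▷ U ⊗≫ (Tᘁ ⊗ A : C) ◁ (η_ U Uᘁ) ▷ U ⊗≫
        (Tᘁ : C) ◁ (φ ▷ (Uᘁ ⊗ U) ≫ T ◁ (ε_ U Uᘁ)) ⊗≫ (ε_ T Tᘁ) ⊗≫ 𝟙 _ := by
      rw [← whisker_exchange (ε_ T Tᘁ)]; monoidal
    _ = 𝟙 _ ⊗≫ coevTilde T ⊗≫ (Tᘁ : C) ◁ ψ ⊗≫
        (Tᘁ ⊗ A : C) ◁ (U ◁ coevTilde U ⊗≫ evTilde U ▷ U) ⊗≫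
        (Tᘁ ⊗ A : C) ◁ ((η_ U Uᘁ) ▷ U ⊗≫ U ◁ (ε_ U Uᘁ)) ⊗≫ (Tᘁ : C) ◁ φ ⊗≫
        (ε_ T Tᘁ) ⊗≫ 𝟙 _ := by
      rw [whisker_exchange, ← whisker_exchange φ]; monoidal
    _ = _ := by
      rw [coevTilde_evTilde, ExactPairing.evaluation_coevaluation'']; monoidal

end Mate

/-! ### Resolution of the identity by dual simples, and coextension to I(Z) -/

section Slide

set_option linter.unusedSectionVars false
set_option linter.unusedSimpArgs false

variable {k : Type w} [Field k] [IsAlgClosed k]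
  {C : Type u} [Category.{v} C] [Abelian C] [Linear k C] [MonoidalCategory C]
  [MonoidalPreadditive C] [MonoidalLinear k C] [RigidCategory C] [BraidedCategory C]
  [RibbonCategory C] [FusionCategory k C] (D : Choices k C)

/-- Morphisms are determined by their compositions with the morphisms from the duals `Sᵢ*`. -/
theorem Choices.hom_ext_dual {N P : C} {x y : N ⟶ P}
    (h : ∀ i (f : (D.S i)ᘁ ⟶ N), f ≫ x = f ≫ y) : x = y := by
  -- N is the right dual of K, so the resolution of id_K by the Sⱼ transposes to one of id_N by the
  -- Sⱼ*.
  let K : C := HasLeftDual.leftDual N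
  have key : 𝟙 N = ∑ j, catDim k (D.S j) • ∑ a,
      mate (N := ((D.S j)ᘁ : C)) (T := N) ((D.basis K j).ψ a) ≫
        mate (N := N) (T := ((D.S j)ᘁ : C)) ((D.basis K j).φ a) := by
    have : ∀ x : K ⟶ K, x = 𝟙 _ → 𝟙 N = mate (N := N) (T := N) x := by
      rintro x rfl; exact (mate_id _ _).symm
    rw [this _ (D.sum_dim_smul (fun j => D.basis K j))]
    simp only [← mate_comp]
    simp [mate, monoidalComp, sum_whiskerRight, whiskerLeft_sum, Preadditive.sum_comp,
      Preadditive.comp_sum, Finset.smul_sum]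
  rw [← Category.id_comp x, ← Category.id_comp y, key]
  simp [Preadditive.sum_comp, h]

theorem coevTilde_evaluation_dim (X : C) :
    coevTilde X ≫ ε_ X Xᘁ = catDim k X • 𝟙 (𝟙_ C) := by
  have := coevTilde_evaluation (𝟙 X)
  rw [MonoidalCategory.whiskerLeft_id, Category.id_comp] at this
  rw [this]
  exact (unitScalar_spec k _).symm

theorem coevaluation_evTilde_dim (X : C) :
    η_ X Xᘁ ≫ evTilde X = catDim k X • 𝟙 (𝟙_ C) := by
  have := unitScalar_spec k (traceEnd (𝟙 X))
  rw [show unitScalar k (traceEnd (𝟙 X)) = catDim k X from rfl, traceEnd, id_whiskerRight,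
    Category.id_comp] at this
  exact this.symm

/-- Schur's lemma for Sᵢ*, transported from Sᵢ by bending. -/
theorem Choices.exists_smul_dual {i : D.I} (f : (D.S i)ᘁ ⟶ (D.S i)ᘁ) : ∃ s : k, f = s • 𝟙 _ := by
  obtain ⟨s, hs⟩ := endomorphism_simple_eq_smul_id k
    (unbend (f ≫ (ρ_ ((D.S i)ᘁ : C)).inv) ≫ (λ_ _).hom)
  refine ⟨s, ?_⟩
  rw [← Iso.comp_inv_eq, Linear.smul_comp, Category.id_comp] at hs
  have h := bend_unbend (f ≫ (ρ_ ((D.S i)ᘁ : C)).inv)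
  rw [← hs] at h
  rw [← cancel_mono (ρ_ ((D.S i)ᘁ : C)).inv, ← h, Linear.smul_comp, Category.id_comp,
    ← bend_leftUnitor_inv]
  simp [bend, monoidalComp]

theorem Choices.hom_dual_eq_zero {i j : D.I} (hij : j ≠ i) (f : (D.S i)ᘁ ⟶ (D.S j)ᘁ) : f = 0 := by
  have h := bend_unbend (f ≫ (ρ_ ((D.S j)ᘁ : C)).inv)
  have h1 : unbend (f ≫ (ρ_ ((D.S j)ᘁ : C)).inv) = 0 := by
    rw [← cancel_mono (λ_ _).hom, zero_comp]
    exact D.hom_eq_zero hij _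
  rw [h1] at h
  rw [← cancel_mono (ρ_ ((D.S j)ᘁ : C)).inv, ← h]
  simp [bend, monoidalComp]

theorem Choices.sum_rot_bend {A : C} {j : D.I} (b : ∀ i, DualBases k (A ⊗ D.S i) (D.S j)) :
    ∑ i, catDim k (D.S i) • ∑ a, rot ((b i).φ a) ≫ bend ((b i).ψ a) = 𝟙 ((D.S j)ᘁ ⊗ A : C) := by
  refine D.hom_ext_dual fun i f => ?_
  rw [Category.comp_id, Preadditive.comp_sum, Finset.sum_eq_single i]
  · rw [← bend_unbend f]
    generalize unbend f = ψ
    have : ∀ a, bend ψ ≫ rot ((b i).φ a) ≫ bend ((b i).ψ a) =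
        (catDim k (D.S i))⁻¹ • trace k (ψ ≫ (b i).φ a) • bend ((b i).ψ a) := fun a => by
      -- The composite on Sᵢ* is a scalar s. Its trace is s dᵢ on one side and tr(ψ ≫ φ) on the
      -- other, so the rotated bases resolve the identity with weights dᵢ, i being the summation
      -- index.
      obtain ⟨s, hs⟩ := D.exists_smul_dual (bend ψ ≫ rot ((b i).φ a))
      have h := leftTrace_bend_rot ψ ((b i).φ a)
      rw [hs, coevTilde_evaluation, MonoidalLinear.smul_whiskerRight, Linear.smul_comp,
        Linear.comp_smul, id_whiskerRight, Category.id_comp, coevTilde_evaluation_dim (k := k),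
        smul_smul] at h
      have h' : trace k (ψ ≫ (b i).φ a) = s * catDim k (D.S i) := unitScalar_eq k h
      rw [← Category.assoc, hs, h', Linear.smul_comp, Category.id_comp, smul_smul, mul_comm s,
        ← mul_assoc, inv_mul_cancel₀ (D.dim_ne_zero i), one_mul]
    rw [Linear.comp_smul, Preadditive.comp_sum]
    simp only [this, ← Finset.smul_sum]
    rw [smul_smul, mul_inv_cancel₀ (D.dim_ne_zero i), one_smul]
    conv_rhs => rw [(b i).expand_right ψ]
    simp [bend, monoidalComp, sum_whiskerRight, whiskerLeft_sum, Preadditive.sum_comp,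
      Preadditive.comp_sum]
  · intro l _ hl
    rw [Linear.comp_smul, Preadditive.comp_sum, Finset.sum_eq_zero fun a _ => ?_, smul_zero]
    rw [← Category.assoc, D.hom_dual_eq_zero hl (f ≫ rot ((b l).φ a)), zero_comp]
  · simp

/-- Sliding a strand over the cup. -/
theorem Choices.sum_coevaluation {A : C} {j : D.I} (b : ∀ i, DualBases k (A ⊗ D.S i) (D.S j)) :
    ∑ i, catDim k (D.S i) • ∑ a, ((ρ_ A).inv ≫ A ◁ (η_ (D.S i) (D.S i)ᘁ) ⊗≫
      ((b i).φ a ⊗ₘ bend ((b i).ψ a))) = (λ_ A).inv ≫ (η_ (D.S j) (D.S j)ᘁ) ▷ A ⊗≫ 𝟙 _ := by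
  have h : ∀ x, x = 𝟙 ((D.S j)ᘁ ⊗ A : C) → (λ_ A).inv ≫ (η_ (D.S j) (D.S j)ᘁ) ▷ A ⊗≫ 𝟙 _ =
      (λ_ A).inv ≫ (η_ (D.S j) (D.S j)ᘁ) ▷ A ⊗≫ D.S j ◁ x := by
    rintro x rfl; simp
  rw [h _ (D.sum_rot_bend b)]
  simp only [← coevaluation_rot]
  simp [monoidalComp, sum_whiskerRight, whiskerLeft_sum, Preadditive.sum_comp,
    Preadditive.comp_sum, Finset.smul_sum]

/-- The coextension of the identity of `Z` to `Z ⟶ I(Z)`, for a family on `Z`. -/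
def Choices.coext {Z : C} (u : HalfFamily Z) : Z ⟶ D.indObj Z :=
  ∑ i, D.sqrtDim i • (openLeft u (D.S i) ≫ D.inj Z i)

/-- On the summand Sᵢ, opening by u and closing by v is one loop; √dᵢ from each side gives the
weight dᵢ. -/
theorem Choices.coext_ext {Z : C} (u v : HalfFamily Z) :
    D.coext u ≫ D.ext v (𝟙 Z) = ∑ i, catDim k (D.S i) • link u v (D.S i) := by
  rw [coext, Preadditive.sum_comp]
  refine Finset.sum_congr rfl fun i _ => ?_
  rw [Linear.smul_comp, Category.assoc, D.inj_ext, Linear.comp_smul, smul_smul,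
    D.sqrtDim_mul_self, MonoidalCategory.whiskerLeft_id, Category.id_comp, link]

/-- Naturality of u moves the vertices of Γ_A onto the coevaluation of Sᵢ, where their weighted sum
slides the strand A across the cup. -/
theorem Choices.coext_intertwines {Z : C} {u : HalfFamily Z} (hu : IsHalf u) :
    Intertwines u (D.gamma Z) (D.coext u) := by
  intro A
  have key : ∀ i j a, A ◁ openLeft u (D.S i) ≫
      (𝟙 (A ⊗ (D.S i ⊗ Z ⊗ (D.S i)ᘁ)) ⊗≫ ((D.bases A i j).φ a ⊗ₘ
        (Z ◁ bend ((D.bases A i j).ψ a))) ⊗≫ 𝟙 ((D.S j ⊗ Z ⊗ (D.S j)ᘁ) ⊗ A)) =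
      𝟙 _ ⊗≫ ((ρ_ A).inv ≫ A ◁ (η_ (D.S i) (D.S i)ᘁ) ⊗≫
      ((D.bases A i j).φ a ⊗ₘ bend ((D.bases A i j).ψ a))) ▷ Z ⊗≫
        D.S j ◁ u ((D.S j)ᘁ ⊗ A : C) ⊗≫ 𝟙 _ := fun i j a => by
    have hn := hu.nat (bend ((D.bases A i j).ψ a))
    generalize (D.bases A i j).φ a = φ at *
    generalize (D.bases A i j).ψ a = ψ at *
    simp only [openLeft, MonoidalCategory.tensorHom_def]
    calc
      _ = 𝟙 _ ⊗≫ A ◁ (η_ (D.S i) (D.S i)ᘁ) ▷ Z ⊗≫ ((A ⊗ D.S i) ◁ u (D.S i)ᘁ ≫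
          φ ▷ (Z ⊗ (D.S i)ᘁ)) ⊗≫ D.S j ◁ Z ◁ bend ψ ⊗≫ 𝟙 _ := by monoidal
      _ = 𝟙 _ ⊗≫ A ◁ (η_ (D.S i) (D.S i)ᘁ) ▷ Z ⊗≫ φ ▷ ((D.S i)ᘁ ⊗ Z) ⊗≫ D.S j ◁ (u (D.S i)ᘁ ≫
          Z ◁ bend ψ) ⊗≫ 𝟙 _ := by rw [whisker_exchange]; monoidal
      _ = _ := by rw [← hn]; monoidal
  have h2 : ∀ j, u A ≫ openLeft u (D.S j) ▷ A = 𝟙 _ ⊗≫ ((λ_ A).inv ≫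
      (η_ (D.S j) (D.S j)ᘁ) ▷ A ⊗≫ 𝟙 (D.S j ⊗ ((D.S j)ᘁ ⊗ A))) ▷ Z ⊗≫
        D.S j ◁ u ((D.S j)ᘁ ⊗ A : C) ⊗≫ 𝟙 _ := fun j => by
    rw [hu.mul, openLeft]
    calc
      _ = 𝟙 _ ⊗≫ (𝟙_ C ◁ u A ≫ (η_ (D.S j) (D.S j)ᘁ) ▷ (Z ⊗ A)) ⊗≫ D.S j ◁ u (D.S j)ᘁ ▷ A ⊗≫
          𝟙 _ := by monoidal
      _ = _ := by rw [whisker_exchange]; monoidal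
  -- The weight √dᵢ · (√dᵢ √dⱼ) is dᵢ √dⱼ: dᵢ is what `sum_coevaluation` needs and √dⱼ is the weight
  -- left in the coextension.
  have h3 : ∀ j, ∑ i, D.sqrtDim i • (A ◁ openLeft u (D.S i) ≫ D.gammaComponent Z A i j) =
      D.sqrtDim j • (u A ≫ openLeft u (D.S j) ▷ A) := fun j => by
    rw [h2, ← D.sum_coevaluation (fun i => D.bases A i j)]
    simp only [gammaComponent, Linear.comp_smul, smul_smul, Preadditive.comp_sum, key]
    simp only [← mul_assoc, D.sqrtDim_mul_self]
    simp only [mul_comm _ (D.sqrtDim j), mul_smul, ← Finset.smul_sum]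
    congr 1
    simp [monoidalComp, sum_whiskerRight, whiskerLeft_sum, Preadditive.sum_comp,
      Preadditive.comp_sum, Finset.smul_sum]
  calc
    _ = ∑ i, D.sqrtDim i • (A ◁ openLeft u (D.S i) ≫ A ◁ D.inj Z i ≫ D.gamma Z A) := by
      simp [coext, whiskerLeft_sum, Preadditive.sum_comp]
    _ = ∑ j, (∑ i, D.sqrtDim i • (A ◁ openLeft u (D.S i) ≫ D.gammaComponent Z A i j)) ≫
        D.inj Z j ▷ A := by
      simp only [D.whisker_inj_gamma, Preadditive.comp_sum, Preadditive.sum_comp, Finset.smul_sum,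
        Linear.smul_comp, Category.assoc]
      exact Finset.sum_comm
    _ = _ := by
      simp only [h3]
      simp [coext, sum_whiskerRight, Preadditive.comp_sum]

end Slide
end
end EllipticCenter



namespace EllipticCenter

noncomputable section

attribute [local instance] Abelian.hasFiniteBiproducts

/-! ### The averaging projections -/

section Average

set_option linter.unusedSectionVars false
set_option linter.unusedSimpArgs false

variable {k : Type w} [Field k] [IsAlgClosed k]
  {C : Type u} [Category.{v} C] [Abelian C] [Linear k C] [MonoidalCategory C]
  [MonoidalPreadditive C] [MonoidalLinear k C] [RigidCategory C] [BraidedCategory C]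
  [RibbonCategory C] [FusionCategory k C] (D : Choices k C)

/-- The average of the links between two families. -/
def Choices.avg {Z : C} (u v : HalfFamily Z) : Z ⟶ Z :=
  D.globalDim⁻¹ • ∑ i, catDim k (D.S i) • link u v (D.S i)

/-- Up to the scalar 𝒟⁻¹ the average factors through I(Z) as a coextension followed by an extension,
both intertwiners. -/
theorem Choices.avg_intertwines {Z : C} {u v : HalfFamily Z} (hu : IsHalf u) (hv : IsHalf v) :
    Intertwines u v (D.avg u v) := by
  rw [avg, ← D.coext_ext]
  exact ((D.coext_intertwines hu).comp (D.ext_intertwines hv _)).smul _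

theorem Choices.comp_avg {Z W : C} {u v : HalfFamily Z} {u' v' : HalfFamily W} {f : Z ⟶ W}
    (hu : Intertwines u u' f) (hv : Intertwines v v' f) : f ≫ D.avg u' v' = D.avg u v ≫ f := by
  simp only [avg, Linear.comp_smul, Linear.smul_comp, Preadditive.comp_sum, Preadditive.sum_comp,
    comp_link hu hv]

theorem Choices.avg_self (hD : D.globalDim ≠ 0) {Z : C} {w : HalfFamily Z} (hw : IsHalf w) :
    D.avg w w = 𝟙 Z := by
  have h : ∀ i, link w w (D.S i) = catDim k (D.S i) • 𝟙 Z := fun i => by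
    rw [hw.link_self, coevaluation_evTilde_dim (k := k)]
    simp [monoidalComp]
  simp only [avg, h, smul_smul, ← pow_two, ← Finset.sum_smul]
  rw [show ∑ i, catDim k (D.S i) ^ 2 = D.globalDim from rfl, inv_mul_cancel₀ hD, one_smul]

theorem Choices.avg_tensor_left {A Z : C} {e : HalfFamily A} (he : IsHalf e) (u v : HalfFamily Z) :
    D.avg (e ⊠ u) (e ⊠ v) = A ◁ D.avg u v := by
  simp only [avg, he.link_tensor_left, MonoidalLinear.whiskerLeft_smul, whiskerLeft_sum]

theorem Choices.avg_tensor_right {A Z : C} {e : HalfFamily A} (he : IsHalf e) (u v : HalfFamily Z) :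
    D.avg (u ⊠ e) (v ⊠ e) = D.avg u v ▷ A := by
  simp only [avg, he.link_tensor_right, MonoidalLinear.smul_whiskerRight, sum_whiskerRight]

/-- Naturality of averages along w_A, together with the fact that a common tensor factor e_A or e'_A
falls out of the loop. -/
theorem Choices.avg_exchange {Z : C} {u v w : HalfFamily Z} {e e' : ∀ A : C, HalfFamily A}
    (he : ∀ A, IsHalf (e A)) (he' : ∀ A, IsHalf (e' A)) (hu : Exchange e e' u w)
    (hv : Exchange e e' v w) : Intertwines w w (D.avg u v) := by
  intro A
  rw [← D.avg_tensor_left (he A), ← D.avg_tensor_right (he' A), D.comp_avg (hu A) (hv A)]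

theorem Choices.Q_eq {X Y : C} (σ : HalfFamily X) (τ : HalfFamily Y) :
    D.Q σ τ = D.avg (σ ⊠ braidFamily Y) (revBraidFamily X ⊠ τ) := by
  simp only [Q, avg, loop_eq_link]

variable {D} {X Y : C} {σ : HalfFamily X} {τ : HalfFamily Y}

theorem Choices.Q_left_right (hσ : IsHalf σ) (hτ : IsHalf τ) :
    Intertwines (σ ⊠ braidFamily Y) (revBraidFamily X ⊠ τ) (D.Q σ τ) := by
  rw [Q_eq]
  exact D.avg_intertwines (hσ.tensor (braidFamily_isHalf Y)) ((revBraidFamily_isHalf X).tensor hτ)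

/-- The crossings of σ ⊠ c exchange with the family itself by Yang–Baxter, and with c⁻¹ ⊠ τ by
naturality of c⁻¹. -/
theorem Choices.Q_left_left (hσ : IsHalf σ) :
    Intertwines (σ ⊠ braidFamily Y) (σ ⊠ braidFamily Y) (D.Q σ τ) := by
  rw [Q_eq]
  exact D.avg_exchange revBraidFamily_isHalf revBraidFamily_isHalf
    (hσ.tensor (braidFamily_isHalf Y)).exchange_revBraid
    ((exchange_revBraid_right X σ).tensor (exchange_revBraid_braid τ))

theorem Choices.Q_right_right (hτ : IsHalf τ) :
    Intertwines (revBraidFamily X ⊠ τ) (revBraidFamily X ⊠ τ) (D.Q σ τ) := by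
  rw [Q_eq]
  exact D.avg_exchange braidFamily_isHalf braidFamily_isHalf
    ((exchange_braid_revBraid σ).tensor (exchange_braid_right Y τ))
    ((revBraidFamily_isHalf X).tensor hτ).exchange_braid

theorem exchange_left {σ' : HalfFamily X} {τ' : HalfFamily Y}
    (hσ : Exchange revBraidFamily braidFamily σ σ') :
    Exchange revBraidFamily braidFamily (σ ⊠ braidFamily Y) (σ' ⊠ τ') :=
  hσ.tensor (exchange_braid_right Y τ')

theorem exchange_right {σ' : HalfFamily X} {τ' : HalfFamily Y}
    (hτ : Exchange revBraidFamily braidFamily τ τ') :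
    Exchange revBraidFamily braidFamily (revBraidFamily X ⊠ τ) (σ' ⊠ τ') :=
  (exchange_revBraid_right X σ').tensor hτ

/-- COMM on each factor, in its exchange form, says that the crossings of σ' ⊠ τ' respect both
families averaged by Q. -/
theorem Choices.Q_snd {σ' : HalfFamily X} {τ' : HalfFamily Y}
    (hσ : Exchange revBraidFamily braidFamily σ σ')
    (hτ : Exchange revBraidFamily braidFamily τ τ') :
    Intertwines (σ' ⊠ τ') (σ' ⊠ τ') (D.Q σ τ) := by
  rw [Q_eq]
  exact D.avg_exchange revBraidFamily_isHalf braidFamily_isHalf (exchange_left hσ)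
    (exchange_right hτ)

/-- By naturality f carries the average to that of w with itself, which is the identity. Idempotence
is the case f = Q. -/
theorem Choices.Q_comp (hD : D.globalDim ≠ 0) {W : C} {w : HalfFamily W} (hw : IsHalf w)
    {f : X ⊗ Y ⟶ W} (h1 : Intertwines (σ ⊠ braidFamily Y) w f)
    (h2 : Intertwines (revBraidFamily X ⊠ τ) w f) : D.Q σ τ ≫ f = f := by
  rw [Q_eq, ← D.comp_avg h1 h2, D.avg_self hD hw, Category.comp_id]

theorem Choices.Q_idem (hD : D.globalDim ≠ 0) (hσ : IsHalf σ) (hτ : IsHalf τ) :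
    D.Q σ τ ≫ D.Q σ τ = D.Q σ τ :=
  Q_comp hD ((revBraidFamily_isHalf X).tensor hτ) (Q_left_right hσ hτ) (Q_right_right hτ)

theorem Choices.Q_right_left (hD : D.globalDim ≠ 0) (hσ : IsHalf σ) (hτ : IsHalf τ) :
    Intertwines (revBraidFamily X ⊠ τ) (σ ⊠ braidFamily Y) (D.Q σ τ) := by
  intro A
  calc
    _ = A ◁ D.Q σ τ ≫ A ◁ D.Q σ τ ≫ (σ ⊠ braidFamily Y) A := by
      conv_lhs => rw [← Q_idem hD hσ hτ]
      simp
    _ = A ◁ D.Q σ τ ≫ A ◁ D.Q σ τ ≫ (revBraidFamily X ⊠ τ) A := by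
      rw [Q_left_left hσ A, Q_left_right hσ hτ A]
    _ = A ◁ D.Q σ τ ≫ (revBraidFamily X ⊠ τ) A := by
      conv_rhs => rw [← Q_idem hD hσ hτ]
      simp
    _ = _ := Q_right_right hτ A

variable (D) in
theorem Choices.proj_incl : (D.proj σ τ : X ⊗ Y ⟶ D.red σ τ) ≫ D.incl σ τ = D.Q σ τ :=
  image.fac (D.Q σ τ)

theorem Choices.incl_proj (hD : D.globalDim ≠ 0) (hσ : IsHalf σ) (hτ : IsHalf τ) :
    D.incl σ τ ≫ D.proj σ τ = 𝟙 (D.red σ τ) := by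
  rw [← cancel_epi (D.proj σ τ), ← cancel_mono (D.incl σ τ)]
  simp only [Category.assoc, Category.comp_id]
  rw [proj_incl D, ← Category.assoc, proj_incl D, Q_idem hD hσ hτ]

theorem Choices.restrict_intertwines (hD : D.globalDim ≠ 0) (hσ : IsHalf σ) (hτ : IsHalf τ)
    {ρ : HalfFamily (X ⊗ Y)} (hρ : Intertwines ρ ρ (D.Q σ τ)) :
    Intertwines (D.restrict σ τ ρ) ρ (D.incl σ τ) ∧ Intertwines ρ (D.restrict σ τ ρ) (D.proj σ τ) :=
  Intertwines.of_retract (incl_proj hD hσ hτ) (by rwa [proj_incl D]) fun _ => rfl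

/-- The first half-braiding on the reduced tensor product. -/
abbrev Choices.redFst (D : Choices k C) (σ : HalfFamily X) (τ : HalfFamily Y) :
    HalfFamily (D.red σ τ) :=
  D.restrict σ τ (σ ⊠ braidFamily Y)

section

variable (hD : D.globalDim ≠ 0) (hσ : IsHalf σ) (hτ : IsHalf τ)

include hD hσ hτ

theorem Choices.incl_left : Intertwines (D.redFst σ τ) (σ ⊠ braidFamily Y) (D.incl σ τ) :=
  (restrict_intertwines hD hσ hτ (Q_left_left hσ)).1

theorem Choices.proj_left : Intertwines (σ ⊠ braidFamily Y) (D.redFst σ τ) (D.proj σ τ) :=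
  (restrict_intertwines hD hσ hτ (Q_left_left hσ)).2

/-- On the image of Q the half-braidings σ ⊠ c and c⁻¹ ⊠ τ coincide; this symmetry of the reduced
product drives all later arguments. -/
theorem Choices.incl_right : Intertwines (D.redFst σ τ) (revBraidFamily X ⊠ τ) (D.incl σ τ) := by
  have := (incl_left hD hσ hτ).comp (Q_left_right (D := D) hσ hτ)
  rwa [← proj_incl D, ← Category.assoc, incl_proj hD hσ hτ, Category.id_comp] at this

theorem Choices.proj_right : Intertwines (revBraidFamily X ⊠ τ) (D.redFst σ τ) (D.proj σ τ) := by
  have := (Q_right_left hD hσ hτ).comp (proj_left hD hσ hτ)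
  rwa [← proj_incl D, Category.assoc, incl_proj hD hσ hτ, Category.comp_id] at this

theorem Choices.redFst_isHalf : IsHalf (D.redFst σ τ) :=
  IsHalf.of_mono (incl_proj hD hσ hτ) (incl_left hD hσ hτ) (hσ.tensor (braidFamily_isHalf Y))

theorem Choices.incl_Q : D.incl σ τ ≫ D.Q σ τ = D.incl σ τ := by
  rw [← proj_incl D, ← Category.assoc, incl_proj hD hσ hτ, Category.id_comp]

end

theorem Exchange.of_retract {X Y : C} {σ σ' : HalfFamily X} {τ τ' : HalfFamily Y}
    {e e' : ∀ A : C, HalfFamily A} (h : Exchange e e' τ τ') {i : X ⟶ Y} {p : Y ⟶ X}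
    (hi : Intertwines σ τ i) (hp : Intertwines τ σ p) (hσ : ∀ A, σ' A = A ◁ i ≫ τ' A ≫ p ▷ A) :
    Exchange e e' σ σ' := by
  intro A
  rw [hσ]
  exact (hi.whiskerLeft _).comp ((h A).comp (hp.whiskerRight _))

end Average

/-! ### Functoriality and associativity of the reduced tensor product -/

section Reduced

set_option linter.unusedSectionVars false
set_option linter.unusedSimpArgs false

variable {k : Type w} [Field k] [IsAlgClosed k]
  {C : Type u} [Category.{v} C] [Abelian C] [Linear k C] [MonoidalCategory C]
  [MonoidalPreadditive C] [MonoidalLinear k C] [RigidCategory C] [BraidedCategory C]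
  [RibbonCategory C] [FusionCategory k C] {D : Choices k C}

/-- The second half-braiding on the reduced tensor product. -/
abbrev Choices.redSnd (D : Choices k C) {X Y : C} (σ σ' : HalfFamily X) (τ τ' : HalfFamily Y) :
    HalfFamily (D.red σ τ) :=
  D.restrict σ τ (σ' ⊠ τ')

/-- The morphism of reduced tensor products induced by two morphisms. -/
def Choices.redMap (D : Choices k C) {X Y X' Y' : C} (σ : HalfFamily X) (τ : HalfFamily Y)
    (σ' : HalfFamily X') (τ' : HalfFamily Y') (f : X ⟶ X') (g : Y ⟶ Y') :
    D.red σ τ ⟶ D.red σ' τ' :=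
  D.incl σ τ ≫ (f ⊗ₘ g) ≫ D.proj σ' τ'

/-- The associator of the reduced tensor product. -/
def Choices.redAssoc (D : Choices k C) {X Y Z : C} (σ : HalfFamily X) (τ : HalfFamily Y)
    (ρ : HalfFamily Z) : D.red (D.redFst σ τ) ρ ⟶ D.red σ (D.redFst τ ρ) :=
  D.incl (D.redFst σ τ) ρ ≫ D.incl σ τ ▷ Z ≫ (α_ X Y Z).hom ≫ X ◁ D.proj τ ρ ≫
    D.proj σ (D.redFst τ ρ)

/-- The inverse of the associator of the reduced tensor product. -/
def Choices.redAssocInv (D : Choices k C) {X Y Z : C} (σ : HalfFamily X) (τ : HalfFamily Y)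
    (ρ : HalfFamily Z) : D.red σ (D.redFst τ ρ) ⟶ D.red (D.redFst σ τ) ρ :=
  D.incl σ (D.redFst τ ρ) ≫ X ◁ D.incl τ ρ ≫ (α_ X Y Z).inv ≫ D.proj σ τ ▷ Z ≫
    D.proj (D.redFst σ τ) ρ

variable (hD : D.globalDim ≠ 0)

include hD

theorem Choices.incl_redSnd {X Y : C} {σ σ' : HalfFamily X} {τ τ' : HalfFamily Y} (hσ : IsHalf σ)
    (hτ : IsHalf τ) (hσ' : Exchange revBraidFamily braidFamily σ σ')
    (hτ' : Exchange revBraidFamily braidFamily τ τ') :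
    Intertwines (D.redSnd σ σ' τ τ') (σ' ⊠ τ') (D.incl σ τ) :=
  (restrict_intertwines hD hσ hτ (Q_snd hσ' hτ')).1

theorem Choices.proj_redSnd {X Y : C} {σ σ' : HalfFamily X} {τ τ' : HalfFamily Y} (hσ : IsHalf σ)
    (hτ : IsHalf τ) (hσ' : Exchange revBraidFamily braidFamily σ σ')
    (hτ' : Exchange revBraidFamily braidFamily τ τ') :
    Intertwines (σ' ⊠ τ') (D.redSnd σ σ' τ τ') (D.proj σ τ) :=
  (restrict_intertwines hD hσ hτ (Q_snd hσ' hτ')).2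

theorem Choices.redSnd_isHalf {X Y : C} {σ σ' : HalfFamily X} {τ τ' : HalfFamily Y}
    (hσ : IsHalf σ) (hτ : IsHalf τ) (hσ' : Exchange revBraidFamily braidFamily σ σ')
    (hτ' : Exchange revBraidFamily braidFamily τ τ') (h1 : IsHalf σ') (h2 : IsHalf τ') :
    IsHalf (D.redSnd σ σ' τ τ') :=
  IsHalf.of_mono (incl_proj hD hσ hτ) (incl_redSnd hD hσ hτ hσ' hτ') (h1.tensor h2)

theorem Choices.red_exchange {X Y : C} {σ σ' : HalfFamily X} {τ τ' : HalfFamily Y}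
    (hσ : IsHalf σ) (hτ : IsHalf τ) (hσ' : Exchange revBraidFamily braidFamily σ σ') :
    Exchange revBraidFamily braidFamily (D.redFst σ τ) (D.redSnd σ σ' τ τ') :=
  (exchange_left (τ' := τ') hσ').of_retract (incl_left hD hσ hτ) (proj_left hD hσ hτ) fun _ => rfl

section Map

variable {X Y X₁ Y₁ : C} {σ σ' : HalfFamily X} {τ τ' : HalfFamily Y} {σ₁ σ₁' : HalfFamily X₁}
  {τ₁ τ₁' : HalfFamily Y₁} {f : X ⟶ X₁} {g : Y ⟶ Y₁} (hσ : IsHalf σ) (hτ : IsHalf τ)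

include hσ hτ

theorem Choices.redMap_incl (hf : Intertwines σ σ₁ f) (hg : Intertwines τ τ₁ g) :
    D.redMap σ τ σ₁ τ₁ f g ≫ D.incl σ₁ τ₁ = D.incl σ τ ≫ (f ⊗ₘ g) := by
  have h : (f ⊗ₘ g) ≫ D.Q σ₁ τ₁ = D.Q σ τ ≫ (f ⊗ₘ g) := by
    rw [Q_eq, Q_eq, D.comp_avg (hf.tensorHom (intertwines_braidFamily g))
      ((intertwines_revBraidFamily f).tensorHom hg)]
  rw [redMap, Category.assoc, Category.assoc, proj_incl D, h, ← Category.assoc, incl_Q hD hσ hτ]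

theorem Choices.redMap_fst (hσ₁ : IsHalf σ₁) (hτ₁ : IsHalf τ₁) (hf : Intertwines σ σ₁ f) :
    Intertwines (D.redFst σ τ) (D.redFst σ₁ τ₁) (D.redMap σ τ σ₁ τ₁ f g) :=
  (incl_left hD hσ hτ).comp <| (hf.tensorHom (intertwines_braidFamily g)).comp <|
    proj_left hD hσ₁ hτ₁

theorem Choices.redMap_snd (hσ' : Exchange revBraidFamily braidFamily σ σ')
    (hτ' : Exchange revBraidFamily braidFamily τ τ') (hσ₁ : IsHalf σ₁) (hτ₁ : IsHalf τ₁)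
    (hσ₁' : Exchange revBraidFamily braidFamily σ₁ σ₁')
    (hτ₁' : Exchange revBraidFamily braidFamily τ₁ τ₁') (hf : Intertwines σ' σ₁' f)
    (hg : Intertwines τ' τ₁' g) :
    Intertwines (D.redSnd σ σ' τ τ') (D.redSnd σ₁ σ₁' τ₁ τ₁') (D.redMap σ τ σ₁ τ₁ f g) :=
  (incl_redSnd hD hσ hτ hσ' hτ').comp <| (hf.tensorHom hg).comp <|
    proj_redSnd hD hσ₁ hτ₁ hσ₁' hτ₁'

end Map

section Assoc

variable {X Y Z : C} {σ : HalfFamily X} {τ : HalfFamily Y} {ρ : HalfFamily Z}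

/-- A morphism respecting three half-braidings on X ⊗ Y ⊗ Z already lands in the iterated reduced
product: each of the two nested projections is an average of two of them and is absorbed by G. -/
theorem Choices.comp_proj_incl_right {W : C} {w : HalfFamily W} (hw : IsHalf w) {G : W ⟶ X ⊗ Y ⊗ Z}
    (hτ : IsHalf τ) (hρ : IsHalf ρ) (h1 : Intertwines w (σ ⊠ braidFamily Y ⊠ braidFamily Z) G)
    (h2 : Intertwines w (revBraidFamily X ⊠ τ ⊠ braidFamily Z) G)
    (h3 : Intertwines w (revBraidFamily X ⊠ revBraidFamily Y ⊠ ρ) G) :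
    G ≫ X ◁ D.proj τ ρ ≫ D.proj σ (D.redFst τ ρ) ≫ D.incl σ (D.redFst τ ρ) ≫ X ◁ D.incl τ ρ =
      G := by
  -- Naturality rewrites the outer projection, which lives on X ⊗ red τ ρ, as an average on the full
  -- triple product.
  have e1 : D.Q σ (D.redFst τ ρ) ≫ X ◁ D.incl τ ρ = X ◁ D.incl τ ρ ≫
      D.avg (σ ⊠ braidFamily Y ⊠ braidFamily Z) (revBraidFamily X ⊠ τ ⊠ braidFamily Z) := by
    rw [Q_eq, D.comp_avg (u := σ ⊠ braidFamily (D.red τ ρ)) (v := revBraidFamily X ⊠ D.redFst τ ρ)]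
    · rw [← braidFamily_tensor]
      exact (intertwines_braidFamily _).whiskerLeft σ
    · exact (incl_left hD hτ hρ).whiskerLeft _
  rw [← Category.assoc (D.proj σ _), proj_incl D, e1, ← MonoidalCategory.whiskerLeft_comp_assoc,
    proj_incl D, Q_eq, ← D.avg_tensor_left (revBraidFamily_isHalf X), ← Category.assoc,
    D.comp_avg h2 h3, D.avg_self hD hw, Category.id_comp, D.comp_avg h1 h2, D.avg_self hD hw,
    Category.id_comp]

theorem Choices.comp_proj_incl_left {W : C} {w : HalfFamily W} (hw : IsHalf w)
    {G : W ⟶ (X ⊗ Y) ⊗ Z}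
    (hσ : IsHalf σ) (hτ : IsHalf τ) (h1 : Intertwines w ((σ ⊠ braidFamily Y) ⊠ braidFamily Z) G)
    (h2 : Intertwines w ((revBraidFamily X ⊠ τ) ⊠ braidFamily Z) G)
    (h3 : Intertwines w ((revBraidFamily X ⊠ revBraidFamily Y) ⊠ ρ) G) :
    G ≫ D.proj σ τ ▷ Z ≫ D.proj (D.redFst σ τ) ρ ≫ D.incl (D.redFst σ τ) ρ ≫ D.incl σ τ ▷ Z =
      G := by
  have e1 : D.Q (D.redFst σ τ) ρ ≫ D.incl σ τ ▷ Z = D.incl σ τ ▷ Z ≫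
      D.avg ((σ ⊠ braidFamily Y) ⊠ braidFamily Z) ((revBraidFamily X ⊠ revBraidFamily Y) ⊠ ρ) := by
    rw [Q_eq, D.comp_avg (u := D.redFst σ τ ⊠ braidFamily Z)
      (v := revBraidFamily (D.red σ τ) ⊠ ρ)]
    · exact (incl_left hD hσ hτ).whiskerRight _
    · rw [← revBraidFamily_tensor]
      exact (intertwines_revBraidFamily _).whiskerRight ρ
  rw [← Category.assoc (D.proj _ ρ), proj_incl D, e1, ← comp_whiskerRight_assoc,
    proj_incl D, Q_eq, ← D.avg_tensor_right (braidFamily_isHalf Z), ← Category.assoc,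
    D.comp_avg h1 h2, D.avg_self hD hw, Category.id_comp, D.comp_avg h1 h3, D.avg_self hD hw,
    Category.id_comp]

variable (hσ : IsHalf σ) (hτ : IsHalf τ) (hρ : IsHalf ρ)

include hσ hτ hρ

theorem Choices.incl_incl_left :
    Intertwines (D.redFst (D.redFst σ τ) ρ) ((σ ⊠ braidFamily Y) ⊠ braidFamily Z)
      (D.incl (D.redFst σ τ) ρ ≫ D.incl σ τ ▷ Z) ∧
    Intertwines (D.redFst (D.redFst σ τ) ρ) ((revBraidFamily X ⊠ τ) ⊠ braidFamily Z)
      (D.incl (D.redFst σ τ) ρ ≫ D.incl σ τ ▷ Z) ∧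
    Intertwines (D.redFst (D.redFst σ τ) ρ) ((revBraidFamily X ⊠ revBraidFamily Y) ⊠ ρ)
      (D.incl (D.redFst σ τ) ρ ≫ D.incl σ τ ▷ Z) := by
  have h := redFst_isHalf hD hσ hτ
  refine ⟨(incl_left hD h hρ).comp ((incl_left hD hσ hτ).whiskerRight _),
    (incl_left hD h hρ).comp ((incl_right hD hσ hτ).whiskerRight _),
    (incl_right hD h hρ).comp ?_⟩
  rw [← revBraidFamily_tensor]
  exact (intertwines_revBraidFamily _).whiskerRight ρ

theorem Choices.incl_incl_right :
    Intertwines (D.redFst σ (D.redFst τ ρ)) (σ ⊠ braidFamily Y ⊠ braidFamily Z)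
      (D.incl σ (D.redFst τ ρ) ≫ X ◁ D.incl τ ρ) ∧
    Intertwines (D.redFst σ (D.redFst τ ρ)) (revBraidFamily X ⊠ τ ⊠ braidFamily Z)
      (D.incl σ (D.redFst τ ρ) ≫ X ◁ D.incl τ ρ) ∧
    Intertwines (D.redFst σ (D.redFst τ ρ)) (revBraidFamily X ⊠ revBraidFamily Y ⊠ ρ)
      (D.incl σ (D.redFst τ ρ) ≫ X ◁ D.incl τ ρ) := by
  have h := redFst_isHalf hD hτ hρ
  refine ⟨(incl_left hD hσ h).comp ?_, (incl_right hD hσ h).comp ((incl_left hD hτ hρ).whiskerLeft _),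
    (incl_right hD hσ h).comp ((incl_right hD hτ hρ).whiskerLeft _)⟩
  rw [← braidFamily_tensor]
  exact (intertwines_braidFamily _).whiskerLeft σ

/-- The inclusion of (XY)Z respects all three half-braidings, so after reassociation the projections
defining the other bracketing act as the identity. The associator is thus the one of C, merely
restricted. -/
theorem Choices.redAssoc_incl :
    D.redAssoc σ τ ρ ≫ D.incl σ (D.redFst τ ρ) ≫ X ◁ D.incl τ ρ =
      D.incl (D.redFst σ τ) ρ ≫ D.incl σ τ ▷ Z ≫ (α_ X Y Z).hom := by
  obtain ⟨h1, h2, h3⟩ := incl_incl_left hD hσ hτ hρ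
  have := comp_proj_incl_right hD (redFst_isHalf hD (redFst_isHalf hD hσ hτ) hρ) hτ hρ
    (h1.comp (intertwines_associator _ _ _)) (h2.comp (intertwines_associator _ _ _))
    (h3.comp (intertwines_associator _ _ _))
  simpa [redAssoc] using this

theorem Choices.redAssocInv_incl :
    D.redAssocInv σ τ ρ ≫ D.incl (D.redFst σ τ) ρ ≫ D.incl σ τ ▷ Z =
      D.incl σ (D.redFst τ ρ) ≫ X ◁ D.incl τ ρ ≫ (α_ X Y Z).inv := by
  obtain ⟨h1, h2, h3⟩ := incl_incl_right hD hσ hτ hρ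
  have := comp_proj_incl_left hD (redFst_isHalf hD hσ (redFst_isHalf hD hτ hρ)) hσ hτ
    (h1.comp (intertwines_associator _ _ _).isoInv) (h2.comp (intertwines_associator _ _ _).isoInv)
    (h3.comp (intertwines_associator _ _ _).isoInv)
  simpa [redAssocInv] using this

theorem Choices.incl_incl_cancel_right {W : C} {f g : W ⟶ D.red σ (D.redFst τ ρ)}
    (h : f ≫ D.incl σ (D.redFst τ ρ) ≫ X ◁ D.incl τ ρ =
      g ≫ D.incl σ (D.redFst τ ρ) ≫ X ◁ D.incl τ ρ) : f = g := by
  have h' := congrArg (· ≫ X ◁ D.proj τ ρ ≫ D.proj σ (D.redFst τ ρ)) h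
  have e : D.incl σ (D.redFst τ ρ) ≫ X ◁ D.incl τ ρ ≫ X ◁ D.proj τ ρ ≫ D.proj σ (D.redFst τ ρ) =
      𝟙 _ := by
    rw [← MonoidalCategory.whiskerLeft_comp_assoc, incl_proj hD hτ hρ,
      MonoidalCategory.whiskerLeft_id, Category.id_comp, incl_proj hD hσ (redFst_isHalf hD hτ hρ)]
  simpa only [Category.assoc, e, Category.comp_id] using h'

theorem Choices.incl_incl_cancel_left {W : C} {f g : W ⟶ D.red (D.redFst σ τ) ρ}
    (h : f ≫ D.incl (D.redFst σ τ) ρ ≫ D.incl σ τ ▷ Z =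
      g ≫ D.incl (D.redFst σ τ) ρ ≫ D.incl σ τ ▷ Z) : f = g := by
  have h' := congrArg (· ≫ D.proj σ τ ▷ Z ≫ D.proj (D.redFst σ τ) ρ) h
  have e : D.incl (D.redFst σ τ) ρ ≫ D.incl σ τ ▷ Z ≫ D.proj σ τ ▷ Z ≫ D.proj (D.redFst σ τ) ρ =
      𝟙 _ := by
    rw [← comp_whiskerRight_assoc, incl_proj hD hσ hτ,
      id_whiskerRight, Category.id_comp, incl_proj hD (redFst_isHalf hD hσ hτ) hρ]
  simpa only [Category.assoc, e, Category.comp_id] using h'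

theorem Choices.redAssoc_isIso : IsIso (D.redAssoc σ τ ρ) := by
  refine ⟨D.redAssocInv σ τ ρ, incl_incl_cancel_left hD hσ hτ hρ ?_,
    incl_incl_cancel_right hD hσ hτ hρ ?_⟩
  · rw [Category.assoc, redAssocInv_incl hD hσ hτ hρ]
    have := congrArg (· ≫ (α_ X Y Z).inv) (redAssoc_incl hD hσ hτ hρ)
    simpa using this
  · rw [Category.assoc, redAssoc_incl hD hσ hτ hρ]
    have := congrArg (· ≫ (α_ X Y Z).hom) (redAssocInv_incl hD hσ hτ hρ)
    simpa using this

theorem Choices.redAssoc_fst : Intertwines (D.redFst (D.redFst σ τ) ρ) (D.redFst σ (D.redFst τ ρ))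
    (D.redAssoc σ τ ρ) := by
  have h1 := (intertwines_braidFamily (D.proj τ ρ)).whiskerLeft σ
  rw [braidFamily_tensor] at h1
  have h := ((incl_incl_left hD hσ hτ hρ).1.comp (intertwines_associator _ _ _)).comp
    (h1.comp (proj_left hD hσ (redFst_isHalf hD hτ hρ)))
  simpa only [redAssoc, Category.assoc] using h

theorem Choices.redAssoc_snd {σ' : HalfFamily X} {τ' : HalfFamily Y} {ρ' : HalfFamily Z}
    (hσ' : Exchange revBraidFamily braidFamily σ σ')
    (hτ' : Exchange revBraidFamily braidFamily τ τ')
    (hρ' : Exchange revBraidFamily braidFamily ρ ρ') :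
    Intertwines (D.redSnd (D.redFst σ τ) (D.redSnd σ σ' τ τ') ρ ρ')
      (D.redSnd σ σ' (D.redFst τ ρ) (D.redSnd τ τ' ρ ρ')) (D.redAssoc σ τ ρ) :=
  (incl_redSnd hD (redFst_isHalf hD hσ hτ) hρ (red_exchange hD hσ hτ hσ') hρ').comp <|
    ((incl_redSnd hD hσ hτ hσ' hτ').whiskerRight ρ').comp <| (intertwines_associator _ _ _).comp <|
    ((proj_redSnd hD hτ hρ hτ' hρ').whiskerLeft σ').comp <|
    proj_redSnd hD hσ (redFst_isHalf hD hτ hρ) hσ' (red_exchange hD hτ hρ hτ')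

end Assoc

end Reduced
end
end EllipticCenter



namespace EllipticCenter

noncomputable section

attribute [local instance] Abelian.hasFiniteBiproducts

/-! ### Second half-braidings from generators -/

section Generation

set_option linter.unusedSectionVars false

variable {C : Type u} [Category.{v} C] [MonoidalCategory C] [RigidCategory C] [BraidedCategory C]

/-- An intertwiner out of a generated object also intertwines other families, as soon as this holds
on the generators. -/
theorem Generates.intertwines {e e' : ∀ A : C, HalfFamily A} (he : IsUniversal e) {Y Z W : C}
    {z z' : HalfFamily Z} {w w' : HalfFamily W} {y' : HalfFamily Y} {j : Y ⟶ Z} {F : Z ⟶ W}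
    (hg : Generates z j) (hF : Intertwines z w F) (hz : Exchange e e' z z')
    (hw : Exchange e e' w w') (hj : Intertwines y' z' j) (hjF : Intertwines y' w' (j ≫ F)) :
    Intertwines z' w' F := by
  intro A
  -- Both sides of the desired identity are themselves intertwiners from e_A ⊠ z to w ⊠ e'_A, so
  -- they may be compared on A ⊗ Y.
  refine hg.whiskerLeft he A (w ⊠ e' A) _ _ ((hF.whiskerLeft _).comp (hw A))
    ((hz A).comp (hF.whiskerRight _)) ?_
  rw [← Category.assoc, ← Category.assoc, ← MonoidalCategory.whiskerLeft_comp, hjF A, hj A,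
    comp_whiskerRight, Category.assoc]

end Generation

/-! ### Extension of morphisms to I(X) ⊗ N and M ⊗ I(X) -/

section Extension

set_option linter.unusedSectionVars false
set_option linter.unusedSimpArgs false

variable {k : Type w} [Field k] [IsAlgClosed k]
  {C : Type u} [Category.{v} C] [Abelian C] [Linear k C] [MonoidalCategory C]
  [MonoidalPreadditive C] [MonoidalLinear k C] [RigidCategory C] [BraidedCategory C]
  [RibbonCategory C] [FusionCategory k C] (D : Choices k C)

/-- The extension of `f : X ⊗ N ⟶ W` to `I(X) ⊗ N`. -/
def Choices.extR {X N W : C} (w : HalfFamily W) (f : X ⊗ N ⟶ W) : D.indObj X ⊗ N ⟶ W :=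
  (tensorRightHomEquiv _ N Nᘁ W).symm
    (D.ext (w ⊠ braidFamily Nᘁ) (tensorRightHomEquiv _ N Nᘁ W f))

/-- The extension of `f : M ⊗ X ⟶ W` to `M ⊗ I(X)`. -/
def Choices.extL {M X W : C} (w : HalfFamily W) (f : M ⊗ X ⟶ W) : M ⊗ D.indObj X ⟶ W :=
  (tensorLeftHomEquiv _ (HasLeftDual.leftDual M) M W).symm
    (D.ext (revBraidFamily (HasLeftDual.leftDual M) ⊠ w)
      (tensorLeftHomEquiv _ (HasLeftDual.leftDual M) M W f))

variable {X Y M N W : C} {w : HalfFamily W} (hw : IsHalf w)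

theorem Choices.generates_right (X N : C) :
    Generates (D.gamma X ⊠ braidFamily N) (D.iota X ▷ N) :=
  (D.gamma_generates X).whiskerRight isUniversal_braidFamily N

theorem Choices.generates_left (M X : C) :
    Generates (revBraidFamily M ⊠ D.gamma X) (M ◁ D.iota X) :=
  (D.gamma_generates X).whiskerLeft isUniversal_revBraidFamily M

include hw in
theorem Choices.extR_intertwines (f : X ⊗ N ⟶ W) :
    Intertwines (D.gamma X ⊠ braidFamily N) w (D.extR w f) :=
  (D.ext_intertwines (hw.tensor (braidFamily_isHalf _)) _).uncurryRight isUniversal_braidFamily N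

include hw in
theorem Choices.iota_extR (f : X ⊗ N ⟶ W) : D.iota X ▷ N ≫ D.extR w f = f := by
  apply (tensorRightHomEquiv _ N Nᘁ W).injective
  rw [tensorRightHomEquiv_comp, extR, Equiv.apply_symm_apply,
    D.iota_ext (hw.tensor (braidFamily_isHalf _))]

include hw in
theorem Choices.extL_intertwines (f : M ⊗ X ⟶ W) :
    Intertwines (revBraidFamily M ⊠ D.gamma X) w (D.extL w f) :=
  (D.ext_intertwines ((revBraidFamily_isHalf _).tensor hw) _).uncurryLeft
    isUniversal_revBraidFamily M

include hw in
theorem Choices.iota_extL (f : M ⊗ X ⟶ W) : M ◁ D.iota X ≫ D.extL w f = f := by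
  apply (tensorLeftHomEquiv _ (HasLeftDual.leftDual M) M W).injective
  rw [tensorLeftHomEquiv_comp, extL, Equiv.apply_symm_apply,
    D.iota_ext ((revBraidFamily_isHalf _).tensor hw)]

/-- Morphisms out of `I(X) ⊗ I(Y)` that intertwine both families are determined by their
restriction to `X ⊗ Y`. -/
theorem Choices.gamma_generates₂ {f g : D.indObj X ⊗ D.indObj Y ⟶ W}
    (hf : Intertwines (D.gamma X ⊠ braidFamily (D.indObj Y)) w f)
    (hf' : Intertwines (revBraidFamily (D.indObj X) ⊠ D.gamma Y) w f)
    (hg : Intertwines (D.gamma X ⊠ braidFamily (D.indObj Y)) w g)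
    (hg' : Intertwines (revBraidFamily (D.indObj X) ⊠ D.gamma Y) w g)
    (h : (D.iota X ⊗ₘ D.iota Y) ≫ f = (D.iota X ⊗ₘ D.iota Y) ≫ g) : f = g := by
  have hi := (intertwines_braidFamily (D.iota Y)).whiskerLeft (D.gamma X)
  refine D.generates_left _ _ w f g hf' hg' (D.generates_right _ _ w _ _ (hi.comp hf)
    (hi.comp hg) ?_)
  simpa [MonoidalCategory.tensorHom_def] using h

/-! ### The unit constraints -/

section Unit

variable {X : C} {σ σ' : HalfFamily X} (hσ : IsHalf σ)

/-- The left action of `I(𝟙)` on a half-braided object. -/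
def Choices.actL (c : k) (σ : HalfFamily X) : D.indObj (𝟙_ C) ⊗ X ⟶ X := D.extR σ (c • (λ_ X).hom)

/-- The right action of `I(𝟙)` on a half-braided object. -/
def Choices.actR (c : k) (σ : HalfFamily X) : X ⊗ D.indObj (𝟙_ C) ⟶ X := D.extL σ (c • (ρ_ X).hom)

include hσ

theorem Choices.iota_actL (c : k) : D.iota (𝟙_ C) ▷ X ≫ D.actL c σ = c • (λ_ X).hom :=
  D.iota_extR hσ _

theorem Choices.iota_actR (c : k) : X ◁ D.iota (𝟙_ C) ≫ D.actR c σ = c • (ρ_ X).hom :=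
  D.iota_extL hσ _

theorem Choices.actL_left (c : k) :
    Intertwines (D.gamma (𝟙_ C) ⊠ braidFamily X) σ (D.actL c σ) :=
  D.extR_intertwines hσ _

theorem Choices.actR_right (c : k) :
    Intertwines (revBraidFamily X ⊠ D.gamma (𝟙_ C)) σ (D.actR c σ) :=
  D.extL_intertwines hσ _

/-- By construction the action respects the left family; it respects the right one too, because on
the generator it is a multiple of the unitor. -/
theorem Choices.actL_right (c : k) :
    Intertwines (revBraidFamily (D.indObj (𝟙_ C)) ⊠ σ) σ (D.actL c σ) := by
  refine (D.generates_right _ _).intertwines isUniversal_braidFamily (D.actL_left hσ c)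
    ((exchange_braid_revBraid _).tensor (exchange_braid_right _ _)) hσ.exchange_braid
    ((intertwines_revBraidFamily (D.iota (𝟙_ C))).whiskerRight σ) ?_
  rw [D.iota_actL hσ, revBraidFamily_unit]
  exact (intertwines_leftUnitor σ).smul c

theorem Choices.actR_left (c : k) :
    Intertwines (σ ⊠ braidFamily (D.indObj (𝟙_ C))) σ (D.actR c σ) := by
  refine (D.generates_left _ _).intertwines isUniversal_revBraidFamily (D.actR_right hσ c)
    ((exchange_revBraid_right _ _).tensor (exchange_revBraid_braid _)) hσ.exchange_revBraid
    ((intertwines_braidFamily (D.iota (𝟙_ C))).whiskerLeft σ) ?_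
  rw [D.iota_actR hσ, braidFamily_unit]
  exact (intertwines_rightUnitor σ).smul c

/-- COMM for I(𝟙) and for X makes the generator argument available; on 𝟙 ⊗ X the claim is that the
unitor intertwines. -/
theorem Choices.actL_snd (c : k) (h : Exchange revBraidFamily braidFamily σ σ') :
    Intertwines (D.tilde unitFamily ⊠ σ') σ' (D.actL c σ) := by
  refine (D.generates_right _ _).intertwines isUniversal_revBraidFamily (D.actL_left hσ c)
    (exchange_left (comm_iff_exchange.1 (D.comm_gamma_tilde _))) h
    ((D.iota_intertwines_tilde unitFamily).whiskerRight σ') ?_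
  rw [D.iota_actL hσ]
  exact (intertwines_leftUnitor σ').smul c

theorem Choices.actR_snd (c : k) (h : Exchange revBraidFamily braidFamily σ σ') :
    Intertwines (σ' ⊠ D.tilde unitFamily) σ' (D.actR c σ) := by
  refine (D.generates_left _ _).intertwines isUniversal_revBraidFamily (D.actR_right hσ c)
    (exchange_right (comm_iff_exchange.1 (D.comm_gamma_tilde _))) h
    ((D.iota_intertwines_tilde unitFamily).whiskerLeft σ') ?_
  rw [D.iota_actR hσ]
  exact (intertwines_rightUnitor σ').smul c

omit hσ

/-- The left unit constraint of the reduced tensor product. -/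
def Choices.redLeft (c : k) (σ : HalfFamily X) : D.red (D.gamma (𝟙_ C)) σ ⟶ X :=
  D.incl (D.gamma (𝟙_ C)) σ ≫ D.actL c σ

/-- The right unit constraint of the reduced tensor product. -/
def Choices.redRight (c : k) (σ : HalfFamily X) : D.red σ (D.gamma (𝟙_ C)) ⟶ X :=
  D.incl σ (D.gamma (𝟙_ C)) ≫ D.actR c σ

variable (hD : D.globalDim ≠ 0) {D}

include hD hσ

theorem Choices.redLeft_fst (c : k) :
    Intertwines (D.redFst (D.gamma (𝟙_ C)) σ) σ (D.redLeft c σ) :=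
  (incl_left hD (D.gamma_isHalf _) hσ).comp (D.actL_left hσ c)

theorem Choices.redRight_fst (c : k) :
    Intertwines (D.redFst σ (D.gamma (𝟙_ C))) σ (D.redRight c σ) :=
  (incl_right hD hσ (D.gamma_isHalf _)).comp (D.actR_right hσ c)

theorem Choices.redLeft_snd (c : k) (h : Exchange revBraidFamily braidFamily σ σ') :
    Intertwines (D.redSnd (D.gamma (𝟙_ C)) (D.tilde unitFamily) σ σ') σ' (D.redLeft c σ) :=
  (incl_redSnd hD (D.gamma_isHalf _) hσ (comm_iff_exchange.1 (D.comm_gamma_tilde _)) h).comp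
    (D.actL_snd hσ c h)

theorem Choices.redRight_snd (c : k) (h : Exchange revBraidFamily braidFamily σ σ') :
    Intertwines (D.redSnd σ σ' (D.gamma (𝟙_ C)) (D.tilde unitFamily)) σ' (D.redRight c σ) :=
  (incl_redSnd hD hσ (D.gamma_isHalf _) h (comm_iff_exchange.1 (D.comm_gamma_tilde _))).comp
    (D.actR_snd hσ c h)

/-- The inverse inserts ι, divides by c and projects. One composite is checked on the generator; in
the other Q is absorbed, since the action respects both families. -/
theorem Choices.redLeft_isIso {c : k} (hc : c ≠ 0) : IsIso (D.redLeft c σ) := by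
  have hΓ := D.gamma_isHalf (𝟙_ C)
  let g : X ⟶ D.red (D.gamma (𝟙_ C)) σ :=
    c⁻¹ • ((λ_ X).inv ≫ D.iota (𝟙_ C) ▷ X ≫ D.proj (D.gamma (𝟙_ C)) σ)
  have hg : Intertwines σ (D.redFst (D.gamma (𝟙_ C)) σ) g := by
    refine .smul ((intertwines_leftUnitor σ).isoInv.comp (.comp ?_ (proj_right hD hΓ hσ))) _
    rw [← revBraidFamily_unit]
    exact (intertwines_revBraidFamily _).whiskerRight σ
  have h1 : D.actL c σ ≫ g = D.proj (D.gamma (𝟙_ C)) σ := by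
    refine D.generates_right _ _ _ _ _ ((D.actL_left hσ c).comp hg) (proj_left hD hΓ hσ) ?_
    rw [← Category.assoc, D.iota_actL hσ]
    simp [g, hc, smul_smul]
  refine ⟨g, ?_, ?_⟩
  · rw [redLeft, Category.assoc, h1, incl_proj hD hΓ hσ]
  · simp only [g, redLeft, Linear.smul_comp, Category.assoc]
    rw [← Category.assoc (D.proj _ _), proj_incl, Q_comp hD hσ (D.actL_left hσ c)
      (D.actL_right hσ c), D.iota_actL hσ]
    simp [hc, smul_smul]

theorem Choices.redRight_isIso {c : k} (hc : c ≠ 0) : IsIso (D.redRight c σ) := by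
  have hΓ := D.gamma_isHalf (𝟙_ C)
  let g : X ⟶ D.red σ (D.gamma (𝟙_ C)) :=
    c⁻¹ • ((ρ_ X).inv ≫ X ◁ D.iota (𝟙_ C) ≫ D.proj σ (D.gamma (𝟙_ C)))
  have hg : Intertwines σ (D.redFst σ (D.gamma (𝟙_ C))) g := by
    refine .smul ((intertwines_rightUnitor σ).isoInv.comp (.comp ?_ (proj_left hD hσ hΓ))) _
    rw [← braidFamily_unit]
    exact (intertwines_braidFamily _).whiskerLeft σ
  have h1 : D.actR c σ ≫ g = D.proj σ (D.gamma (𝟙_ C)) := by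
    refine D.generates_left _ _ _ _ _ ((D.actR_right hσ c).comp hg) (proj_right hD hσ hΓ) ?_
    rw [← Category.assoc, D.iota_actR hσ]
    simp [g, hc, smul_smul]
  refine ⟨g, ?_, ?_⟩
  · rw [redRight, Category.assoc, h1, incl_proj hD hσ hΓ]
  · simp only [g, redRight, Linear.smul_comp, Category.assoc]
    rw [← Category.assoc (D.proj _ _), proj_incl, Q_comp hD hσ (D.actR_left hσ c)
      (D.actR_right hσ c), D.iota_actR hσ]
    simp [hc, smul_smul]

theorem Choices.redLeft_naturality {Y : C} {τ : HalfFamily Y} (hτ : IsHalf τ) (c : k) {f : X ⟶ Y}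
    (hf : Intertwines σ τ f) :
    D.redMap (D.gamma (𝟙_ C)) σ (D.gamma (𝟙_ C)) τ (𝟙 _) f ≫ D.redLeft c τ =
      D.redLeft c σ ≫ f := by
  have hΓ := D.gamma_isHalf (𝟙_ C)
  rw [redLeft, ← Category.assoc, redMap_incl hD hΓ hσ (.id _) hf, redLeft, Category.assoc,
    Category.assoc]
  congr 1
  refine D.generates_right _ _ _ _ _ (((Intertwines.id _).tensorHom (intertwines_braidFamily f)).comp
    (D.actL_left hτ c)) ((D.actL_left hσ c).comp hf) ?_
  rw [MonoidalCategory.id_tensorHom, ← whisker_exchange_assoc, ← Category.assoc (D.iota _ ▷ _),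
    D.iota_actL hσ, D.iota_actL hτ]
  simp

theorem Choices.redRight_naturality {Y : C} {τ : HalfFamily Y} (hτ : IsHalf τ) (c : k) {f : X ⟶ Y}
    (hf : Intertwines σ τ f) :
    D.redMap σ (D.gamma (𝟙_ C)) τ (D.gamma (𝟙_ C)) f (𝟙 _) ≫ D.redRight c τ =
      D.redRight c σ ≫ f := by
  have hΓ := D.gamma_isHalf (𝟙_ C)
  rw [redRight, ← Category.assoc, redMap_incl hD hσ hΓ hf (.id _), redRight, Category.assoc,
    Category.assoc]
  congr 1
  refine D.generates_left _ _ _ _ _ (((intertwines_revBraidFamily f).tensorHom (Intertwines.id _)).comp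
    (D.actR_right hτ c)) ((D.actR_right hσ c).comp hf) ?_
  rw [MonoidalCategory.tensorHom_id, whisker_exchange_assoc, ← Category.assoc (_ ◁ D.iota _),
    D.iota_actR hσ, D.iota_actR hτ]
  simp

end Unit

/-! ### Coherence of the reduced tensor product -/

section Coherence

variable {X Y Z V : C} {σ : HalfFamily X} {τ : HalfFamily Y} {ρ : HalfFamily Z} {υ : HalfFamily V}
  (hD : D.globalDim ≠ 0) (hσ : IsHalf σ) (hτ : IsHalf τ) (hρ : IsHalf ρ) (hυ : IsHalf υ) {D}

include hD hσ hτ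

theorem Choices.redMap_id : D.redMap σ τ σ τ (𝟙 X) (𝟙 Y) = 𝟙 _ := by
  rw [redMap, MonoidalCategory.id_tensorHom_id, Category.id_comp, incl_proj hD hσ hτ]

theorem Choices.redMap_comp {X₁ X₂ Y₁ Y₂ : C} {σ₁ : HalfFamily X₁} {σ₂ : HalfFamily X₂}
    {τ₁ : HalfFamily Y₁} {τ₂ : HalfFamily Y₂} {f : X ⟶ X₁} {f' : X₁ ⟶ X₂} {g : Y ⟶ Y₁}
    {g' : Y₁ ⟶ Y₂} (hf : Intertwines σ σ₁ f) (hg : Intertwines τ τ₁ g) :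
    D.redMap σ τ σ₁ τ₁ f g ≫ D.redMap σ₁ τ₁ σ₂ τ₂ f' g' =
      D.redMap σ τ σ₂ τ₂ (f ≫ f') (g ≫ g') := by
  rw [redMap.eq_1 D σ₁, ← Category.assoc, redMap_incl hD hσ hτ hf hg, redMap,
    ← MonoidalCategory.tensorHom_comp_tensorHom]
  simp only [Category.assoc]

theorem Choices.red_triangle (c : k) :
    D.redAssoc σ (D.gamma (𝟙_ C)) τ ≫
      D.redMap σ (D.redFst (D.gamma (𝟙_ C)) τ) σ τ (𝟙 X) (D.redLeft c τ) =
    D.redMap (D.redFst σ (D.gamma (𝟙_ C))) τ σ τ (D.redRight c σ) (𝟙 Y) := by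
  have hΓ := D.gamma_isHalf (𝟙_ C)
  -- After projection to the reduced product, I(𝟙) acts equally on X from the right and on Y from
  -- the left: both are intertwiners and agree on the generator 𝟙 in the middle, where each is c
  -- times a unitor.
  have key : (α_ X (D.indObj (𝟙_ C)) Y).hom ≫ X ◁ D.actL c τ ≫ D.proj σ τ =
      D.actR c σ ▷ Y ≫ D.proj σ τ := by
    refine (D.generates_left _ _).whiskerRight isUniversal_braidFamily Y (D.redFst σ τ) _ _
      ((intertwines_associator _ _ _).comp (((D.actL_left hτ c).whiskerLeft _).comp
        (proj_right hD hσ hτ)))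
      (((D.actR_right hσ c).whiskerRight _).comp (proj_left hD hσ hτ)) ?_
    rw [← comp_whiskerRight_assoc, D.iota_actR hσ]
    calc
      _ = (α_ X (𝟙_ C) Y).hom ≫ X ◁ (D.iota (𝟙_ C) ▷ Y ≫ D.actL c τ) ≫ D.proj σ τ := by monoidal
      _ = _ := by rw [D.iota_actL hτ]; simp
  calc
    _ = (D.redAssoc σ (D.gamma (𝟙_ C)) τ ≫ D.incl σ (D.redFst (D.gamma (𝟙_ C)) τ) ≫
        X ◁ D.incl (D.gamma (𝟙_ C)) τ) ≫ X ◁ D.actL c τ ≫ D.proj σ τ := by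
      simp [redMap, redLeft]
    _ = _ := by
      rw [redAssoc_incl hD hσ hΓ hτ]
      simp [redMap, redRight, key]

include hρ

theorem Choices.redAssoc_naturality {X' Y' Z' : C} {σ' : HalfFamily X'} {τ' : HalfFamily Y'}
    {ρ' : HalfFamily Z'} (hσ' : IsHalf σ') (hτ' : IsHalf τ') (hρ' : IsHalf ρ') {f : X ⟶ X'}
    {g : Y ⟶ Y'} {h : Z ⟶ Z'} (hf : Intertwines σ σ' f) (hg : Intertwines τ τ' g)
    (hh : Intertwines ρ ρ' h) :
    D.redMap (D.redFst σ τ) ρ (D.redFst σ' τ') ρ' (D.redMap σ τ σ' τ' f g) h ≫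
        D.redAssoc σ' τ' ρ' =
      D.redAssoc σ τ ρ ≫
        D.redMap σ (D.redFst τ ρ) σ' (D.redFst τ' ρ') f (D.redMap τ ρ τ' ρ' g h) := by
  refine incl_incl_cancel_right hD hσ' hτ' hρ' ?_
  rw [Category.assoc, redAssoc_incl hD hσ' hτ' hρ', Category.assoc,
    ← Category.assoc (D.redMap σ _ _ _ _ _),
    redMap_incl hD hσ (redFst_isHalf hD hτ hρ) hf (redMap_fst hD hτ hρ hτ' hρ' hg),
    ← Category.assoc, redMap_incl hD (redFst_isHalf hD hσ hτ) hρ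
      (redMap_fst hD hσ hτ hσ' hτ' hf) hh]
  have h1 := redMap_incl hD hσ hτ hf hg
  have h2 := redMap_incl hD hτ hρ hg hh
  calc
    _ = D.incl (D.redFst σ τ) ρ ≫ ((D.redMap σ τ σ' τ' f g ≫ D.incl σ' τ') ⊗ₘ h) ≫
        (α_ X' Y' Z').hom := by
      simp [MonoidalCategory.tensorHom_def', Category.assoc]
    _ = (D.incl (D.redFst σ τ) ρ ≫ D.incl σ τ ▷ Z ≫ (α_ X Y Z).hom) ≫ (f ⊗ₘ (g ⊗ₘ h)) := by
      rw [h1]; simp [MonoidalCategory.tensorHom_def]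
    _ = D.redAssoc σ τ ρ ≫ D.incl σ (D.redFst τ ρ) ≫ (f ⊗ₘ (D.incl τ ρ ≫ (g ⊗ₘ h))) := by
      rw [← redAssoc_incl hD hσ hτ hρ]; simp [MonoidalCategory.tensorHom_def', Category.assoc]
    _ = _ := by rw [← h2]; simp [MonoidalCategory.tensorHom_def, Category.assoc]

include hυ

/-- After inclusion into the full fourfold product every reduced associator becomes the one of C,
whose pentagon finishes the proof. -/
theorem Choices.red_pentagon :
    D.redMap (D.redFst (D.redFst σ τ) ρ) υ (D.redFst σ (D.redFst τ ρ)) υ (D.redAssoc σ τ ρ) (𝟙 V) ≫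
      D.redAssoc σ (D.redFst τ ρ) υ ≫
      D.redMap σ (D.redFst (D.redFst τ ρ) υ) σ (D.redFst τ (D.redFst ρ υ)) (𝟙 X)
        (D.redAssoc τ ρ υ) =
    D.redAssoc (D.redFst σ τ) ρ υ ≫ D.redAssoc σ τ (D.redFst ρ υ) := by
  have hστ := redFst_isHalf hD hσ hτ
  have hτρ := redFst_isHalf hD hτ hρ
  have hρυ := redFst_isHalf hD hρ hυ
  refine incl_incl_cancel_right hD hσ hτ hρυ ?_
  -- The innermost inclusion is split by its projection, so it may be composed with and cancelled.
  have hm : ∀ {W : C} {f g : W ⟶ X ⊗ Y ⊗ D.red ρ υ},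
      f ≫ X ◁ Y ◁ D.incl ρ υ = g ≫ X ◁ Y ◁ D.incl ρ υ → f = g := fun {W f g} h => by
    have := congrArg (· ≫ X ◁ Y ◁ D.proj ρ υ) h
    simpa [← MonoidalCategory.whiskerLeft_comp, incl_proj hD hρ hυ] using this
  refine hm ?_
  have a1 := redAssoc_incl hD hτ hρ hυ
  have a2 := redAssoc_incl hD hσ hτρ hυ
  have a3 := redAssoc_incl hD hσ hτ hρ
  have a4 := redAssoc_incl hD hσ hτ hρυ
  have a5 := redAssoc_incl hD hστ hρ hυ
  have m1 := redMap_incl hD hσ (redFst_isHalf hD hτρ hυ) (.id σ) (redAssoc_fst hD hτ hρ hυ)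
  have m2 := redMap_incl hD (redFst_isHalf hD hστ hρ) hυ (redAssoc_fst hD hσ hτ hρ) (.id υ)
  calc
    _ = D.redMap (D.redFst (D.redFst σ τ) ρ) υ (D.redFst σ (D.redFst τ ρ)) υ (D.redAssoc σ τ ρ)
          (𝟙 V) ≫ D.redAssoc σ (D.redFst τ ρ) υ ≫
        (D.redMap σ (D.redFst (D.redFst τ ρ) υ) σ (D.redFst τ (D.redFst ρ υ)) (𝟙 X)
          (D.redAssoc τ ρ υ) ≫ D.incl σ (D.redFst τ (D.redFst ρ υ))) ≫
        X ◁ (D.incl τ (D.redFst ρ υ) ≫ Y ◁ D.incl ρ υ) := by simp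
    _ = D.redMap (D.redFst (D.redFst σ τ) ρ) υ (D.redFst σ (D.redFst τ ρ)) υ (D.redAssoc σ τ ρ)
          (𝟙 V) ≫ (D.redAssoc σ (D.redFst τ ρ) υ ≫ D.incl σ (D.redFst (D.redFst τ ρ) υ)) ≫
        X ◁ (D.redAssoc τ ρ υ ≫ D.incl τ (D.redFst ρ υ) ≫ Y ◁ D.incl ρ υ) := by
      rw [m1]; simp
    _ = D.redMap (D.redFst (D.redFst σ τ) ρ) υ (D.redFst σ (D.redFst τ ρ)) υ (D.redAssoc σ τ ρ)
          (𝟙 V) ≫ (D.redAssoc σ (D.redFst τ ρ) υ ≫ D.incl σ (D.redFst (D.redFst τ ρ) υ) ≫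
          X ◁ D.incl (D.redFst τ ρ) υ) ≫ X ◁ (D.incl τ ρ ▷ V ≫ (α_ Y Z V).hom) := by
      rw [a1]; simp
    _ = (D.redMap (D.redFst (D.redFst σ τ) ρ) υ (D.redFst σ (D.redFst τ ρ)) υ (D.redAssoc σ τ ρ)
          (𝟙 V) ≫ D.incl (D.redFst σ (D.redFst τ ρ)) υ) ≫ D.incl σ (D.redFst τ ρ) ▷ V ≫
        (α_ X (D.red τ ρ) V).hom ≫ X ◁ (D.incl τ ρ ▷ V ≫ (α_ Y Z V).hom) := by
      rw [a2]; simp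
    _ = D.incl (D.redFst (D.redFst σ τ) ρ) υ ≫ (D.redAssoc σ τ ρ ≫ D.incl σ (D.redFst τ ρ) ≫
        X ◁ D.incl τ ρ) ▷ V ≫ (α_ X (Y ⊗ Z) V).hom ≫ X ◁ (α_ Y Z V).hom := by
      rw [m2]; simp
    _ = D.incl (D.redFst (D.redFst σ τ) ρ) υ ≫ D.incl (D.redFst σ τ) ρ ▷ V ≫
        D.incl σ τ ▷ Z ▷ V ≫ (α_ (X ⊗ Y) Z V).hom ≫ (α_ X Y (Z ⊗ V)).hom := by
      rw [a3]; simp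
    _ = (D.redAssoc (D.redFst σ τ) ρ υ ≫ D.incl (D.redFst σ τ) (D.redFst ρ υ) ≫
        D.red σ τ ◁ D.incl ρ υ) ≫ D.incl σ τ ▷ (Z ⊗ V) ≫ (α_ X Y (Z ⊗ V)).hom := by
      rw [a5]; simp
    _ = D.redAssoc (D.redFst σ τ) ρ υ ≫ (D.incl (D.redFst σ τ) (D.redFst ρ υ) ≫
        D.incl σ τ ▷ D.red ρ υ ≫ (α_ X Y (D.red ρ υ)).hom) ≫ X ◁ Y ◁ D.incl ρ υ := by
      simp only [Category.assoc]
      rw [whisker_exchange_assoc]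
      simp
    _ = _ := by rw [← a4]; simp

end Coherence

end Extension
end
end EllipticCenter



namespace EllipticCenter

noncomputable section

attribute [local instance] Abelian.hasFiniteBiproducts

/-! ### The structure morphism of the induction functor -/

section Multiplication

set_option linter.unusedSectionVars false
set_option linter.unusedSimpArgs false

variable {k : Type w} [Field k] [IsAlgClosed k]
  {C : Type u} [Category.{v} C] [Abelian C] [Linear k C] [MonoidalCategory C]
  [MonoidalPreadditive C] [MonoidalLinear k C] [RigidCategory C] [BraidedCategory C]
  [RibbonCategory C] [FusionCategory k C] (D : Choices k C)

/-- The extension of `c ι` to `I(X) ⊗ Y ⟶ I(X ⊗ Y)`. -/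
def Choices.halfMul (c : k) (X Y : C) : D.indObj X ⊗ Y ⟶ D.indObj (X ⊗ Y) :=
  D.extR (D.gamma (X ⊗ Y)) (c • D.iota (X ⊗ Y))

/-- The extension of `c ι` to `I(X) ⊗ I(Y) ⟶ I(X ⊗ Y)`. -/
def Choices.mul (c : k) (X Y : C) : D.indObj X ⊗ D.indObj Y ⟶ D.indObj (X ⊗ Y) :=
  D.extL (D.gamma (X ⊗ Y)) (D.halfMul c X Y)

variable (c : k) {X Y Z : C}

theorem Choices.iota_halfMul : D.iota X ▷ Y ≫ D.halfMul c X Y = c • D.iota (X ⊗ Y) :=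
  D.iota_extR (D.gamma_isHalf _) _

theorem Choices.halfMul_left :
    Intertwines (D.gamma X ⊠ braidFamily Y) (D.gamma (X ⊗ Y)) (D.halfMul c X Y) :=
  D.extR_intertwines (D.gamma_isHalf _) _

theorem Choices.iota_mul : D.indObj X ◁ D.iota Y ≫ D.mul c X Y = D.halfMul c X Y :=
  D.iota_extL (D.gamma_isHalf _) _

theorem Choices.iota_iota_mul :
    (D.iota X ⊗ₘ D.iota Y) ≫ D.mul c X Y = c • D.iota (X ⊗ Y) := by
  rw [MonoidalCategory.tensorHom_def, Category.assoc, D.iota_mul, D.iota_halfMul]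

theorem Choices.mul_right :
    Intertwines (revBraidFamily (D.indObj X) ⊠ D.gamma Y) (D.gamma (X ⊗ Y)) (D.mul c X Y) :=
  D.extL_intertwines (D.gamma_isHalf _) _

/-- As an extension in the second variable the multiplication respects the right family; the left
one is checked on the generator, where it is the property of `halfMul`. -/
theorem Choices.mul_left :
    Intertwines (D.gamma X ⊠ braidFamily (D.indObj Y)) (D.gamma (X ⊗ Y)) (D.mul c X Y) := by
  refine (D.generates_left _ _).intertwines isUniversal_revBraidFamily (D.mul_right c)
    ((exchange_revBraid_right _ _).tensor (exchange_revBraid_braid _))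
    (D.gamma_isHalf _).exchange_revBraid
    ((intertwines_braidFamily (D.iota Y)).whiskerLeft (D.gamma X)) ?_
  rw [D.iota_mul]
  exact D.halfMul_left c

theorem Choices.exchange_gamma_tilde (σ : HalfFamily X) :
    Exchange revBraidFamily braidFamily (D.gamma X) (D.tilde σ) :=
  comm_iff_exchange.1 (D.comm_gamma_tilde σ)

theorem Choices.halfMul_snd (σ : HalfFamily X) (τ : HalfFamily Y) :
    Intertwines (D.tilde σ ⊠ τ) (D.tilde (σ ⊠ τ)) (D.halfMul c X Y) := by
  refine (D.generates_right _ _).intertwines isUniversal_revBraidFamily (D.halfMul_left c)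
    (exchange_left (D.exchange_gamma_tilde _)) (D.exchange_gamma_tilde _)
    ((D.iota_intertwines_tilde σ).whiskerRight τ) ?_
  rw [D.iota_halfMul]
  exact (D.iota_intertwines_tilde _).smul c

theorem Choices.mul_snd (σ : HalfFamily X) (τ : HalfFamily Y) :
    Intertwines (D.tilde σ ⊠ D.tilde τ) (D.tilde (σ ⊠ τ)) (D.mul c X Y) := by
  refine (D.generates_left _ _).intertwines isUniversal_revBraidFamily (D.mul_right c)
    (exchange_right (D.exchange_gamma_tilde _)) (D.exchange_gamma_tilde _)
    ((D.iota_intertwines_tilde τ).whiskerLeft (D.tilde σ)) ?_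
  rw [D.iota_mul]
  exact D.halfMul_snd c σ τ

theorem Choices.mul_naturality {X' Y' : C} (f : X ⟶ X') (g : Y ⟶ Y') :
    (D.indMap f ⊗ₘ D.indMap g) ≫ D.mul c X' Y' = D.mul c X Y ≫ D.indMap (f ⊗ₘ g) := by
  refine D.gamma_generates₂
    (((D.indMap_gamma f).tensorHom (intertwines_braidFamily _)).comp (D.mul_left c))
    (((intertwines_revBraidFamily _).tensorHom (D.indMap_gamma g)).comp (D.mul_right c))
    ((D.mul_left c).comp (D.indMap_gamma _)) ((D.mul_right c).comp (D.indMap_gamma _)) ?_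
  rw [← Category.assoc, MonoidalCategory.tensorHom_comp_tensorHom, D.iota_indMap, D.iota_indMap,
    ← MonoidalCategory.tensorHom_comp_tensorHom, Category.assoc, D.iota_iota_mul, ← Category.assoc,
    D.iota_iota_mul, Linear.comp_smul, Linear.smul_comp, D.iota_indMap]

/-- Both sides are successively restricted to the generators of I(Z), I(Y) and I(X), each
restriction leaving intertwiners for the next. On X ⊗ Y ⊗ Z both equal c² times the associator
followed by ι. -/
theorem Choices.mul_associativity :
    D.mul c X Y ▷ D.indObj Z ≫ D.mul c (X ⊗ Y) Z ≫ D.indMap (α_ X Y Z).hom =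
      (α_ _ _ _).hom ≫ D.indObj X ◁ D.mul c Y Z ≫ D.mul c X (Y ⊗ Z) := by
  have hr : Intertwines (revBraidFamily (D.indObj X ⊗ D.indObj Y) ⊠ D.gamma Z)
      (revBraidFamily (D.indObj X) ⊠ revBraidFamily (D.indObj Y) ⊠ D.gamma Z) (α_ _ _ _).hom := by
    rw [revBraidFamily_tensor]
    exact intertwines_associator _ _ _
  refine D.generates_left _ _ _ _ _
    (((intertwines_revBraidFamily _).whiskerRight _).comp ((D.mul_right c).comp (D.indMap_gamma _)))
    (hr.comp (((D.mul_right c).whiskerLeft _).comp (D.mul_right c))) ?_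
  have e1 : (D.indObj X ⊗ D.indObj Y) ◁ D.iota Z ≫ D.mul c X Y ▷ D.indObj Z ≫
      D.mul c (X ⊗ Y) Z ≫ D.indMap (α_ X Y Z).hom =
      D.mul c X Y ▷ Z ≫ D.halfMul c (X ⊗ Y) Z ≫ D.indMap (α_ X Y Z).hom := by
    rw [whisker_exchange_assoc, ← D.iota_mul c (X := X ⊗ Y), Category.assoc]
  have e2 : (D.indObj X ⊗ D.indObj Y) ◁ D.iota Z ≫ (α_ _ _ _).hom ≫
      D.indObj X ◁ D.mul c Y Z ≫ D.mul c X (Y ⊗ Z) =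
      (α_ _ _ _).hom ≫ D.indObj X ◁ D.halfMul c Y Z ≫ D.mul c X (Y ⊗ Z) := by
    rw [← D.iota_mul c (X := Y)]
    simp
  rw [e1, e2]
  refine (D.generates_left (D.indObj X) Y).whiskerRight isUniversal_braidFamily Z _ _ _
    (((D.mul_right c).whiskerRight _).comp ((D.halfMul_left c).comp (D.indMap_gamma _)))
    ((intertwines_associator _ _ _).comp (((D.halfMul_left c).whiskerLeft _).comp
      (D.mul_right c))) ?_
  have e3 : (D.indObj X ◁ D.iota Y) ▷ Z ≫ D.mul c X Y ▷ Z ≫ D.halfMul c (X ⊗ Y) Z ≫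
      D.indMap (α_ X Y Z).hom =
      D.halfMul c X Y ▷ Z ≫ D.halfMul c (X ⊗ Y) Z ≫ D.indMap (α_ X Y Z).hom := by
    rw [← comp_whiskerRight_assoc, D.iota_mul]
  have e4 : (D.indObj X ◁ D.iota Y) ▷ Z ≫ (α_ _ _ _).hom ≫
      D.indObj X ◁ D.halfMul c Y Z ≫ D.mul c X (Y ⊗ Z) =
      c • ((α_ _ _ _).hom ≫ D.halfMul c X (Y ⊗ Z)) := by
    have h := D.iota_halfMul c (X := Y) (Y := Z)
    calc
      _ = (α_ _ _ _).hom ≫ D.indObj X ◁ (D.iota Y ▷ Z ≫ D.halfMul c Y Z) ≫ D.mul c X (Y ⊗ Z) := by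
        monoidal
      _ = _ := by
        rw [h, ← D.iota_mul]
        simp
  rw [e3, e4]
  have hl : Intertwines ((D.gamma X ⊠ braidFamily Y) ⊠ braidFamily Z)
      (D.gamma X ⊠ braidFamily (Y ⊗ Z)) (α_ _ _ _).hom := by
    rw [braidFamily_tensor]
    exact intertwines_associator _ _ _
  refine (D.generates_right X Y).whiskerRight isUniversal_braidFamily Z _ _ _
    (((D.halfMul_left c).whiskerRight _).comp ((D.halfMul_left c).comp (D.indMap_gamma _)))
    ((hl.comp (D.halfMul_left c)).smul c) ?_
  have e5 : (D.iota X ▷ Y) ▷ Z ≫ (α_ _ _ _).hom ≫ D.halfMul c X (Y ⊗ Z) =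
      c • ((α_ X Y Z).hom ≫ D.iota (X ⊗ Y ⊗ Z)) := by
    have h := D.iota_halfMul c (X := X) (Y := Y ⊗ Z)
    calc
      _ = (α_ _ _ _).hom ≫ (D.iota X ▷ (Y ⊗ Z) ≫ D.halfMul c X (Y ⊗ Z)) := by monoidal
      _ = _ := by rw [h]; simp
  rw [Linear.comp_smul, e5, ← comp_whiskerRight_assoc, D.iota_halfMul,
    MonoidalLinear.smul_whiskerRight, Linear.smul_comp, ← Category.assoc (D.iota _ ▷ _),
    D.iota_halfMul, Linear.smul_comp, D.iota_indMap]

/-- On 𝟙 ⊗ X both sides are c times the unitor followed by ι. The common normalization of unit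
constraint and multiplication is what permits the identity as unit isomorphism. -/
theorem Choices.mul_leftUnitality :
    D.actL c (D.gamma X) = D.mul c (𝟙_ C) X ≫ D.indMap (λ_ X).hom := by
  refine D.gamma_generates₂ (D.actL_left (D.gamma_isHalf X) c) (D.actL_right (D.gamma_isHalf X) c)
    ((D.mul_left c).comp (D.indMap_gamma _)) ((D.mul_right c).comp (D.indMap_gamma _)) ?_
  rw [← Category.assoc, D.iota_iota_mul, MonoidalCategory.tensorHom_def', Category.assoc,
    D.iota_actL (D.gamma_isHalf X), Linear.smul_comp, D.iota_indMap]
  simp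

theorem Choices.mul_rightUnitality :
    D.actR c (D.gamma X) = D.mul c X (𝟙_ C) ≫ D.indMap (ρ_ X).hom := by
  refine D.gamma_generates₂ (D.actR_left (D.gamma_isHalf X) c) (D.actR_right (D.gamma_isHalf X) c)
    ((D.mul_left c).comp (D.indMap_gamma _)) ((D.mul_right c).comp (D.indMap_gamma _)) ?_
  rw [← Category.assoc, D.iota_iota_mul, MonoidalCategory.tensorHom_def, Category.assoc,
    D.iota_actR (D.gamma_isHalf X), Linear.smul_comp, D.iota_indMap]
  simp

variable (X Y) in
/-- The restriction of the multiplication to the reduced tensor product. -/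
def Choices.redMul : D.red (D.gamma X) (D.gamma Y) ⟶ D.indObj (X ⊗ Y) :=
  D.incl (D.gamma X) (D.gamma Y) ≫ D.mul c X Y

section

variable (hD : D.globalDim ≠ 0) {D}

include hD

theorem Choices.redMul_fst : Intertwines (D.redFst (D.gamma X) (D.gamma Y)) (D.gamma (X ⊗ Y))
    (D.redMul c X Y) :=
  (incl_left hD (D.gamma_isHalf _) (D.gamma_isHalf _)).comp (D.mul_left c)

theorem Choices.redMul_snd (σ : HalfFamily X) (τ : HalfFamily Y) :
    Intertwines (D.redSnd (D.gamma X) (D.tilde σ) (D.gamma Y) (D.tilde τ)) (D.tilde (σ ⊠ τ))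
      (D.redMul c X Y) :=
  (incl_redSnd hD (D.gamma_isHalf _) (D.gamma_isHalf _) (D.exchange_gamma_tilde _)
    (D.exchange_gamma_tilde _)).comp (D.mul_snd c σ τ)

/-- The reduced product of I(X) and I(Y) is again free on X ⊗ Y. The inverse is the extension of c⁻¹
times ι ⊗ ι followed by the projection; both composites are compared on generators, Q being absorbed
by the multiplication. -/
theorem Choices.redMul_isIso {c : k} (hc : c ≠ 0) : IsIso (D.redMul c X Y) := by
  have hX := D.gamma_isHalf X
  have hY := D.gamma_isHalf Y
  have hred := redFst_isHalf hD hX hY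
  let g : D.indObj (X ⊗ Y) ⟶ D.red (D.gamma X) (D.gamma Y) :=
    D.ext (D.redFst (D.gamma X) (D.gamma Y))
      (c⁻¹ • ((D.iota X ⊗ₘ D.iota Y) ≫ D.proj (D.gamma X) (D.gamma Y)))
  have hg : Intertwines (D.gamma (X ⊗ Y)) (D.redFst (D.gamma X) (D.gamma Y)) g :=
    D.ext_intertwines hred _
  have hg' : D.iota (X ⊗ Y) ≫ g =
      c⁻¹ • ((D.iota X ⊗ₘ D.iota Y) ≫ D.proj (D.gamma X) (D.gamma Y)) := D.iota_ext hred _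
  have h1 : D.mul c X Y ≫ g = D.proj (D.gamma X) (D.gamma Y) := by
    refine D.gamma_generates₂ ((D.mul_left c).comp hg) ((D.mul_right c).comp hg)
      (proj_left hD hX hY) (proj_right hD hX hY) ?_
    rw [← Category.assoc, D.iota_iota_mul, Linear.smul_comp, hg', smul_smul, mul_inv_cancel₀ hc,
      one_smul]
  refine ⟨g, ?_, ?_⟩
  · rw [redMul, Category.assoc, h1, incl_proj hD hX hY]
  · refine D.gamma_generates _ _ _ _ (hg.comp (redMul_fst c hD)) (.id _) ?_
    rw [← Category.assoc, hg', redMul, Linear.smul_comp, Category.assoc,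
      ← Category.assoc (D.proj _ _), proj_incl, Q_comp hD (D.gamma_isHalf _) (D.mul_left c)
        (D.mul_right c), D.iota_iota_mul, smul_smul, inv_mul_cancel₀ hc, one_smul,
      Category.comp_id]

end

/-! ### Comparison with the explicit formulas -/

/-- An intertwiner is computed on a summand from its restriction to the generator. Since Sᵢ* stands
between X and N, it must first be braided past N before the strand closes. -/
theorem Choices.inj_whiskerRight_comp {X N W : C} {w : HalfFamily W} {F : D.indObj X ⊗ N ⟶ W}
    (hF : Intertwines (D.gamma X ⊠ braidFamily N) w F) (i : D.I) :
    D.inj X i ▷ N ≫ F = D.sqrtDim i • (𝟙 _ ⊗≫ (D.S i ⊗ X) ◁ (β_ ((D.S i)ᘁ : C) N).hom ⊗≫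
      closeRight (D.S i ◁ (D.iota X ▷ N ≫ F) ≫ w (D.S i))) := by
  rw [D.inj_eq, MonoidalLinear.smul_whiskerRight, Linear.smul_comp, closeRight_whiskerRight]
  congr 1
  have h : D.S i ◁ (D.iota X ▷ N ≫ F) ≫ w (D.S i) =
      ((α_ (D.S i) X N).inv ≫ D.kappa X (D.S i) ▷ N ≫ (α_ _ (D.S i) N).hom ≫
        D.indObj X ◁ (β_ (D.S i) N).hom ≫ (α_ _ N (D.S i)).inv) ≫ F ▷ D.S i := by
    rw [MonoidalCategory.whiskerLeft_comp, Category.assoc, hF, ← D.whiskerLeft_iota_gamma]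
    simp only [tensorFamily, braidFamily]
    monoidal
  rw [h, ← closeRight_comp]
  monoidal

theorem Choices.whiskerLeft_inj_comp {X M W : C} {w : HalfFamily W} {F : M ⊗ D.indObj X ⟶ W}
    (hF : Intertwines (revBraidFamily M ⊠ D.gamma X) w F) (i : D.I) :
    M ◁ D.inj X i ≫ F = D.sqrtDim i • (𝟙 _ ⊗≫ (β_ M (D.S i)).hom ▷ (X ⊗ (D.S i)ᘁ) ⊗≫
      closeRight (D.S i ◁ (M ◁ D.iota X ≫ F) ≫ w (D.S i))) := by
  rw [D.inj_eq, MonoidalLinear.whiskerLeft_smul, Linear.smul_comp, whiskerLeft_closeRight]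
  congr 1
  have h : D.S i ◁ (M ◁ D.iota X ≫ F) ≫ w (D.S i) =
      ((α_ (D.S i) M X).inv ≫ (β_ M (D.S i)).inv ▷ X ≫ (α_ M (D.S i) X).hom ≫
        M ◁ D.kappa X (D.S i) ≫ (α_ M _ (D.S i)).inv) ≫ F ▷ D.S i := by
    rw [MonoidalCategory.whiskerLeft_comp, Category.assoc, hF, ← D.whiskerLeft_iota_gamma]
    simp only [tensorFamily, revBraidFamily]
    calc
      _ = 𝟙 _ ⊗≫ ((D.S i ⊗ M) ◁ D.iota X ≫ (β_ M (D.S i)).inv ▷ D.indObj X) ⊗≫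
          M ◁ D.gamma X (D.S i) ⊗≫ F ▷ D.S i := by monoidal
      _ = _ := by rw [whisker_exchange]; monoidal
  rw [h, ← closeRight_comp]
  monoidal

theorem Choices.whiskerRight_indObj_hom_ext {A X W : C} {f g : D.indObj X ⊗ A ⟶ W}
    (h : ∀ i, D.inj X i ▷ A ≫ f = D.inj X i ▷ A ≫ g) : f = g := by
  have key : 𝟙 (D.indObj X ⊗ A) = ∑ i, D.prj X i ▷ A ≫ D.inj X i ▷ A := by
    rw [← id_whiskerRight, ← biproduct.total, sum_whiskerRight]
    simp only [comp_whiskerRight]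
  rw [← Category.id_comp f, ← Category.id_comp g, key, Preadditive.sum_comp, Preadditive.sum_comp]
  simp [h]

theorem Choices.inj_prj_sum_whiskerRight {X W : C} (A : C) (i : D.I)
    (f : ∀ j, (D.S j ⊗ X ⊗ (D.S j)ᘁ) ⊗ A ⟶ W) :
    D.inj X i ▷ A ≫ ∑ j, D.prj X j ▷ A ≫ f j = f i := by
  classical
  rw [Preadditive.comp_sum, Finset.sum_eq_single i]
  · rw [← Category.assoc, ← comp_whiskerRight, biproduct.ι_π_self]
    simp
  · intro j _ hj
    rw [← Category.assoc, ← comp_whiskerRight, biproduct.ι_π_ne _ hj.symm]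
    simp
  · simp

/-- The abstract extension and the explicit unit constraint agree on each summand; the factor √dᵢ
comes from the summand inclusion. -/
theorem Choices.actL_eq {X : C} {σ : HalfFamily X} (hσ : IsHalf σ) :
    D.actL c σ = ∑ i, (c * D.sqrtDim i) •
    (D.prj (𝟙_ C) i ▷ X ⊗≫
      D.S i ◁ (β_ ((D.S i)ᘁ : C) X).hom ⊗≫ σ (D.S i) ▷ (D.S i)ᘁ ⊗≫
      X ◁ evTilde (D.S i) ⊗≫ 𝟙 X) := by
  refine D.whiskerRight_indObj_hom_ext fun i => ?_
  have h1 : (∑ i, (c * D.sqrtDim i) • (D.prj (𝟙_ C) i ▷ X ⊗≫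
      D.S i ◁ (β_ ((D.S i)ᘁ : C) X).hom ⊗≫ σ (D.S i) ▷ (D.S i)ᘁ ⊗≫
      X ◁ evTilde (D.S i) ⊗≫ 𝟙 X)) = ∑ i, D.prj (𝟙_ C) i ▷ X ≫ ((c * D.sqrtDim i) •
      (𝟙 _ ⊗≫ D.S i ◁ (β_ ((D.S i)ᘁ : C) X).hom ⊗≫ σ (D.S i) ▷ (D.S i)ᘁ ⊗≫
      X ◁ evTilde (D.S i) ⊗≫ 𝟙 X)) := by
    refine Finset.sum_congr rfl fun i _ => ?_
    rw [Linear.comp_smul]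
    congr 1
    monoidal
  rw [h1, D.inj_prj_sum_whiskerRight X i (fun i => (c * D.sqrtDim i) •
      (𝟙 _ ⊗≫ D.S i ◁ (β_ ((D.S i)ᘁ : C) X).hom ⊗≫ σ (D.S i) ▷ (D.S i)ᘁ ⊗≫
      X ◁ evTilde (D.S i) ⊗≫ 𝟙 X)), D.inj_whiskerRight_comp (D.actL_left hσ c), D.iota_actL hσ,
      mul_comm, mul_smul]
  congr 1
  simp only [closeRight, monoidalComp, MonoidalLinear.smul_whiskerRight,
    MonoidalLinear.whiskerLeft_smul, Linear.smul_comp, Linear.comp_smul]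
  congr 1
  monoidal

theorem Choices.actR_eq {X : C} {σ : HalfFamily X} (hσ : IsHalf σ) :
    D.actR c σ = ∑ i, (c * D.sqrtDim i) •
    (X ◁ D.prj (𝟙_ C) i ⊗≫
      (β_ X (D.S i)).hom ▷ (D.S i)ᘁ ⊗≫ σ (D.S i) ▷ (D.S i)ᘁ ⊗≫
      X ◁ evTilde (D.S i) ⊗≫ 𝟙 X) := by
  refine D.whisker_indObj_hom_ext fun i => ?_
  have h1 : (∑ i, (c * D.sqrtDim i) • (X ◁ D.prj (𝟙_ C) i ⊗≫
      (β_ X (D.S i)).hom ▷ (D.S i)ᘁ ⊗≫ σ (D.S i) ▷ (D.S i)ᘁ ⊗≫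
      X ◁ evTilde (D.S i) ⊗≫ 𝟙 X)) = ∑ i, X ◁ D.prj (𝟙_ C) i ≫ ((c * D.sqrtDim i) •
      (𝟙 _ ⊗≫ (β_ X (D.S i)).hom ▷ (D.S i)ᘁ ⊗≫ σ (D.S i) ▷ (D.S i)ᘁ ⊗≫
      X ◁ evTilde (D.S i) ⊗≫ 𝟙 X)) := by
    refine Finset.sum_congr rfl fun i _ => ?_
    rw [Linear.comp_smul]
    congr 1
    monoidal
  rw [h1, D.whisker_inj_prj_sum X i (fun i => (c * D.sqrtDim i) •
      (𝟙 _ ⊗≫ (β_ X (D.S i)).hom ▷ (D.S i)ᘁ ⊗≫ σ (D.S i) ▷ (D.S i)ᘁ ⊗≫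
      X ◁ evTilde (D.S i) ⊗≫ 𝟙 X)), D.whiskerLeft_inj_comp (D.actR_right hσ c), D.iota_actR hσ,
      mul_comm, mul_smul]
  congr 1
  simp only [closeRight, monoidalComp, MonoidalLinear.smul_whiskerRight,
    MonoidalLinear.whiskerLeft_smul, Linear.smul_comp, Linear.comp_smul]
  congr 1
  monoidal

/-- Closing both strands U and T pivotally turns ψ into its transpose; agreement with the dual
vertex in J is `dualVertex_eq`. -/
theorem closeRight_flank_dualVertex {S T U W Z : C} (φ : U ⊗ T ⟶ S) (ψ : S ⟶ U ⊗ T)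
    (g : S ⊗ W ⊗ Sᘁ ⟶ Z) :
    closeRight (𝟙 (U ⊗ T ⊗ W ⊗ Tᘁ) ⊗≫ (flank W φ ψ ≫ g ▷ (U ⊗ T)) ▷ Tᘁ ⊗≫
      (Z ⊗ U) ◁ evTilde T ⊗≫ 𝟙 _) =
      𝟙 _ ⊗≫ (φ ⊗ₘ (W ◁ dualVertex ψ)) ≫ g := by
  rw [dualVertex_eq, flank, closeRight, MonoidalCategory.tensorHom_def]
  calc
    _ = 𝟙 _ ⊗≫ φ ▷ (W ⊗ Tᘁ ⊗ Uᘁ) ⊗≫ (S ⊗ W) ◁ (coevTilde S ≫ Sᘁ ◁ ψ) ▷ (Tᘁ ⊗ Uᘁ : C) ⊗≫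
        (g ▷ ((U ⊗ T) ⊗ (Tᘁ ⊗ Uᘁ)) ≫ Z ◁ evTildeTensor U T) ⊗≫ 𝟙 _ := by
      rw [evTildeTensor]; monoidal
    _ = _ := by rw [← whisker_exchange]; monoidal

/-- With X already at the generator, the multiplication is an extension in the second variable only,
so the summand formula produces the braiding of X past Sⱼ found in J. -/
theorem Choices.whiskerLeft_inj_mul (X Y : C) (j : D.I) :
    X ◁ D.inj Y j ≫ D.iota X ▷ D.indObj Y ≫ D.mul c X Y =
      c • (𝟙 _ ⊗≫ (β_ X (D.S j)).hom ▷ (Y ⊗ (D.S j)ᘁ) ⊗≫ D.inj (X ⊗ Y) j) := by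
  have h := ((intertwines_revBraidFamily (D.iota X)).whiskerRight (D.gamma Y)).comp (D.mul_right c)
  have h2 : X ◁ D.iota Y ≫ D.iota X ▷ D.indObj Y ≫ D.mul c X Y = c • D.iota (X ⊗ Y) := by
    rw [← D.iota_iota_mul, MonoidalCategory.tensorHom_def', Category.assoc]
  rw [D.whiskerLeft_inj_comp h, h2, MonoidalLinear.whiskerLeft_smul, Linear.smul_comp,
    D.whiskerLeft_iota_gamma, D.inj_eq (X ⊗ Y)]
  simp only [closeRight, monoidalComp, MonoidalLinear.smul_whiskerRight, Linear.smul_comp,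
    Linear.comp_smul]
  rw [smul_comm]

theorem Choices.closeRight_inj_gamma (W : C) (i j : D.I) :
    closeRight (D.S i ◁ D.inj W j ≫ D.gamma W (D.S i)) =
      ∑ l, (D.sqrtDim j * D.sqrtDim l) • ∑ a, (𝟙 (D.S i ⊗ (D.S j ⊗ W ⊗ (D.S j)ᘁ) ⊗ (D.S i)ᘁ) ⊗≫
        ((D.bases (D.S i) j l).φ a ⊗ₘ (W ◁ dualVertex ((D.bases (D.S i) j l).ψ a))) ≫
        D.inj W l) := by
  rw [D.whisker_inj_gamma_eq, D.kappa_eq W (D.S i ⊗ D.S j) (fun l => D.bases (D.S i) j l)]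
  simp only [← closeRight_flank_dualVertex]
  simp only [mul_smul, ← Finset.smul_sum]
  simp [closeRight, monoidalComp, sum_whiskerRight, whiskerLeft_sum, Preadditive.sum_comp,
    Preadditive.comp_sum, Finset.smul_sum]

/-- The scalar collects √dᵢ from the first summand, c from the value on ι ⊗ ι, and √dⱼ √dₗ from the
component of Γ at Sᵢ; that component also supplies the dual bases in J. -/
theorem Choices.inj_mul (X Y : C) (i j : D.I) :
    (D.inj X i ⊗ₘ D.inj Y j) ≫ D.mul c X Y =
      ∑ l, (c * D.sqrtDim i * D.sqrtDim j * D.sqrtDim l) • (D.muComponent X Y i j l ≫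
        D.inj (X ⊗ Y) l) := by
  have h1 := D.closeRight_inj_gamma (X ⊗ Y) i j
  rw [MonoidalCategory.tensorHom_def', Category.assoc, D.inj_whiskerRight_comp (D.mul_left c),
    Linear.comp_smul]
  have h2 : (D.S i ⊗ X ⊗ (D.S i)ᘁ) ◁ D.inj Y j ≫ (𝟙 ((D.S i ⊗ X ⊗ (D.S i)ᘁ) ⊗ D.indObj Y) ⊗≫
      (D.S i ⊗ X) ◁ (β_ ((D.S i)ᘁ : C) (D.indObj Y)).hom ⊗≫
      closeRight (D.S i ◁ (D.iota X ▷ D.indObj Y ≫ D.mul c X Y) ≫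
        D.gamma (X ⊗ Y) (D.S i))) =
      c • (𝟙 _ ⊗≫ (D.S i ⊗ X) ◁ (β_ ((D.S i)ᘁ : C) (D.S j ⊗ Y ⊗ (D.S j)ᘁ)).hom ⊗≫
        D.S i ◁ (β_ X (D.S j)).hom ▷ (Y ⊗ (D.S j)ᘁ ⊗ (D.S i)ᘁ) ⊗≫
        closeRight (D.S i ◁ D.inj (X ⊗ Y) j ≫ D.gamma (X ⊗ Y) (D.S i))) := by
    calc
      _ = 𝟙 _ ⊗≫ (D.S i ⊗ X) ◁ ((D.S i)ᘁ ◁ D.inj Y j ≫ (β_ ((D.S i)ᘁ : C) (D.indObj Y)).hom) ⊗≫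
          closeRight (D.S i ◁ (D.iota X ▷ D.indObj Y ≫ D.mul c X Y) ≫
            D.gamma (X ⊗ Y) (D.S i)) := by monoidal
      _ = 𝟙 _ ⊗≫ (D.S i ⊗ X) ◁ (β_ ((D.S i)ᘁ : C) (D.S j ⊗ Y ⊗ (D.S j)ᘁ)).hom ⊗≫
          (D.S i ◁ (X ◁ D.inj Y j) ▷ (D.S i)ᘁ ≫
          closeRight (D.S i ◁ (D.iota X ▷ D.indObj Y ≫ D.mul c X Y) ≫
            D.gamma (X ⊗ Y) (D.S i))) := by
        rw [BraidedCategory.braiding_naturality_right]; monoidal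
      _ = 𝟙 _ ⊗≫ (D.S i ⊗ X) ◁ (β_ ((D.S i)ᘁ : C) (D.S j ⊗ Y ⊗ (D.S j)ᘁ)).hom ⊗≫
          closeRight (c • (D.S i ◁ (𝟙 _ ⊗≫ (β_ X (D.S j)).hom ▷ (Y ⊗ (D.S j)ᘁ) ⊗≫
            D.inj (X ⊗ Y) j) ≫ D.gamma (X ⊗ Y) (D.S i))) := by
        rw [whisker_closeRight, ← Category.assoc, ← MonoidalCategory.whiskerLeft_comp,
          D.whiskerLeft_inj_mul, MonoidalLinear.whiskerLeft_smul, Linear.smul_comp]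
      _ = _ := by
        simp only [closeRight, monoidalComp, MonoidalLinear.smul_whiskerRight,
          MonoidalLinear.whiskerLeft_smul, Linear.smul_comp, Linear.comp_smul]
        congr 1
        monoidal
  rw [h2, h1]
  simp only [muComponent, smul_smul]
  simp only [monoidalComp, Preadditive.sum_comp, Preadditive.comp_sum, Linear.smul_comp,
    Linear.comp_smul, Finset.smul_sum, smul_smul, Category.assoc]
  refine Finset.sum_congr rfl fun l _ => Finset.sum_congr rfl fun a _ => ?_
  congr 1
  · ring
  · generalize ((D.bases (D.S i) j l).φ a ⊗ₘ
      ((X ⊗ Y) ◁ dualVertex ((D.bases (D.S i) j l).ψ a))) = m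
    monoidal

theorem Choices.mul_eq (X Y : C) :
    D.mul c X Y = ∑ i, ∑ j, ∑ l, (c * D.sqrtDim i * D.sqrtDim j * D.sqrtDim l) •
      ((D.prj X i ⊗ₘ D.prj Y j) ≫ D.muComponent X Y i j l ≫ D.inj (X ⊗ Y) l) := by
  have key : 𝟙 (D.indObj X ⊗ D.indObj Y) =
      ∑ i, ∑ j, (D.prj X i ⊗ₘ D.prj Y j) ≫ (D.inj X i ⊗ₘ D.inj Y j) := by
    rw [← MonoidalCategory.id_tensorHom_id, ← biproduct.total, ← biproduct.total, sum_tensor]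
    refine Finset.sum_congr rfl fun i _ => ?_
    rw [tensor_sum]
    simp only [MonoidalCategory.tensorHom_comp_tensorHom]
  rw [← Category.id_comp (D.mul c X Y), key]
  simp only [Preadditive.sum_comp, Category.assoc, D.inj_mul, Preadditive.comp_sum,
    Linear.comp_smul]

end Multiplication
end
end EllipticCenter



namespace EllipticCenter

noncomputable section

attribute [local instance] Abelian.hasFiniteBiproducts

/-! ### The monoidal structure and the monoidal functor -/

section CenterFamily

variable {C : Type u} [Category.{v} C] [MonoidalCategory C]

theorem centerFamily_unit : centerFamily (𝟙_ (Center C)) = unitFamily := by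
  funext A
  simp [centerFamily, unitFamily]
  rfl

theorem centerFamily_tensor (X Y : Center C) :
    centerFamily (X ⊗ Y) = centerFamily X ⊠ centerFamily Y := by
  funext A
  simp only [centerFamily, tensorFamily, Center.tensor_β]
  simp

end CenterFamily

section Final

set_option linter.unusedSectionVars false
set_option linter.unusedSimpArgs false

variable {k : Type w} [Field k] [IsAlgClosed k]
  {C : Type u} [Category.{v} C] [Abelian C] [Linear k C] [MonoidalCategory C]
  [MonoidalPreadditive C] [MonoidalLinear k C] [RigidCategory C] [BraidedCategory C]
  [RibbonCategory C] [FusionCategory k C] {D : Choices k C}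

theorem ZEl.fst_isHalf (P : ZEl C) : IsHalf P.fst :=
  isHalfBraiding_iff.1 P.isElliptic.fst_isHalfBraiding

theorem ZEl.snd_isHalf (P : ZEl C) : IsHalf P.snd :=
  isHalfBraiding_iff.1 P.isElliptic.snd_isHalfBraiding

theorem ZEl.exchange (P : ZEl C) : Exchange revBraidFamily braidFamily P.fst P.snd :=
  comm_iff_exchange.1 P.isElliptic.comm

theorem Choices.leftUnitMap_eq (c : k) (P : ZEl C) :
    D.leftUnitMap c P.toEllipticDatum = D.redLeft c P.fst := by
  rw [redLeft, D.actL_eq c P.fst_isHalf]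
  rfl

theorem Choices.rightUnitMap_eq (c : k) (P : ZEl C) :
    D.rightUnitMap c P.toEllipticDatum = D.redRight c P.fst := by
  rw [redRight, D.actR_eq c P.fst_isHalf]
  rfl

theorem Choices.J_eq (c : k) (X Y : Center C) : D.J c X Y = D.redMul c X.1 Y.1 := by
  rw [redMul, D.mul_eq]
  rfl

theorem Choices.indMap_id (D : Choices k C) (X : C) : D.indMap (𝟙 X) = 𝟙 (D.indObj X) :=
  biproduct.hom_ext _ _ fun i => by simp [indMap]

theorem Choices.unitDatum_snd :
    D.unitDatum.snd = (D.tilde unitFamily : HalfFamily (D.indObj (𝟙_ C))) := by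
  rw [← centerFamily_unit]
  rfl

variable (hD : D.globalDim ≠ 0)

include hD

theorem Choices.tensorWellDefined {c : k} (hc : c ≠ 0) : D.TensorWellDefined c where
  tensorObj P R :=
    { fst_isHalfBraiding := isHalfBraiding_iff.2 (redFst_isHalf hD P.fst_isHalf R.fst_isHalf)
      snd_isHalfBraiding := isHalfBraiding_iff.2 (redSnd_isHalf hD P.fst_isHalf R.fst_isHalf
        P.exchange R.exchange P.snd_isHalf R.snd_isHalf)
      comm := comm_iff_exchange.2 (red_exchange hD P.fst_isHalf R.fst_isHalf P.exchange) }
  tensorHom_fst {P P' R R'} f g := redMap_fst hD P.fst_isHalf R.fst_isHalf P'.fst_isHalf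
    R'.fst_isHalf f.fst_comm
  tensorHom_snd {P P' R R'} f g := redMap_snd hD P.fst_isHalf R.fst_isHalf P.exchange R.exchange
    P'.fst_isHalf R'.fst_isHalf P'.exchange R'.exchange f.snd_comm g.snd_comm
  associator P R T :=
    { isIso := redAssoc_isIso hD P.fst_isHalf R.fst_isHalf T.fst_isHalf
      fst_comm := redAssoc_fst hD P.fst_isHalf R.fst_isHalf T.fst_isHalf
      snd_comm := redAssoc_snd hD P.fst_isHalf R.fst_isHalf T.fst_isHalf P.exchange R.exchange
        T.exchange }
  leftUnitor P := by
    rw [leftUnitMap_eq]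
    refine ⟨redLeft_isIso P.fst_isHalf hD hc, redLeft_fst P.fst_isHalf hD c, ?_⟩
    have := redLeft_snd P.fst_isHalf hD c P.exchange
    rw [← unitDatum_snd] at this
    exact this
  rightUnitor P := by
    rw [rightUnitMap_eq]
    refine ⟨redRight_isIso P.fst_isHalf hD hc, redRight_fst P.fst_isHalf hD c, ?_⟩
    have := redRight_snd P.fst_isHalf hD c P.exchange
    rw [← unitDatum_snd] at this
    exact this

variable {c : k} (hI : D.InductionWellDefined) (hT : D.TensorWellDefined c)

/-- The monoidal structure on the elliptic Drinfeld center. -/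
abbrev Choices.zelMonoidal : MonoidalCategory (ZEl C) :=
  { Choices.zelStruct hI hT with
    tensorHom_def := fun {P₁ P₂ R₁ R₂} f g => ZEl.Hom.ext (by
      symm
      refine (redMap_comp hD P₁.fst_isHalf R₁.fst_isHalf f.fst_comm (.id _)).trans ?_
      rw [Category.comp_id, Category.id_comp]
      rfl)
    id_tensorHom_id := fun P R => ZEl.Hom.ext (redMap_id hD P.fst_isHalf R.fst_isHalf)
    tensorHom_comp_tensorHom := fun {P₁ _ _ R₁ _ _} f g _ _ => ZEl.Hom.ext
      (redMap_comp hD P₁.fst_isHalf R₁.fst_isHalf f.fst_comm g.fst_comm)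
    whiskerLeft_id := fun P R => ZEl.Hom.ext (redMap_id hD P.fst_isHalf R.fst_isHalf)
    id_whiskerRight := fun P R => ZEl.Hom.ext (redMap_id hD P.fst_isHalf R.fst_isHalf)
    associator_naturality := fun {P₁ P₂ P₃ R₁ R₂ R₃} f g h => ZEl.Hom.ext
      (redAssoc_naturality hD P₁.fst_isHalf P₂.fst_isHalf P₃.fst_isHalf R₁.fst_isHalf
        R₂.fst_isHalf R₃.fst_isHalf f.fst_comm g.fst_comm h.fst_comm)
    leftUnitor_naturality := fun {P R} f => ZEl.Hom.ext (by
      change D.redMap (D.gamma (𝟙_ C)) P.fst (D.gamma (𝟙_ C)) R.fst (𝟙 _) f.f ≫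
        D.leftUnitMap c R.toEllipticDatum = D.leftUnitMap c P.toEllipticDatum ≫ f.f
      rw [leftUnitMap_eq, leftUnitMap_eq]
      exact redLeft_naturality P.fst_isHalf hD R.fst_isHalf c f.fst_comm)
    rightUnitor_naturality := fun {P R} f => ZEl.Hom.ext (by
      change D.redMap P.fst (D.gamma (𝟙_ C)) R.fst (D.gamma (𝟙_ C)) f.f (𝟙 _) ≫
        D.rightUnitMap c R.toEllipticDatum = D.rightUnitMap c P.toEllipticDatum ≫ f.f
      rw [rightUnitMap_eq, rightUnitMap_eq]
      exact redRight_naturality P.fst_isHalf hD R.fst_isHalf c f.fst_comm)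
    pentagon := fun P R T V => ZEl.Hom.ext
      (red_pentagon hD P.fst_isHalf R.fst_isHalf T.fst_isHalf V.fst_isHalf)
    triangle := fun P R => ZEl.Hom.ext (by
      change D.redAssoc P.fst (D.gamma (𝟙_ C)) R.fst ≫
        D.redMap P.fst (D.redFst (D.gamma (𝟙_ C)) R.fst) P.fst R.fst (𝟙 _)
          (D.leftUnitMap c R.toEllipticDatum) =
        D.redMap (D.redFst P.fst (D.gamma (𝟙_ C))) R.fst P.fst R.fst
          (D.rightUnitMap c P.toEllipticDatum) (𝟙 _)
      rw [leftUnitMap_eq, rightUnitMap_eq]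
      exact red_triangle hD P.fst_isHalf R.fst_isHalf c) }

theorem Choices.J_isDatumIso (hc : c ≠ 0) (X Y : Center C) :
    IsDatumIso (D.tensorDatum (D.ind X) (D.ind Y)) (D.ind (X ⊗ Y)) (D.J c X Y) := by
  rw [J_eq]
  refine ⟨redMul_isIso hD hc, redMul_fst c hD, ?_⟩
  have := redMul_snd c hD (centerFamily X) (centerFamily Y)
  rw [← centerFamily_tensor] at this
  exact this

theorem Choices.redMul_naturality {X X' Y Y' : C} (f : X ⟶ X') (g : Y ⟶ Y') :
    D.redMap (D.gamma X) (D.gamma Y) (D.gamma X') (D.gamma Y') (D.indMap f) (D.indMap g) ≫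
      D.redMul c X' Y' = D.redMul c X Y ≫ D.indMap (f ⊗ₘ g) := by
  rw [redMul, redMul, ← Category.assoc, redMap_incl hD (D.gamma_isHalf _)
    (D.gamma_isHalf _) (D.indMap_gamma _) (D.indMap_gamma _), Category.assoc, D.mul_naturality,
    Category.assoc]

theorem Choices.redMul_associativity (X Y Z : C) :
    D.redMap (D.redFst (D.gamma X) (D.gamma Y)) (D.gamma Z) (D.gamma (X ⊗ Y)) (D.gamma Z)
      (D.redMul c X Y) (𝟙 (D.indObj Z)) ≫ D.redMul c (X ⊗ Y) Z ≫ D.indMap (α_ X Y Z).hom =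
    D.redAssoc (D.gamma X) (D.gamma Y) (D.gamma Z) ≫
      D.redMap (D.gamma X) (D.redFst (D.gamma Y) (D.gamma Z)) (D.gamma X) (D.gamma (Y ⊗ Z))
        (𝟙 (D.indObj X)) (D.redMul c Y Z) ≫ D.redMul c X (Y ⊗ Z) := by
  have hX := D.gamma_isHalf X
  have hY := D.gamma_isHalf Y
  have hZ := D.gamma_isHalf Z
  have a := redAssoc_incl hD hX hY hZ
  have m1 := redMap_incl hD (redFst_isHalf hD hX hY) hZ (redMul_fst c hD) (.id _)
  have m2 := redMap_incl hD hX (redFst_isHalf hD hY hZ) (.id _) (redMul_fst c hD)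
  have e := D.mul_associativity c (X := X) (Y := Y) (Z := Z)
  calc
    _ = (D.redMap (D.redFst (D.gamma X) (D.gamma Y)) (D.gamma Z) (D.gamma (X ⊗ Y))
        (D.gamma Z) (D.redMul c X Y) (𝟙 (D.indObj Z)) ≫
        D.incl (D.gamma (X ⊗ Y)) (D.gamma Z)) ≫ D.mul c (X ⊗ Y) Z ≫
        D.indMap (α_ X Y Z).hom := by
      simp [redMul]
    _ = D.incl (D.redFst (D.gamma X) (D.gamma Y)) (D.gamma Z) ≫
        D.incl (D.gamma X) (D.gamma Y) ▷ _ ≫ D.mul c X Y ▷ _ ≫ D.mul c (X ⊗ Y) Z ≫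
        D.indMap (α_ X Y Z).hom := by
      rw [m1]; simp [redMul]
    _ = (D.redAssoc (D.gamma X) (D.gamma Y) (D.gamma Z) ≫
        D.incl (D.gamma X) (D.redFst (D.gamma Y) (D.gamma Z)) ≫
        D.indObj X ◁ D.incl (D.gamma Y) (D.gamma Z)) ≫ D.indObj X ◁ D.mul c Y Z ≫
        D.mul c X (Y ⊗ Z) := by
      rw [a, e]; simp
    _ = D.redAssoc (D.gamma X) (D.gamma Y) (D.gamma Z) ≫
        (D.redMap (D.gamma X) (D.redFst (D.gamma Y) (D.gamma Z)) (D.gamma X)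
        (D.gamma (Y ⊗ Z)) (𝟙 (D.indObj X)) (D.redMul c Y Z) ≫
        D.incl (D.gamma X) (D.gamma (Y ⊗ Z))) ≫ D.mul c X (Y ⊗ Z) := by
      rw [m2]; simp [redMul]
    _ = _ := by simp [redMul]

theorem Choices.J_whiskerRight {X X' : Center C} (f : X ⟶ X') (Y : Center C) :
    D.tensorMap (P := D.ind X) (P' := D.ind X') (R := D.ind Y) (R' := D.ind Y) (D.indMap f.f)
      (𝟙 (D.indObj Y.1)) ≫ D.J c X' Y = D.J c X Y ≫ D.indMap (f ▷ Y).f := by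
  rw [J_eq, J_eq, ← D.indMap_id]
  refine (redMul_naturality hD f.f (𝟙 Y.1)).trans ?_
  rw [MonoidalCategory.tensorHom_id]
  rfl

theorem Choices.J_whiskerLeft (X : Center C) {Y Y' : Center C} (g : Y ⟶ Y') :
    D.tensorMap (P := D.ind X) (P' := D.ind X) (R := D.ind Y) (R' := D.ind Y') (𝟙 (D.indObj X.1))
      (D.indMap g.f) ≫ D.J c X Y' = D.J c X Y ≫ D.indMap (X ◁ g).f := by
  rw [J_eq, J_eq, ← D.indMap_id]
  refine (redMul_naturality hD (𝟙 X.1) g.f).trans ?_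
  rw [MonoidalCategory.id_tensorHom]
  rfl

theorem Choices.J_associativity (X Y Z : Center C) :
    D.tensorMap (P := D.tensorDatum (D.ind X) (D.ind Y)) (P' := D.ind (X ⊗ Y)) (R := D.ind Z)
      (R' := D.ind Z) (D.J c X Y) (𝟙 (D.indObj Z.1)) ≫ D.J c (X ⊗ Y) Z ≫
      D.indMap (α_ X Y Z).hom.f =
    D.assocMap (D.ind X) (D.ind Y) (D.ind Z) ≫
      D.tensorMap (P := D.ind X) (P' := D.ind X) (R := D.tensorDatum (D.ind Y) (D.ind Z))
        (R' := D.ind (Y ⊗ Z)) (𝟙 (D.indObj X.1)) (D.J c Y Z) ≫ D.J c X (Y ⊗ Z) := by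
  rw [J_eq, J_eq, J_eq, J_eq]
  exact redMul_associativity hD X.1 Y.1 Z.1

theorem Choices.leftUnitMap_ind (X : Center C) :
    D.leftUnitMap c (D.ind X) =
      D.redMap (D.gamma (𝟙_ C)) (D.gamma X.1) (D.gamma (𝟙_ C)) (D.gamma X.1) (𝟙 _) (𝟙 _) ≫
        D.J c (𝟙_ (Center C)) X ≫ D.indMap (λ_ X.1).hom := by
  rw [redMap_id hD (D.gamma_isHalf _) (D.gamma_isHalf _), Category.id_comp, J_eq]
  change D.leftUnitMap c (⟨D.ind X, D.inductionWellDefined.obj X⟩ : ZEl C).toEllipticDatum =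
    D.redMul c (𝟙_ C) X.1 ≫ D.indMap (λ_ X.1).hom
  rw [leftUnitMap_eq, redMul, Category.assoc, ← D.mul_leftUnitality]
  rfl

theorem Choices.rightUnitMap_ind (X : Center C) :
    D.rightUnitMap c (D.ind X) =
      D.redMap (D.gamma X.1) (D.gamma (𝟙_ C)) (D.gamma X.1) (D.gamma (𝟙_ C)) (𝟙 _) (𝟙 _) ≫
        D.J c X (𝟙_ (Center C)) ≫ D.indMap (ρ_ X.1).hom := by
  rw [redMap_id hD (D.gamma_isHalf _) (D.gamma_isHalf _), Category.id_comp, J_eq]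
  change D.rightUnitMap c (⟨D.ind X, D.inductionWellDefined.obj X⟩ : ZEl C).toEllipticDatum =
    D.redMul c X.1 (𝟙_ C) ≫ D.indMap (ρ_ X.1).hom
  rw [rightUnitMap_eq, redMul, Category.assoc, ← D.mul_rightUnitality]
  rfl

end Final
end
end EllipticCenter

theorem mainTheorem8 {k : Type w} [Field k] [IsAlgClosed k] [CharZero k]
    {C : Type u} [Category.{v} C] [Abelian C] [Linear k C] [MonoidalCategory C]
    [MonoidalPreadditive C] [MonoidalLinear k C] [RigidCategory C] [BraidedCategory C]
    [EllipticCenter.RibbonCategory C] [EllipticCenter.FusionCategory k C]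
    (D : EllipticCenter.Choices k C) (hD : D.globalDim ≠ 0) (c : k) (hc : c ≠ 0) :
    ∃ (hI : D.InductionWellDefined) (hT : D.TensorWellDefined c)
      (hM : ∃ M : MonoidalCategory (EllipticCenter.ZEl C),
        M.toMonoidalCategoryStruct = EllipticCenter.Choices.zelStruct hI hT),
      letI := EllipticCenter.monoidalOfStruct (EllipticCenter.Choices.zelStruct hI hT) hM
      ∃ F : (EllipticCenter.Choices.inductionFunctor hI).Monoidal,
        F.ε = 𝟙 (𝟙_ (EllipticCenter.ZEl C)) ∧
        ∀ X Y : Center C, (F.μ X Y).f = D.J c X Y := by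
  have hI := D.inductionWellDefined
  have hT := EllipticCenter.Choices.tensorWellDefined hD hc
  refine ⟨hI, hT, ⟨EllipticCenter.Choices.zelMonoidal hD hI hT, rfl⟩, ?_⟩
  let _ := EllipticCenter.monoidalOfStruct (EllipticCenter.Choices.zelStruct hI hT)
    ⟨EllipticCenter.Choices.zelMonoidal hD hI hT, rfl⟩
  let G : (EllipticCenter.Choices.inductionFunctor hI).CoreMonoidal :=
    -- The tensor unit is I₁(𝟙) by definition, so the identity has the required source and target;
    -- the remaining fields reduce to identities between underlying morphisms of C.
    { εIso := Iso.refl (𝟙_ (EllipticCenter.ZEl C))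
      μIso := fun X Y => EllipticCenter.ZEl.isoMk (D.J c X Y)
        (EllipticCenter.Choices.J_isDatumIso hD hc X Y)
      μIso_hom_natural_left := fun f Y => EllipticCenter.ZEl.Hom.ext
        (EllipticCenter.Choices.J_whiskerRight hD f Y)
      μIso_hom_natural_right := fun X g => EllipticCenter.ZEl.Hom.ext
        (EllipticCenter.Choices.J_whiskerLeft hD X g)
      associativity := fun X Y Z => EllipticCenter.ZEl.Hom.ext
        (EllipticCenter.Choices.J_associativity hD X Y Z)
      left_unitality := fun X => EllipticCenter.ZEl.Hom.ext
        (EllipticCenter.Choices.leftUnitMap_ind hD X)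
      right_unitality := fun X => EllipticCenter.ZEl.Hom.ext
        (EllipticCenter.Choices.rightUnitMap_ind hD X) }
  exact ⟨G.toMonoidal, rfl, fun X Y => rfl⟩
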